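/- Let $k$ be a field. A word $n_1\ldots n_r$ over the integers is packed if its set of letters is $\{1,\ldots,m\}$ for some $m$; the packing $\mathrm{Pack}(n_1\ldots n_r)$ is the unique packed word $m_1\ldots m_r$ with $m_i<m_j\Leftrightarrow n_i<n_j$. A decorated packed word of length $r$ is a pair $(\sigma,d)$ of a packed word $\sigma=\sigma(1)\ldots\sigma(r)$ and a map $d:\{1,\ldots,r\}\to\mathbb{N}^*$. Let $\mathbf{QSh}^d_+$ be the $k$-vector space with basis the nonempty decorated packed words. For $(\sigma,d)$ of length $r$ and $(\tau,e)$ of length $l$, the products $(\sigma,d)\prec(\tau,e)$, $(\sigma,d)\succ(\tau,e)$ and $(\sigma,d)\bullet(\tau,e)$ are the sums of the decorated packed words $(u,(d(1),\ldots,d(r),e(1),\ldots,e(l)))$ over all packed words $u$ of length $r+l$ with $\mathrm{Pack}(u(1)\ldots u(r))=\sigma$, $\mathrm{Pack}(u(r+1)\ldots u(r+l))=\tau$ and, respectively, $\min(u(1)\ldots u(r))<$, $>$, $=\min(u(r+1)\ldots u(r+l))$. Put $\preceq\,=\,\prec+\bullet$, $\succeq\,=\,\succ+\bullet$, $\star=\prec+\succ+\bullet$.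 For $I\subseteq\{1,\ldots,\max(\sigma)\}$, $(\sigma,d)_{|I}$ is obtained by keeping only the columns of $(\sigma,d)$ whose letter lies in $I$ and packing the first row. Define $$\Delta_\prec(\sigma,d)=\sum_{i=\sigma(1)}^{\max(\sigma)-1}(\sigma,d)_{|\{1,\ldots,i\}}\otimes(\sigma,d)_{|\{i+1,\ldots,\max(\sigma)\}},\qquad \Delta_\succ(\sigma,d)=\sum_{i=1}^{\sigma(1)-1}(\sigma,d)_{|\{1,\ldots,i\}}\otimes(\sigma,d)_{|\{i+1,\ldots,\max(\sigma)\}},$$ and $\tilde\Delta=\Delta_\prec+\Delta_\succ$. Write $\tilde\Delta(a)=a'\otimes a''$, $\Delta_\prec(a)=a'_\prec\otimes a''_\prec$, $\Delta_\succ(a)=a'_\succ\otimes a''_\succ$. A noncommutative shuffle (NSh, or dendriform) algebra $(A,\prec,\succ)$ is a vector space with two bilinear products such that, with $xy=x\prec y+x\succ y$, $(x\prec y)\prec z=x\prec(yz)$, $(x\succ y)\prec z=x\succ(y\prec z)$ and $(xy)\succ z=x\succ(y\succ z)$. It is free if it has a subset $X$ such that every map from $X$ to an NSh algebra $B$ extends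 uniquely to a morphism of NSh algebras $A\to B$. A bidendriform bialgebra $(A,\prec,\succ,\Delta_\prec,\Delta_\succ)$ is an NSh algebra with linear maps $\Delta_\prec,\Delta_\succ:A\to A\otimes A$ such that, with $\tilde\Delta=\Delta_\prec+\Delta_\succ$, $$(\Delta_\prec\otimes Id)\Delta_\prec=(Id\otimes\tilde\Delta)\Delta_\prec,\quad(\Delta_\succ\otimes Id)\Delta_\prec=(Id\otimes\Delta_\prec)\Delta_\succ,\quad(\tilde\Delta\otimes Id)\Delta_\succ=(Id\otimes\Delta_\succ)\Delta_\succ,$$ and, for all $a,b\in A$, \begin{align*} \Delta_\succ(a\succ b)&=a'b'_\succ\otimes a''\succ b''_\succ+a'\otimes a''\succ b+b'_\succ\otimes a\succ b''_\succ+ab'_\succ\otimes b''_\succ+a\otimes b,\\ \Delta_\succ(a\prec b)&=a'b'_\succ\otimes a''\prec b''_\succ+a'\otimes a''\prec b+b'_\succ\otimes a\prec b''_\succ,\\ \Delta_\prec(a\succ b)&=a'b'_\prec\otimes a''\succ b''_\prec+ab'_\prec\otimes b''_\prec+b'_\prec\otimes a\succ b''_\prec,\\ \Delta_\prec(a\prec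 b)&=a'b'_\prec\otimes a''\prec b''_\prec+a'b\otimes a''+b'_\prec\otimes a\prec b''_\prec+b\otimes a. \end{align*} For a product write $x\cdot^{op}y=y\cdot x$, and for a coproduct let $\Delta^{op}$ be $\Delta$ followed by the exchange of the tensor factors. Then: (1) For all $a,b\in\mathbf{QSh}^d_+$, \begin{align*} \Delta_\prec(a\preceq b)&=a'_\prec\preceq b'\otimes a''_\prec\star b''+a'_\prec\preceq b\otimes a''_\prec+a'_\prec\otimes a''_\prec\star b+a\preceq b'\otimes b''+a\otimes b,\\ \Delta_\prec(a\succeq b)&=a'_\prec\succeq b'\otimes a''_\prec\star b''+a\succeq b'\otimes b''+a'_\prec\succeq b\otimes a''_\prec,\\ \Delta_\succ(a\preceq b)&=a'_\succ\preceq b'\otimes a''_\succ\star b''+a'_\succ\preceq b\otimes a''_\succ+a'_\succ\otimes a''_\succ\star b,\\ \Delta_\succ(a\succeq b)&=a'_\succ\succeq b'\otimes a''_\succ\star b''+a'_\succ\succeq b\otimes a''_\succ+b'\otimes a\star b''+b\otimes a,\\ \tilde\Delta(a\circ b)&=a'\circ b'\otimes a''\star b''+a'\circ b\otimes a''+a'\otimes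 a''\star b+a\circ b'\otimes b''+a\otimes b\quad(\circ\in\{\prec,\preceq\}),\\ \tilde\Delta(a\circ b)&=a'\circ b'\otimes a''\star b''+a'\circ b\otimes a''+a\circ b'\otimes b''+b'\otimes a\star b''+b\otimes a\quad(\circ\in\{\succ,\succeq\}),\\ \tilde\Delta(a\bullet b)&=a'\bullet b'\otimes a''\star b''+a'\bullet b\otimes a''+a\bullet b'\otimes b''. \end{align*} (2) $(\mathbf{QSh}^d_+,\succ^{op},\preceq^{op},\Delta_\succ^{op},\Delta_\prec^{op})$ and $(\mathbf{QSh}^d_+,\succeq^{op},\prec^{op},\Delta_\succ^{op},\Delta_\prec^{op})$ are bidendriform bialgebras. (3) $(\mathbf{QSh}^d_+,\preceq,\succ)$ and $(\mathbf{QSh}^d_+,\prec,\succeq)$ are free noncommutative shuffle (dendriform) algebras. -/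

import Mathlib

open scoped TensorProduct

/-! ### Decorated packed words -/

namespace QSh

/-- A word over the integers whose letters are decorated by positive integers. The list
`[(u 1, d 1), …, (u n, d n)]` stands for the two-row array with rows `u` and `d`. -/
abbrev DecWord : Type := List (ℕ × ℕ+)

/-- The set of letters (first row) of a decorated word. -/
def letterSet (l : DecWord) : Finset ℕ := (l.map Prod.fst).toFinset

/-- The smallest letter of a decorated word (`⊤` for the empty word). -/
def minLetter (l : DecWord) : WithTop ℕ := (letterSet l).min

/-- The largest letter of a decorated word (`0` for the empty word). -/
def maxLetter (l : DecWord) : ℕ := (letterSet l).sup id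

/-- The first row is packed: its set of letters is `{1, …, m}` for some `m`. -/
def IsPacked (l : DecWord) : Prop := ∃ m : ℕ, letterSet l = Finset.Icc 1 m

/-- Packing: each letter is replaced by its rank among the letters that occur in the word, the
decorations being kept. -/
def pack (l : DecWord) : DecWord :=
  l.map fun p => (((letterSet l).filter fun y => y ≤ p.1).card, p.2)

theorem isPacked_pack (l : DecWord) : IsPacked (pack l) := by
  refine ⟨(letterSet l).card, ?_⟩
  have himg : letterSet (pack l) =
      (letterSet l).image fun x => ((letterSet l).filter fun y => y ≤ x).card := by
    ext x
    simp [letterSet, pack]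
  rw [himg]
  apply Finset.eq_of_subset_of_card_le
  · intro c hc
    obtain ⟨x, hx, rfl⟩ := Finset.mem_image.1 hc
    rw [Finset.mem_Icc]
    refine ⟨Finset.card_pos.2 ⟨x, by simp [hx]⟩, Finset.card_le_card (Finset.filter_subset _ _)⟩
  · rw [Finset.card_image_of_injOn]
    · simp
    · intro x hx y hy hxy
      rcases lt_trichotomy x y with h | h | h
      · refine absurd hxy (ne_of_lt (Finset.card_lt_card ?_))
        rw [Finset.ssubset_iff_of_subset]
        · exact ⟨y, by simpa using hy, by simp [h]⟩
        · intro z hz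
          simp only [Finset.mem_filter] at hz ⊢
          exact ⟨hz.1, hz.2.trans h.le⟩
      · exact h
      · refine absurd hxy.symm (ne_of_lt (Finset.card_lt_card ?_))
        rw [Finset.ssubset_iff_of_subset]
        · exact ⟨x, by simpa using hx, by simp [h]⟩
        · intro z hz
          simp only [Finset.mem_filter] at hz ⊢
          exact ⟨hz.1, hz.2.trans h.le⟩

/-- Nonempty decorated packed words. -/
structure DPW : Type where
  word : DecWord
  ne_nil : word ≠ []
  packed : IsPacked word

/-- The set of decorated packed words `u` of length `k + l` (with `k`, `l` the lengths of `a`, `b`)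
such that the first `k` columns pack to `a`, the last `l` columns pack to `b`, and the minimum of
the first `k` letters is in the relation `R` to the minimum of the last `l` letters. -/
def quasiShuffles (R : WithTop ℕ → WithTop ℕ → Prop) (a b : DPW) : Set DPW :=
  {u | u.word.length = a.word.length + b.word.length ∧
    pack (u.word.take a.word.length) = a.word ∧
    pack (u.word.drop a.word.length) = b.word ∧
    R (minLetter (u.word.take a.word.length)) (minLetter (u.word.drop a.word.length))}

theorem pack_map_snd (l : DecWord) : (pack l).map Prod.snd = l.map Prod.snd := by
  simp [pack]

theorem IsPacked.le_length {l : DecWord} (h : IsPacked l) {p : ℕ × ℕ+} (hp : p ∈ l) :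
    p.1 ≤ l.length := by
  obtain ⟨m, hm⟩ := h
  have h1 : p.1 ∈ letterSet l := by
    simpa [letterSet] using ⟨p.2, hp⟩
  rw [hm, Finset.mem_Icc] at h1
  have h2 : m = (letterSet l).card := by simp [hm]
  have h3 : (letterSet l).card ≤ l.length := by
    simpa [letterSet] using List.toFinset_card_le (l.map Prod.fst)
  omega

theorem quasiShuffles_finite (R : WithTop ℕ → WithTop ℕ → Prop) (a b : DPW) :
    (quasiShuffles R a b).Finite := by
  set n := a.word.length + b.word.length with hn
  have hfin : {l : List (Fin (n + 1)) | l.length = n}.Finite := List.finite_length_eq _ n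
  refine Set.Finite.of_injOn (f := fun u : DPW => u.word.map fun p => Fin.ofNat (n + 1) p.1)
    (t := {l : List (Fin (n + 1)) | l.length = n}) ?_ ?_ hfin
  · intro u hu
    simpa using hu.1
  · intro u hu v hv huv
    have hsnd : ∀ w ∈ quasiShuffles R a b,
        w.word.map Prod.snd = a.word.map Prod.snd ++ b.word.map Prod.snd := by
      intro w hw
      have e1 := congrArg (List.map Prod.snd) hw.2.1
      have e2 := congrArg (List.map Prod.snd) hw.2.2.1
      rw [pack_map_snd] at e1 e2
      rw [← e1, ← e2, ← List.map_append, List.take_append_drop]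
    have hfst : ∀ w ∈ quasiShuffles R a b,
        (w.word.map fun p => Fin.ofNat (n + 1) p.1).map Fin.val = w.word.map Prod.fst := by
      intro w hw
      rw [List.map_map]
      apply List.map_congr_left
      intro p hp
      have := w.packed.le_length hp
      rw [hw.1] at this
      simp only [Function.comp, Fin.ofNat]
      exact Nat.mod_eq_of_lt (by omega)
    have h1 : u.word.map Prod.fst = v.word.map Prod.fst := by
      rw [← hfst u hu, ← hfst v hv]
      exact congrArg _ huv
    have h2 : u.word.map Prod.snd = v.word.map Prod.snd := by
      rw [hsnd u hu, hsnd v hv]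
    have h3 : u.word = v.word := by
      rw [← List.zip_unzip u.word, ← List.zip_unzip v.word]
      simp [List.unzip_eq_map, h1, h2]
    cases u; cases v; simp_all

/-! ### The space spanned by decorated packed words, its products and coproducts -/

section

variable (k : Type*) [Field k]

/-- The vector space `QSh^d_+` with basis the nonempty decorated packed words. -/
abbrev QShd := DPW →₀ k

/-- Bilinear products on `A`. -/
abbrev Prd (A : Type*) [AddCommGroup A] [Module k A] := A →ₗ[k] A →ₗ[k] A

/-- Linear coproducts on `A`. -/
abbrev Coprd (A : Type*) [AddCommGroup A] [Module k A] := A →ₗ[k] A ⊗[k] A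

/-- The bilinear product sending two basis words `a`, `b` to the sum of `quasiShuffles R a b`. -/
noncomputable def relProd (R : WithTop ℕ → WithTop ℕ → Prop) : Prd k (QShd k) :=
  Finsupp.linearCombination k fun a : DPW =>
    Finsupp.linearCombination k fun b : DPW =>
      ∑ u ∈ (quasiShuffles_finite R a b).toFinset, (Finsupp.single u 1 : QShd k)

/-- The half-product `≺`. -/
noncomputable def prec : Prd k (QShd k) := relProd k (· < ·)

/-- The half-product `≻`. -/
noncomputable def succ : Prd k (QShd k) := relProd k (· > ·)

/-- The product `•`. -/
noncomputable def bullet : Prd k (QShd k) := relProd k (· = ·)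

/-- `⪯ = ≺ + •`. -/
noncomputable def preceq : Prd k (QShd k) := prec k + bullet k

/-- `⪰ = ≻ + •`. -/
noncomputable def succeq : Prd k (QShd k) := succ k + bullet k

/-- The basis element `(σ, d)_{|I}`: keep the columns whose letter lies in `I` and pack. (If no
column is left, the value is `0`; this never happens in the coproducts below.) -/
noncomputable def restrict (a : DPW) (I : Finset ℕ) : QShd k :=
  if h : (a.word.filter fun p => p.1 ∈ I) ≠ [] then
    Finsupp.single
      ⟨pack (a.word.filter fun p => p.1 ∈ I), by simpa [pack] using h, isPacked_pack _⟩ 1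
  else 0

/-- The term `(σ, d)_{|{1, …, i}} ⊗ (σ, d)_{|{i + 1, …, max σ}}`. -/
noncomputable def cut (a : DPW) (i : ℕ) : QShd k ⊗[k] QShd k :=
  restrict k a (Finset.Icc 1 i) ⊗ₜ[k] restrict k a (Finset.Icc (i + 1) (maxLetter a.word))

/-- The first letter `σ(1)`. -/
def DPW.firstLetter (a : DPW) : ℕ := (a.word.head a.ne_nil).1

/-- `Δ_≺(σ, d)`: the sum of the cuts at `σ(1) ≤ i ≤ max σ - 1`. -/
noncomputable def deltaPrec : Coprd k (QShd k) :=
  Finsupp.linearCombination k fun a : DPW =>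
    ∑ i ∈ Finset.Ico a.firstLetter (maxLetter a.word), cut k a i

/-- `Δ_≻(σ, d)`: the sum of the cuts at `1 ≤ i ≤ σ(1) - 1`. -/
noncomputable def deltaSucc : Coprd k (QShd k) :=
  Finsupp.linearCombination k fun a : DPW =>
    ∑ i ∈ Finset.Ico 1 a.firstLetter, cut k a i

end

/-! ### Noncommutative shuffle (dendriform) algebras, coalgebras and bidendriform bialgebras -/

section

variable {k : Type*} [Field k] {A : Type*} [AddCommGroup A] [Module k A]

/-- `(A, p, s)` is a noncommutative shuffle (dendriform) algebra, `p` being `≺` and `s` being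
`≻`. -/
structure IsNSh (p s : Prd k A) : Prop where
  prec_prec : ∀ x y z, p (p x y) z = p x (p y z + s y z)
  succ_prec : ∀ x y z, p (s x y) z = s x (p y z)
  succ_succ : ∀ x y z, s (p x y + s x y) z = s x (s y z)

/-- `f` is a morphism of algebras with two products. -/
structure IsNShHom {B : Type*} [AddCommGroup B] [Module k B] (p s : Prd k A) (p' s' : Prd k B)
    (f : A →ₗ[k] B) : Prop where
  map_prec : ∀ x y, f (p x y) = p' (f x) (f y)
  map_succ : ∀ x y, f (s x y) = s' (f x) (f y)

/-- `(A, p, s)` is a free noncommutative shuffle (dendriform) algebra: it is one, and it has a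
subset `X` such that every map from `X` to a noncommutative shuffle algebra `B` extends uniquely to
a morphism from `A` to `B`. -/
def IsFreeNSh.{w, u, v} {k : Type u} [Field k] {A : Type v} [AddCommGroup A] [Module k A]
    (p s : Prd k A) : Prop :=
  IsNSh p s ∧ ∃ X : Set A, ∀ (B : Type w) [AddCommGroup B] [Module k B] (p' s' : Prd k B),
    IsNSh p' s' → ∀ g : X → B,
      ∃! f : A →ₗ[k] B, IsNShHom p s p' s' f ∧ ∀ x : X, f x = g x

/-- `(A, dp, ds)` is a noncommutative shuffle (dendriform) coalgebra, `dp` being `Δ_≺` and `ds`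
being `Δ_≻`. -/
structure IsNShCoalg (dp ds : Coprd k A) : Prop where
  prec_prec : ∀ a, TensorProduct.assoc k A A A (dp.rTensor A (dp a)) = (dp + ds).lTensor A (dp a)
  succ_prec : ∀ a, TensorProduct.assoc k A A A (ds.rTensor A (dp a)) = dp.lTensor A (ds a)
  succ_succ : ∀ a, TensorProduct.assoc k A A A ((dp + ds).rTensor A (ds a)) = ds.lTensor A (ds a)

/-- `(A, p, s, dp, ds)` is a bidendriform bialgebra. With `a b = a ≺ b + a ≻ b`,
`Δ̃(a) = Δ_≺(a) + Δ_≻(a) = a' ⊗ a''`, `Δ_≺(b) = b'_≺ ⊗ b''_≺` and `Δ_≻(b) = b'_≻ ⊗ b''_≻`, the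
compatibilities are
* `Δ_≻(a ≻ b) = a'b'_≻ ⊗ a''≻b''_≻ + a' ⊗ a''≻b + b'_≻ ⊗ a≻b''_≻ + ab'_≻ ⊗ b''_≻ + a ⊗ b`,
* `Δ_≻(a ≺ b) = a'b'_≻ ⊗ a''≺b''_≻ + a' ⊗ a''≺b + b'_≻ ⊗ a≺b''_≻`,
* `Δ_≺(a ≻ b) = a'b'_≺ ⊗ a''≻b''_≺ + ab'_≺ ⊗ b''_≺ + b'_≺ ⊗ a≻b''_≺`,
* `Δ_≺(a ≺ b) = a'b'_≺ ⊗ a''≺b''_≺ + a'b ⊗ a'' + b'_≺ ⊗ a≺b''_≺ + b ⊗ a`. -/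
structure IsBidendriform (p s : Prd k A) (dp ds : Coprd k A) : Prop where
  alg : IsNSh p s
  coalg : IsNShCoalg dp ds
  dsucc_succ : ∀ a b, ds (s a b) =
    TensorProduct.map₂ (p + s) s ((dp + ds) a) (ds b) + (s.flip b).lTensor A ((dp + ds) a)
      + (s a).lTensor A (ds b) + ((p + s) a).rTensor A (ds b) + a ⊗ₜ[k] b
  dsucc_prec : ∀ a b, ds (p a b) =
    TensorProduct.map₂ (p + s) p ((dp + ds) a) (ds b) + (p.flip b).lTensor A ((dp + ds) a)
      + (p a).lTensor A (ds b)
  dprec_succ : ∀ a b, dp (s a b) =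
    TensorProduct.map₂ (p + s) s ((dp + ds) a) (dp b) + ((p + s) a).rTensor A (dp b)
      + (s a).lTensor A (dp b)
  dprec_prec : ∀ a b, dp (p a b) =
    TensorProduct.map₂ (p + s) p ((dp + ds) a) (dp b) + ((p + s).flip b).rTensor A ((dp + ds) a)
      + (p a).lTensor A (dp b) + b ⊗ₜ[k] a

/-- The compatibilities between the products `≺ = p`, `≻ = s`, `• = m` (with `⪯ = p + m`,
`⪰ = s + m`, `⋆ = p + s + m`) and the coproducts `Δ_≺ = dp`, `Δ_≻ = ds` (with
`Δ̃ = dp + ds`). With `Δ̃(a) = a' ⊗ a''`, `Δ_≺(a) = a'_≺ ⊗ a''_≺` and `Δ_≻(a) = a'_≻ ⊗ a''_≻`: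
* `Δ_≺(a ⪯ b) = a'_≺⪯b' ⊗ a''_≺⋆b'' + a'_≺⪯b ⊗ a''_≺ + a'_≺ ⊗ a''_≺⋆b + a⪯b' ⊗ b'' + a ⊗ b`,
* `Δ_≺(a ⪰ b) = a'_≺⪰b' ⊗ a''_≺⋆b'' + a⪰b' ⊗ b'' + a'_≺⪰b ⊗ a''_≺`,
* `Δ_≻(a ⪯ b) = a'_≻⪯b' ⊗ a''_≻⋆b'' + a'_≻⪯b ⊗ a''_≻ + a'_≻ ⊗ a''_≻⋆b`,
* `Δ_≻(a ⪰ b) = a'_≻⪰b' ⊗ a''_≻⋆b'' + a'_≻⪰b ⊗ a''_≻ + b' ⊗ a⋆b'' + b ⊗ a`,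
* for `∘` equal to `≺` or `⪯`:
  `Δ̃(a ∘ b) = a'∘b' ⊗ a''⋆b'' + a'∘b ⊗ a'' + a' ⊗ a''⋆b + a∘b' ⊗ b'' + a ⊗ b`,
* for `∘` equal to `≻` or `⪰`:
  `Δ̃(a ∘ b) = a'∘b' ⊗ a''⋆b'' + a'∘b ⊗ a'' + a∘b' ⊗ b'' + b' ⊗ a⋆b'' + b ⊗ a`,
* `Δ̃(a • b) = a'•b' ⊗ a''⋆b'' + a'•b ⊗ a'' + a•b' ⊗ b''`. -/
structure CoproductIdentities (p s m : Prd k A) (dp ds : Coprd k A) : Prop where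
  dprec_preceq : ∀ a b, dp ((p + m) a b) =
    TensorProduct.map₂ (p + m) (p + s + m) (dp a) ((dp + ds) b)
      + ((p + m).flip b).rTensor A (dp a) + ((p + s + m).flip b).lTensor A (dp a)
      + ((p + m) a).rTensor A ((dp + ds) b) + a ⊗ₜ[k] b
  dprec_succeq : ∀ a b, dp ((s + m) a b) =
    TensorProduct.map₂ (s + m) (p + s + m) (dp a) ((dp + ds) b)
      + ((s + m) a).rTensor A ((dp + ds) b) + ((s + m).flip b).rTensor A (dp a)
  dsucc_preceq : ∀ a b, ds ((p + m) a b) =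
    TensorProduct.map₂ (p + m) (p + s + m) (ds a) ((dp + ds) b)
      + ((p + m).flip b).rTensor A (ds a) + ((p + s + m).flip b).lTensor A (ds a)
  dsucc_succeq : ∀ a b, ds ((s + m) a b) =
    TensorProduct.map₂ (s + m) (p + s + m) (ds a) ((dp + ds) b)
      + ((s + m).flip b).rTensor A (ds a) + ((p + s + m) a).lTensor A ((dp + ds) b) + b ⊗ₜ[k] a
  dtilde_left : ∀ o : Prd k A, o = p ∨ o = p + m → ∀ a b, (dp + ds) (o a b) =
    TensorProduct.map₂ o (p + s + m) ((dp + ds) a) ((dp + ds) b)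
      + (o.flip b).rTensor A ((dp + ds) a) + ((p + s + m).flip b).lTensor A ((dp + ds) a)
      + (o a).rTensor A ((dp + ds) b) + a ⊗ₜ[k] b
  dtilde_right : ∀ o : Prd k A, o = s ∨ o = s + m → ∀ a b, (dp + ds) (o a b) =
    TensorProduct.map₂ o (p + s + m) ((dp + ds) a) ((dp + ds) b)
      + (o.flip b).rTensor A ((dp + ds) a) + (o a).rTensor A ((dp + ds) b)
      + ((p + s + m) a).lTensor A ((dp + ds) b) + b ⊗ₜ[k] a
  dtilde_bullet : ∀ a b, (dp + ds) (m a b) =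
    TensorProduct.map₂ m (p + s + m) ((dp + ds) a) ((dp + ds) b)
      + (m.flip b).rTensor A ((dp + ds) a) + (m a).rTensor A ((dp + ds) b)

/-- The opposite product `x ·ᵒᵖ y = y · x`. -/
def opProd (m : Prd k A) : Prd k A := m.flip

/-- The opposite coproduct: the coproduct followed by the exchange of the two tensor factors. -/
noncomputable def opCoprd (d : Coprd k A) : Coprd k A :=
  (TensorProduct.comm k A A).toLinearMap ∘ₗ d

end

end QSh

universe w u

namespace QSh

/-! ### Relabelling and packing of words -/

/-! All the products are instances of `relProd R`, where `R` relates the minima of the two factors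
of a quasi-shuffle and depends only on how they compare (`OrdInv`). The empty word, with minimum
`⊤`, is admitted as a factor throughout the combinatorics, so that boundary terms need no separate
treatment.

Dendriform axioms. An iterated product of `a`, `b`, `c`, bracketed either way, is a sum over packed
words `u₁u₂u₃` whose blocks pack to `a`, `b`, `c`, with a condition on the three minima. Each axiom
is thus an equivalence between two conditions on three elements of a linear order (`relProd_assoc`).

Coproducts. `Δ_≺`, `Δ_≻` and `Δ̃` are sums over all cuts `i`, weighted according to whether the
first letter is at most `i` (`weightedCoprd`). Let `u₁u₂` be a quasi-shuffle of `a` and `b`, and let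
`j`, `l` count the distinct letters at most `i` in `u₁`, `u₂`. Its lower part is a quasi-shuffle of
the lower parts of `a`, `b` cut at `j`, `l`, with the same condition `R`, since the lower part
contains the smaller minimum. Its upper part is an arbitrary quasi-shuffle of the upper parts. This
is a bijection (`sum_cuts`), and the first letter of `u₁u₂` is low exactly when that of `a` is. The
extreme values of `j` and `l` produce the terms with an uncut factor, so one formula,
`weightedCoprd_relProd`, contains all the compatibilities of (1) and (2). Coassociativity compares
the weights of double cuts.

Freeness. This part uses the products only. Every word is, in exactly one way, `lead b x a`: `b` is
shifted above everything else, the letters of `x` other than 1 are raised to leave a gap just above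
1, and `a` fills that gap; here `x` is indecomposable on both sides and `b`, `a` may be empty
(`lead_injective`, `exists_eq_lead`). This word is the lexicographically largest one in `(b ≻ x) ≺
a` (`eq_lead_or_lt`), for either choice of strict and weak half-products. The graftings `(b ≻ x) ≺
a` therefore form a basis by triangularity. A morphism is forced on such a basis by recursion on
length, and the dendriform axioms, which bring any product back to the shape `(b ≻ x) ≺ a`, show
that the resulting map is a morphism (`isFreeNSh_of_basis`). -/

/-- Replace every letter `x` of a decorated word by `φ x`. -/
def relabel (φ : ℕ → ℕ) (l : DecWord) : DecWord := l.map (Prod.map φ id)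

theorem mem_letterSet {l : DecWord} {x : ℕ} : x ∈ letterSet l ↔ ∃ d, (x, d) ∈ l := by
  simp [letterSet]

theorem fst_mem_letterSet {l : DecWord} {p : ℕ × ℕ+} (h : p ∈ l) : p.1 ∈ letterSet l :=
  mem_letterSet.2 ⟨p.2, h⟩

@[simp] theorem letterSet_nil : letterSet [] = ∅ := rfl

@[simp] theorem letterSet_append (l l' : DecWord) :
    letterSet (l ++ l') = letterSet l ∪ letterSet l' := by
  simp [letterSet]

theorem letterSet_eq_empty {l : DecWord} : letterSet l = ∅ ↔ l = [] := by
  simp [letterSet]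

@[simp] theorem letterSet_relabel (φ : ℕ → ℕ) (l : DecWord) :
    letterSet (relabel φ l) = (letterSet l).image φ := by
  ext x
  simp [letterSet, relabel]

@[simp] theorem length_relabel (φ : ℕ → ℕ) (l : DecWord) : (relabel φ l).length = l.length := by
  simp [relabel]

@[simp] theorem relabel_nil (φ : ℕ → ℕ) : relabel φ [] = [] := rfl

@[simp] theorem relabel_eq_nil {φ : ℕ → ℕ} {l : DecWord} : relabel φ l = [] ↔ l = [] := by
  simp [relabel]

@[simp] theorem relabel_append (φ : ℕ → ℕ) (l l' : DecWord) :
    relabel φ (l ++ l') = relabel φ l ++ relabel φ l' := by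
  simp [relabel]

theorem relabel_relabel (φ ψ : ℕ → ℕ) (l : DecWord) :
    relabel φ (relabel ψ l) = relabel (φ ∘ ψ) l := by
  simp [relabel, Function.comp_def]

theorem relabel_eq_relabel {φ ψ : ℕ → ℕ} {l : DecWord} :
    relabel φ l = relabel ψ l ↔ ∀ x ∈ letterSet l, φ x = ψ x := by
  simp only [relabel, List.map_inj_left, Prod.ext_iff, mem_letterSet]
  constructor
  · rintro h x ⟨d, hd⟩
    exact (h _ hd).1
  · intro h p hp
    exact ⟨h _ ⟨_, hp⟩, rfl⟩

theorem relabel_eq_self {φ : ℕ → ℕ} {l : DecWord} (h : ∀ x ∈ letterSet l, φ x = x) :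
    relabel φ l = l := by
  have : relabel φ l = relabel id l := relabel_eq_relabel.2 h
  rw [this]; simp [relabel]

theorem eq_of_relabel_eq {φ : ℕ → ℕ} (hφ : Function.Injective φ) {l l' : DecWord}
    (h : relabel φ l = relabel φ l') : l = l' :=
  List.map_injective_iff.2 (hφ.prodMap Function.injective_id) h

/-- The rank of `x` in `S`. -/
def rank (S : Finset ℕ) (x : ℕ) : ℕ := (S.filter fun y => y ≤ x).card

theorem pack_eq_relabel (l : DecWord) : pack l = relabel (rank (letterSet l)) l := rfl

@[simp] theorem length_pack (l : DecWord) : (pack l).length = l.length := by simp [pack]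

@[simp] theorem pack_nil : pack [] = [] := rfl

@[simp] theorem pack_eq_nil {l : DecWord} : pack l = [] ↔ l = [] := by simp [pack]

theorem strictMonoOn_rank (S : Finset ℕ) : StrictMonoOn (rank S) S := by
  intro x _ y hy h
  refine Finset.card_lt_card ?_
  rw [Finset.ssubset_iff_of_subset]
  · exact ⟨y, by simpa using hy, by simp [h]⟩
  · intro z hz
    simp only [Finset.mem_filter] at hz ⊢
    exact ⟨hz.1, hz.2.trans h.le⟩

theorem rank_image {S : Finset ℕ} {φ : ℕ → ℕ} (hφ : StrictMonoOn φ S) {x : ℕ} (hx : x ∈ S) :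
    rank (S.image φ) (φ x) = rank S x := by
  have : (S.image φ).filter (fun y => y ≤ φ x) = (S.filter fun y => y ≤ x).image φ := by
    ext y
    simp only [Finset.mem_filter, Finset.mem_image]
    constructor
    · rintro ⟨⟨z, hz, rfl⟩, h⟩
      exact ⟨z, ⟨hz, (hφ.le_iff_le hz hx).1 h⟩, rfl⟩
    · rintro ⟨z, ⟨hz, h⟩, rfl⟩
      exact ⟨⟨z, hz, rfl⟩, (hφ.le_iff_le hz hx).2 h⟩
  rw [rank, this, Finset.card_image_of_injOn, rank]
  exact hφ.injOn.mono fun y hy => (Finset.mem_filter.1 hy).1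

theorem pack_relabel {φ : ℕ → ℕ} {l : DecWord} (hφ : StrictMonoOn φ (letterSet l)) :
    pack (relabel φ l) = pack l := by
  rw [pack_eq_relabel, pack_eq_relabel, relabel_relabel, letterSet_relabel, relabel_eq_relabel]
  intro x hx
  exact rank_image hφ hx

theorem IsPacked.letterSet_eq {l : DecWord} (h : IsPacked l) :
    letterSet l = Finset.Icc 1 (maxLetter l) := by
  obtain ⟨m, hm⟩ := h
  rw [hm, maxLetter, hm]
  congr 1
  rcases Nat.eq_zero_or_pos m with rfl | h
  · simp
  · apply le_antisymm
    · exact Finset.le_sup (f := id) (Finset.mem_Icc.2 ⟨h, le_rfl⟩)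
    · exact Finset.sup_le fun x hx => (Finset.mem_Icc.1 hx).2

theorem maxLetter_eq_of_letterSet {l : DecWord} {m : ℕ} (h : letterSet l = Finset.Icc 1 m) :
    maxLetter l = m := by
  have := IsPacked.letterSet_eq ⟨m, h⟩
  rw [h] at this
  simpa using (congrArg Finset.card this).symm

theorem IsPacked.card_letterSet {l : DecWord} (h : IsPacked l) :
    (letterSet l).card = maxLetter l := by
  rw [h.letterSet_eq]; simp

theorem isPacked_nil : IsPacked [] := ⟨0, by simp⟩

theorem IsPacked.pack_eq {l : DecWord} (h : IsPacked l) : pack l = l := by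
  rw [pack_eq_relabel]
  apply relabel_eq_self
  intro x hx
  rw [h.letterSet_eq] at hx ⊢
  have : (Finset.Icc 1 (maxLetter l)).filter (fun y => y ≤ x) = Finset.Icc 1 x := by
    ext y
    simp only [Finset.mem_filter, Finset.mem_Icc] at hx ⊢
    omega
  simp [rank, this]

theorem exists_relabel_pack (l : DecWord) :
    ∃ φ : ℕ → ℕ, StrictMonoOn φ (letterSet (pack l)) ∧ l = relabel φ (pack l) := by
  set S := letterSet l with hS
  have hinj : Set.InjOn (rank S) S := (strictMonoOn_rank S).injOn
  have hinv : ∀ x ∈ S, Function.invFunOn (rank S) S (rank S x) = x := fun x hx =>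
    hinj.leftInvOn_invFunOn hx
  refine ⟨Function.invFunOn (rank S) S, ?_, ?_⟩
  · intro x hx y hy hxy
    rw [pack_eq_relabel, letterSet_relabel, ← hS] at hx hy
    simp only [Finset.coe_image, Set.mem_image] at hx hy
    obtain ⟨x, hx, rfl⟩ := hx
    obtain ⟨y, hy, rfl⟩ := hy
    rw [hinv x hx, hinv y hy]
    exact ((strictMonoOn_rank S).lt_iff_lt hx hy).1 hxy
  · rw [pack_eq_relabel, relabel_relabel]
    exact (relabel_eq_self hinv).symm

/-- The inverse of the rank function is increasing on the packed letters. This is the form in which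
packing is used: the words that pack to `a` are parametrised by increasing relabellings of `a`. -/
theorem pack_eq_iff {a l : DecWord} (ha : IsPacked a) :
    pack l = a ↔ ∃ φ : ℕ → ℕ, StrictMonoOn φ (letterSet a) ∧ l = relabel φ a := by
  constructor
  · rintro rfl
    exact exists_relabel_pack l
  · rintro ⟨φ, hφ, rfl⟩
    rw [pack_relabel hφ, ha.pack_eq]

/-! ### Comparison of minimal letters -/

/-- A relation that only depends on the comparison of its two arguments. -/
def OrdInv (R : WithTop ℕ → WithTop ℕ → Prop) : Prop :=
  ∀ x y x' y', cmp x y = cmp x' y' → (R x y ↔ R x' y')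

theorem ordInv_lt : OrdInv (· < ·) := fun x y x' y' h => by
  change x < y ↔ x' < y'
  rw [← cmp_eq_lt_iff, ← cmp_eq_lt_iff, h]

theorem ordInv_gt : OrdInv (· > ·) := fun x y x' y' h => by
  change y < x ↔ y' < x'
  rw [← cmp_eq_gt_iff, ← cmp_eq_gt_iff, h]

theorem ordInv_eq : OrdInv (· = ·) := fun x y x' y' h => by
  change x = y ↔ x' = y'
  rw [← cmp_eq_eq_iff x y, h, cmp_eq_eq_iff]

theorem ordInv_le : OrdInv (· ≤ ·) := fun x y x' y' h => by
  change x ≤ y ↔ x' ≤ y'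
  rw [← not_lt, ← not_lt, not_iff_not]
  exact ordInv_gt x y x' y' h

theorem ordInv_ge : OrdInv (· ≥ ·) := fun x y x' y' h => by
  change y ≤ x ↔ y' ≤ x'
  rw [← not_lt, ← not_lt, not_iff_not]
  exact ordInv_lt x y x' y' h

theorem ordInv_true : OrdInv (fun _ _ => True) := fun _ _ _ _ _ => Iff.rfl

@[simp] theorem minLetter_nil : minLetter [] = ⊤ := rfl

theorem minLetter_append (l l' : DecWord) :
    minLetter (l ++ l') = min (minLetter l) (minLetter l') := by
  simp [minLetter, Finset.min_union]

theorem minLetter_eq_top {l : DecWord} : minLetter l = ⊤ ↔ l = [] := by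
  rw [minLetter, Finset.min_eq_top, letterSet_eq_empty]

theorem minLetter_eq_coe {l : DecWord} {x : ℕ} :
    minLetter l = x ↔ x ∈ letterSet l ∧ ∀ y ∈ letterSet l, x ≤ y := by
  constructor
  · intro h
    exact ⟨Finset.mem_of_min h, fun y hy => Finset.min_le_of_eq hy h⟩
  · rintro ⟨h1, h2⟩
    exact le_antisymm (Finset.min_le h1) (Finset.le_min fun y hy => WithTop.coe_le_coe.2 (h2 y hy))

theorem exists_minLetter {l : DecWord} (h : l ≠ []) :
    ∃ x ∈ letterSet l, minLetter l = (x : WithTop ℕ) ∧ ∀ y ∈ letterSet l, x ≤ y := by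
  obtain ⟨x, hx⟩ := WithTop.ne_top_iff_exists.1 (mt minLetter_eq_top.1 h)
  have := minLetter_eq_coe.1 hx.symm
  exact ⟨x, this.1, hx.symm, this.2⟩

/-- An increasing map sends minima to minima, and an empty word keeps the minimum `⊤`. Monotonicity
is required on the letters of both words together, since the two minima are compared with each
other. -/
theorem cmp_minLetter_relabel {φ : ℕ → ℕ} {l l' : DecWord}
    (hφ : StrictMonoOn φ (letterSet (l ++ l'))) :
    cmp (minLetter (relabel φ l)) (minLetter (relabel φ l')) =
      cmp (minLetter l) (minLetter l') := by
  have key : ∀ m : DecWord, letterSet m ⊆ letterSet (l ++ l') → ∀ x, minLetter m = (x : ℕ) →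
      minLetter (relabel φ m) = (φ x : ℕ) := by
    intro m hm x hx
    rw [minLetter_eq_coe] at hx ⊢
    refine ⟨by simpa using ⟨x, hx.1, rfl⟩, fun y hy => ?_⟩
    simp only [letterSet_relabel, Finset.mem_image] at hy
    obtain ⟨z, hz, rfl⟩ := hy
    exact (hφ.le_iff_le (hm hx.1) (hm hz)).2 (hx.2 z hz)
  by_cases hl : l = []
  · subst hl
    by_cases hl' : l' = []
    · subst hl'; rfl
    · obtain ⟨y, hy, hy1, -⟩ := exists_minLetter hl'
      rw [key l' (by simp) y hy1, hy1]
      simp only [relabel_nil, minLetter_nil]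
      rw [cmp_eq_gt_iff _ _ |>.2 (WithTop.coe_lt_top _), cmp_eq_gt_iff _ _ |>.2 (WithTop.coe_lt_top _)]
  · obtain ⟨x, hx, hx1, -⟩ := exists_minLetter hl
    rw [key l (by simp) x hx1, hx1]
    by_cases hl' : l' = []
    · subst hl'
      simp only [relabel_nil, minLetter_nil]
      rw [cmp_eq_lt_iff _ _ |>.2 (WithTop.coe_lt_top _), cmp_eq_lt_iff _ _ |>.2 (WithTop.coe_lt_top _)]
    · obtain ⟨y, hy, hy1, -⟩ := exists_minLetter hl'
      rw [key l' (by simp) y hy1, hy1]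
      have hx' : x ∈ (letterSet (l ++ l') : Set ℕ) := by simp [hx]
      have hy' : y ∈ (letterSet (l ++ l') : Set ℕ) := by simp [hy]
      rcases lt_trichotomy x y with h | h | h
      · rw [(cmp_eq_lt_iff (x : WithTop ℕ) y).2 (by exact_mod_cast h),
          (cmp_eq_lt_iff (φ x : WithTop ℕ) (φ y)).2 (by exact_mod_cast hφ hx' hy' h)]
      · subst h; simp
      · rw [(cmp_eq_gt_iff (x : WithTop ℕ) y).2 (by exact_mod_cast h),
          (cmp_eq_gt_iff (φ x : WithTop ℕ) (φ y)).2 (by exact_mod_cast hφ hy' hx' h)]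

/-! ### Cutting words at a letter -/

/-- The subword of the letters at most `i`. -/
def lo (i : ℕ) (l : DecWord) : DecWord := l.filter fun p => p.1 ≤ i

/-- The subword of the letters larger than `i`, shifted by `i`. -/
def hi (i : ℕ) (l : DecWord) : DecWord := relabel (fun x => x - i) (l.filter fun p => i < p.1)

@[simp] theorem lo_append (i : ℕ) (l l' : DecWord) : lo i (l ++ l') = lo i l ++ lo i l' := by
  simp [lo]

@[simp] theorem hi_append (i : ℕ) (l l' : DecWord) : hi i (l ++ l') = hi i l ++ hi i l' := by
  simp [hi]

@[simp] theorem letterSet_lo (i : ℕ) (l : DecWord) :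
    letterSet (lo i l) = (letterSet l).filter (· ≤ i) := by
  ext x; simp [lo, mem_letterSet]

theorem mem_letterSet_hi {i x : ℕ} {l : DecWord} :
    x ∈ letterSet (hi i l) ↔ 1 ≤ x ∧ x + i ∈ letterSet l := by
  simp only [hi, letterSet_relabel, Finset.mem_image, mem_letterSet, List.mem_filter,
    decide_eq_true_eq]
  constructor
  · rintro ⟨y, ⟨d, hd, hi⟩, rfl⟩
    exact ⟨by omega, d, by rwa [Nat.sub_add_cancel hi.le]⟩
  · rintro ⟨hx, d, hd⟩
    exact ⟨x + i, ⟨d, hd, by omega⟩, by omega⟩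

theorem IsPacked.letterSet_lo {l : DecWord} (h : IsPacked l) (i : ℕ) :
    letterSet (lo i l) = Finset.Icc 1 (min i (maxLetter l)) := by
  rw [QSh.letterSet_lo, h.letterSet_eq]
  ext x; simp; omega

theorem IsPacked.letterSet_hi {l : DecWord} (h : IsPacked l) (i : ℕ) :
    letterSet (hi i l) = Finset.Icc 1 (maxLetter l - i) := by
  ext x
  rw [mem_letterSet_hi, h.letterSet_eq]
  simp; omega

theorem IsPacked.lo {l : DecWord} (h : IsPacked l) (i : ℕ) : IsPacked (lo i l) :=
  ⟨_, h.letterSet_lo i⟩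

theorem IsPacked.hi {l : DecWord} (h : IsPacked l) (i : ℕ) : IsPacked (hi i l) :=
  ⟨_, h.letterSet_hi i⟩

theorem IsPacked.maxLetter_lo {l : DecWord} (h : IsPacked l) (i : ℕ) :
    maxLetter (QSh.lo i l) = min i (maxLetter l) :=
  maxLetter_eq_of_letterSet (h.letterSet_lo i)

theorem IsPacked.maxLetter_hi {l : DecWord} (h : IsPacked l) (i : ℕ) :
    maxLetter (QSh.hi i l) = maxLetter l - i :=
  maxLetter_eq_of_letterSet (h.letterSet_hi i)

theorem IsPacked.maxLetter_eq_zero {l : DecWord} (h : IsPacked l) :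
    maxLetter l = 0 ↔ l = [] := by
  rw [← h.card_letterSet, Finset.card_eq_zero, letterSet_eq_empty]

theorem IsPacked.lo_eq_self {l : DecWord} (h : IsPacked l) {i : ℕ} (hi : maxLetter l ≤ i) :
    QSh.lo i l = l := by
  rw [QSh.lo, List.filter_eq_self]
  intro p hp
  have := fst_mem_letterSet hp
  rw [h.letterSet_eq, Finset.mem_Icc] at this
  simp; omega

theorem IsPacked.lo_zero {l : DecWord} (h : IsPacked l) : QSh.lo 0 l = [] := by
  rw [← (h.lo 0).maxLetter_eq_zero, h.maxLetter_lo]; simp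

theorem IsPacked.hi_eq_nil {l : DecWord} (h : IsPacked l) {i : ℕ} (hi : maxLetter l ≤ i) :
    QSh.hi i l = [] := by
  rw [← (h.hi i).maxLetter_eq_zero, h.maxLetter_hi]; omega

theorem IsPacked.hi_zero {l : DecWord} (h : IsPacked l) : QSh.hi 0 l = l := by
  rw [QSh.hi, List.filter_eq_self.2]
  · exact relabel_eq_self (by simp)
  · intro p hp
    have := fst_mem_letterSet hp
    rw [h.letterSet_eq, Finset.mem_Icc] at this
    simp; omega

theorem lo_relabel {φ : ℕ → ℕ} {i j : ℕ} {l : DecWord}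
    (h : ∀ x ∈ letterSet l, φ x ≤ i ↔ x ≤ j) : lo i (relabel φ l) = relabel φ (lo j l) := by
  simp only [lo, relabel, List.filter_map]
  congr 1
  apply List.filter_congr
  intro p hp
  simpa using h _ (fst_mem_letterSet hp)

/-- The hypothesis says that `φ` crosses the level `i` exactly at `j`; the upper part is then
relabelled by `φ` conjugated by the two shifts. -/
theorem hi_relabel {φ : ℕ → ℕ} {i j : ℕ} {l : DecWord}
    (h : ∀ x ∈ letterSet l, φ x ≤ i ↔ x ≤ j) :
    hi i (relabel φ l) = relabel (fun x => φ (x + j) - i) (hi j l) := by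
  simp only [hi, relabel_relabel]
  have : (relabel φ l).filter (fun p => i < p.1) = relabel φ (l.filter fun p => j < p.1) := by
    simp only [relabel, List.filter_map]
    congr 1
    apply List.filter_congr
    intro p hp
    have := h _ (fst_mem_letterSet hp)
    simp only [Function.comp, Prod.map_fst, decide_eq_decide]
    omega
  rw [this, relabel_relabel, relabel_eq_relabel]
  intro x hx
  obtain ⟨d, hd⟩ := mem_letterSet.1 hx
  simp only [List.mem_filter, decide_eq_true_eq] at hd
  simp only [Function.comp]
  rw [Nat.sub_add_cancel hd.2.le]

/-- This rule and the next two reduce double cuts to a lower, a middle and an upper block, as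
coassociativity requires. -/
theorem lo_lo (i j : ℕ) (l : DecWord) : lo i (lo j l) = lo (min i j) l := by
  simp [lo, List.filter_filter]

theorem lo_hi (i j : ℕ) (l : DecWord) : lo i (hi j l) = hi j (lo (i + j) l) := by
  simp only [lo, hi, relabel, List.filter_map, List.filter_filter]
  congr 1
  apply List.filter_congr
  intro p _
  simp only [Function.comp, Prod.map_fst]
  rw [Bool.eq_iff_iff]
  simp; omega

theorem hi_hi (i j : ℕ) (l : DecWord) : hi i (hi j l) = hi (i + j) l := by
  simp only [hi, relabel, List.filter_map, List.filter_filter, List.map_map]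
  have : (l.filter fun p => (decide (i < p.1 - j) && decide (j < p.1))) =
      l.filter fun p => decide (i + j < p.1) := by
    apply List.filter_congr
    intro p _
    rw [Bool.eq_iff_iff]
    simp; omega
  simp only [Function.comp_def, Prod.map_fst] at this ⊢
  rw [this]
  apply List.map_congr_left
  intro p _
  simp [Prod.ext_iff]; omega

/-! ### Quasi-shuffles of possibly empty words -/

/-- The packed words `u₁u₂` with `u₁` packing to `a`, `u₂` packing to `b`, and the minimal letters
of `u₁`, `u₂` in the relation `R`. -/
def qsWords (R : WithTop ℕ → WithTop ℕ → Prop) (a b : DecWord) : Set DecWord :=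
  {u | IsPacked u ∧ ∃ u₁ u₂, u = u₁ ++ u₂ ∧ pack u₁ = a ∧ pack u₂ = b ∧
    R (minLetter u₁) (minLetter u₂)}

theorem qsWords_nil_left {R : WithTop ℕ → WithTop ℕ → Prop} {b : DecWord} (hb : IsPacked b) :
    qsWords R [] b = {u | u = b ∧ R ⊤ (minLetter b)} := by
  ext u
  constructor
  · rintro ⟨hu, u₁, u₂, rfl, h1, rfl, h⟩
    rw [pack_eq_nil] at h1
    subst h1
    have e : pack u₂ = u₂ := IsPacked.pack_eq (by simpa using hu)
    rw [Set.mem_ofPred_eq, e]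
    exact ⟨rfl, h⟩
  · rintro ⟨rfl, h⟩
    exact ⟨hb, [], u, rfl, rfl, hb.pack_eq, h⟩

theorem qsWords_nil_right {R : WithTop ℕ → WithTop ℕ → Prop} {a : DecWord} (ha : IsPacked a) :
    qsWords R a [] = {u | u = a ∧ R (minLetter a) ⊤} := by
  ext u
  constructor
  · rintro ⟨hu, u₁, u₂, rfl, rfl, h1, h⟩
    rw [pack_eq_nil] at h1
    subst h1
    have e : pack u₁ = u₁ := IsPacked.pack_eq (by simpa using hu)
    rw [Set.mem_ofPred_eq, e]
    exact ⟨by simp, h⟩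
  · rintro ⟨rfl, h⟩
    exact ⟨ha, u, [], by simp, ha.pack_eq, rfl, h⟩

theorem word_mem_qsWords {R : WithTop ℕ → WithTop ℕ → Prop} {a b u : DPW} :
    u.word ∈ qsWords R a.word b.word ↔ u ∈ quasiShuffles R a b := by
  constructor
  · rintro ⟨-, u₁, u₂, h, h1, h2, hR⟩
    have e1 : a.word.length = u₁.length := by rw [← h1, length_pack]
    have e2 : b.word.length = u₂.length := by rw [← h2, length_pack]
    refine ⟨by rw [h, e1, e2, List.length_append], ?_⟩
    rw [e1, h, List.take_left, List.drop_left]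
    exact ⟨h1, h2, hR⟩
  · rintro ⟨_, h1, h2, hR⟩
    exact ⟨u.packed, _, _, (List.take_append_drop _ _).symm, h1, h2, hR⟩

theorem qsWords_finite (R : WithTop ℕ → WithTop ℕ → Prop) (a b : DecWord) :
    (qsWords R a b).Finite := by
  by_cases hab : IsPacked a ∧ IsPacked b
  · by_cases ha : a = []
    · subst ha
      rw [qsWords_nil_left hab.2]
      exact (Set.finite_singleton b).subset fun u hu => hu.1
    by_cases hb : b = []
    · subst hb
      rw [qsWords_nil_right hab.1]
      exact (Set.finite_singleton a).subset fun u hu => hu.1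
    refine ((quasiShuffles_finite R ⟨a, ha, hab.1⟩ ⟨b, hb, hab.2⟩).image DPW.word).subset ?_
    intro u hu
    have hu0 : u ≠ [] := by
      rintro rfl
      obtain ⟨-, u₁, u₂, h, h1, -⟩ := hu
      rw [List.nil_eq, List.append_eq_nil_iff] at h
      rw [h.1] at h1
      exact ha h1.symm
    exact ⟨⟨u, hu0, hu.1⟩, word_mem_qsWords.1 hu, rfl⟩
  · convert Set.finite_empty
    rw [Set.eq_empty_iff_forall_notMem]
    rintro u ⟨-, u₁, u₂, -, h1, h2, -⟩
    exact hab ⟨h1 ▸ isPacked_pack _, h2 ▸ isPacked_pack _⟩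

/-- The finset of the words in `qsWords R a b`. -/
noncomputable def qsFinset (R : WithTop ℕ → WithTop ℕ → Prop) (a b : DecWord) : Finset DecWord :=
  (qsWords_finite R a b).toFinset

@[simp] theorem mem_qsFinset {R : WithTop ℕ → WithTop ℕ → Prop} {a b u : DecWord} :
    u ∈ qsFinset R a b ↔ u ∈ qsWords R a b := by
  simp [qsFinset]

theorem length_of_mem_qsWords {R : WithTop ℕ → WithTop ℕ → Prop} {a b u : DecWord}
    (h : u ∈ qsWords R a b) : u.length = a.length + b.length := by
  obtain ⟨-, u₁, u₂, rfl, rfl, rfl, -⟩ := h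
  simp

theorem ne_nil_of_mem_qsWords {R : WithTop ℕ → WithTop ℕ → Prop} {a b u : DecWord}
    (h : u ∈ qsWords R a b) (hab : a ≠ [] ∨ b ≠ []) : u ≠ [] := by
  have := length_of_mem_qsWords h
  rw [← List.length_pos_iff]
  rcases hab with h | h <;> have := List.length_pos_iff.2 h <;> omega

section

variable (k : Type*) [Field k]

open Classical in
/-- The basis element of a nonempty packed word, and `0` for the other words. -/
noncomputable def ofWord (l : DecWord) : QShd k :=
  if h : l ≠ [] ∧ IsPacked l then Finsupp.single ⟨l, h.1, h.2⟩ 1 else 0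

variable {k}

@[simp] theorem ofWord_word (a : DPW) : ofWord k a.word = Finsupp.single a 1 := by
  rw [ofWord, dif_pos ⟨a.ne_nil, a.packed⟩]

theorem ofWord_induction {P : QShd k → Prop} (x : QShd k) (add : ∀ x y, P x → P y → P (x + y))
    (smul : ∀ (c : k) x, P x → P (c • x))
    (basis : ∀ a : DecWord, a ≠ [] → IsPacked a → P (ofWord k a)) : P x := by
  have hb : ∀ a : DPW, P (Finsupp.single a 1) := fun a => by
    rw [← ofWord_word]; exact basis _ a.ne_nil a.packed
  induction x using Finsupp.induction_linear with
  | zero =>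
    -- Zero is obtained as 0 times an arbitrary basis word, which spares every later induction a
    -- zero case.
    have := smul 0 _ (basis [(1, 1)] (by simp) ⟨1, rfl⟩)
    rwa [zero_smul] at this
  | add f g hf hg => exact add _ _ hf hg
  | single a c =>
    have := smul c _ (hb a)
    rwa [Finsupp.smul_single, smul_eq_mul, mul_one] at this

theorem DPW.ext {a b : DPW} (h : a.word = b.word) : a = b := by
  cases a; cases b; simp_all

open Classical in
theorem sum_ofWord_apply (S : Finset DecWord) (u : DPW) :
    (∑ w ∈ S, ofWord k w) u = if u.word ∈ S then 1 else 0 := by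
  rw [Finsupp.finsetSum_apply]
  have : ∀ w ∈ S, ofWord k w u = if u.word = w then 1 else 0 := by
    intro w _
    rw [ofWord]
    split_ifs with h1 h2 h2
    · subst h2; simp
    · rw [Finsupp.single_eq_of_ne]
      rintro rfl; exact h2 rfl
    · subst h2; exact absurd ⟨u.ne_nil, u.packed⟩ h1
    · rfl
  rw [Finset.sum_congr rfl this, Finset.sum_ite_eq]

theorem relProd_ofWord (R : WithTop ℕ → WithTop ℕ → Prop) {a b : DecWord} (ha : a ≠ [])
    (ha' : IsPacked a) (hb : b ≠ []) (hb' : IsPacked b) :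
    relProd k R (ofWord k a) (ofWord k b) = ∑ u ∈ qsFinset R a b, ofWord k u := by
  classical
  have e1 := ofWord_word (k := k) ⟨a, ha, ha'⟩
  have e2 := ofWord_word (k := k) ⟨b, hb, hb'⟩
  simp only at e1 e2
  ext u
  rw [sum_ofWord_apply, e1, e2]
  simp only [relProd, Finsupp.linearCombination_single, one_smul]
  have : (∑ u ∈ (quasiShuffles_finite R ⟨a, ha, ha'⟩ ⟨b, hb, hb'⟩).toFinset,
      (Finsupp.single u 1 : QShd k)) u =
      if u ∈ quasiShuffles R ⟨a, ha, ha'⟩ ⟨b, hb, hb'⟩ then 1 else 0 := by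
    simp [Finsupp.finsetSum_apply, Finsupp.single_apply]
  rw [this]
  simp only [mem_qsFinset, ← word_mem_qsWords]

theorem relProd_add {R R' R'' : WithTop ℕ → WithTop ℕ → Prop}
    (h : ∀ x y, R'' x y ↔ R x y ∨ R' x y) (h' : ∀ x y, R x y → ¬ R' x y) :
    relProd k R + relProd k R' = relProd k R'' := by
  classical
  refine LinearMap.ext₂ fun x y => ?_
  rw [LinearMap.add_apply, LinearMap.add_apply]
  induction x using ofWord_induction with
  | add x₁ x₂ h1 h2 => simp only [map_add, LinearMap.add_apply, ← h1, ← h2]; abel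
  | smul c x h1 => simp only [map_smul, LinearMap.smul_apply, ← h1, smul_add]
  | basis a ha ha' =>
    induction y using ofWord_induction with
    | add x₁ x₂ h1 h2 => simp only [map_add, ← h1, ← h2]; abel
    | smul c x h1 => simp only [map_smul, ← h1, smul_add]
    | basis b hb hb' =>
      simp only [relProd_ofWord _ ha ha' hb hb']
      rw [← Finset.sum_union]
      · refine Finset.sum_congr ?_ fun _ _ => rfl
        ext u
        simp only [Finset.mem_union, mem_qsFinset, qsWords, Set.mem_ofPred_eq, h]
        constructor
        · rintro (⟨hu, u₁, u₂, h1, h2, h3, h4⟩ | ⟨hu, u₁, u₂, h1, h2, h3, h4⟩)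
          · exact ⟨hu, u₁, u₂, h1, h2, h3, .inl h4⟩
          · exact ⟨hu, u₁, u₂, h1, h2, h3, .inr h4⟩
        · rintro ⟨hu, u₁, u₂, h1, h2, h3, h4 | h4⟩
          · exact .inl ⟨hu, u₁, u₂, h1, h2, h3, h4⟩
          · exact .inr ⟨hu, u₁, u₂, h1, h2, h3, h4⟩
      · rw [Finset.disjoint_left]
        intro u hu hu'
        rw [mem_qsFinset] at hu hu'
        obtain ⟨-, u₁, u₂, h1, h2, h3, h4⟩ := hu
        obtain ⟨-, v₁, v₂, h1', h2', h3', h4'⟩ := hu'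
        -- The first factor has the length of `a`, so `u` determines its splitting and cannot
        -- satisfy both of the exclusive relations.
        have hl : u₁.length = v₁.length := by rw [← length_pack u₁, h2, ← h2', length_pack]
        obtain ⟨rfl, rfl⟩ := List.append_inj (h1.symm.trans h1') hl
        exact h' _ _ h4 h4'

theorem preceq_eq : preceq k = relProd k (· ≤ ·) :=
  relProd_add (fun _ _ => le_iff_lt_or_eq) fun _ _ h => h.ne

theorem succeq_eq : succeq k = relProd k (· ≥ ·) :=
  relProd_add (fun x y => by rw [ge_iff_le, le_iff_lt_or_eq, gt_iff_lt, eq_comm])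
    fun _ _ h => h.ne'

theorem star_eq : prec k + succ k + bullet k = relProd k fun _ _ => True := by
  rw [add_assoc]
  change prec k + succeq k = _
  rw [succeq_eq]
  exact relProd_add (fun x y => by simpa using lt_or_ge x y) fun _ _ h => not_le.2 h

/-! ### Iterated products -/

section

variable {R R' : WithTop ℕ → WithTop ℕ → Prop}

open Classical in
-- The intermediate word is `pack (u₁ ++ u₂)`. Packing preserves the comparison of the two minima,
-- so the condition `R` can be read on `u₁` and `u₂` directly.
theorem mem_biUnion_left (hR : OrdInv R) {a b c u : DecWord} :
    u ∈ (qsFinset R a b).biUnion (fun w => qsFinset R' w c) ↔ IsPacked u ∧ ∃ u₁ u₂ u₃,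
      u = u₁ ++ u₂ ++ u₃ ∧ pack u₁ = a ∧ pack u₂ = b ∧ pack u₃ = c ∧
      R (minLetter u₁) (minLetter u₂) ∧ R' (minLetter (u₁ ++ u₂)) (minLetter u₃) := by
  simp only [Finset.mem_biUnion, mem_qsFinset]
  constructor
  · rintro ⟨w, ⟨hw, w₁, w₂, rfl, rfl, rfl, h⟩, hu, v, u₃, rfl, h1, rfl, h'⟩
    obtain ⟨φ, hφ, e⟩ := (pack_eq_iff hw).1 h1
    refine ⟨hu, relabel φ w₁, relabel φ w₂, u₃, by simp [e], pack_relabel (hφ.mono (by simp)),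
      pack_relabel (hφ.mono (by simp)), rfl, ?_, by rwa [← relabel_append, ← e]⟩
    exact (hR _ _ _ _ (cmp_minLetter_relabel hφ)).2 h
  · rintro ⟨hu, u₁, u₂, u₃, rfl, rfl, rfl, rfl, h, h'⟩
    refine ⟨pack (u₁ ++ u₂), ⟨isPacked_pack _, ?_⟩, hu, u₁ ++ u₂, u₃, rfl, rfl, rfl, h'⟩
    have hm := strictMonoOn_rank (letterSet (u₁ ++ u₂))
    refine ⟨_, _, by rw [pack_eq_relabel, relabel_append], pack_relabel (hm.mono (by simp)),
      pack_relabel (hm.mono (by simp)), ?_⟩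
    exact (hR _ _ _ _ (cmp_minLetter_relabel hm)).2 h

open Classical in
theorem mem_biUnion_right (hR' : OrdInv R') {a b c u : DecWord} :
    u ∈ (qsFinset R' b c).biUnion (fun w => qsFinset R a w) ↔ IsPacked u ∧ ∃ u₁ u₂ u₃,
      u = u₁ ++ u₂ ++ u₃ ∧ pack u₁ = a ∧ pack u₂ = b ∧ pack u₃ = c ∧
      R (minLetter u₁) (minLetter (u₂ ++ u₃)) ∧ R' (minLetter u₂) (minLetter u₃) := by
  simp only [Finset.mem_biUnion, mem_qsFinset]
  constructor
  · rintro ⟨w, ⟨hw, w₁, w₂, rfl, rfl, rfl, h⟩, hu, u₁, v, rfl, rfl, h1, h'⟩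
    obtain ⟨φ, hφ, e⟩ := (pack_eq_iff hw).1 h1
    refine ⟨hu, u₁, relabel φ w₁, relabel φ w₂, by simp [e], rfl, pack_relabel (hφ.mono (by simp)),
      pack_relabel (hφ.mono (by simp)), by rwa [← relabel_append, ← e], ?_⟩
    exact (hR' _ _ _ _ (cmp_minLetter_relabel hφ)).2 h
  · rintro ⟨hu, u₁, u₂, u₃, rfl, rfl, rfl, rfl, h, h'⟩
    refine ⟨pack (u₂ ++ u₃), ⟨isPacked_pack _, ?_⟩, hu, u₁, u₂ ++ u₃, by simp, rfl, rfl, h⟩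
    have hm := strictMonoOn_rank (letterSet (u₂ ++ u₃))
    refine ⟨_, _, by rw [pack_eq_relabel, relabel_append], pack_relabel (hm.mono (by simp)),
      pack_relabel (hm.mono (by simp)), ?_⟩
    exact (hR' _ _ _ _ (cmp_minLetter_relabel hm)).2 h'

open Classical in
-- The union is disjoint: the intermediate word is the packing of a prefix of `u` of prescribed
-- length.
theorem sum_sum_left {M : Type*} [AddCommMonoid M] (F : DecWord → M) (a b c : DecWord) :
    ∑ w ∈ qsFinset R a b, ∑ u ∈ qsFinset R' w c, F u =
      ∑ u ∈ (qsFinset R a b).biUnion (fun w => qsFinset R' w c), F u := by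
  rw [Finset.sum_biUnion]
  intro w hw w' hw' hne
  rw [Function.onFun, Finset.disjoint_left]
  intro u hu hu'
  simp only [Finset.mem_coe, mem_qsFinset] at hw hw' hu hu'
  have hl := (length_of_mem_qsWords hw).trans (length_of_mem_qsWords hw').symm
  obtain ⟨-, u₁, u₂, rfl, rfl, -⟩ := hu
  obtain ⟨-, v₁, v₂, h, rfl, -⟩ := hu'
  rw [length_pack, length_pack] at hl
  exact hne (by rw [(List.append_inj h hl).1])

open Classical in
theorem sum_sum_right {M : Type*} [AddCommMonoid M] (F : DecWord → M) (a b c : DecWord) :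
    ∑ w ∈ qsFinset R' b c, ∑ u ∈ qsFinset R a w, F u =
      ∑ u ∈ (qsFinset R' b c).biUnion (fun w => qsFinset R a w), F u := by
  rw [Finset.sum_biUnion]
  intro w hw w' hw' hne
  rw [Function.onFun, Finset.disjoint_left]
  intro u hu hu'
  simp only [Finset.mem_coe, mem_qsFinset] at hw hw' hu hu'
  obtain ⟨-, u₁, u₂, rfl, h1, rfl, -⟩ := hu
  obtain ⟨-, v₁, v₂, h, h2, rfl, -⟩ := hu'
  have hl : u₁.length = v₁.length := by rw [← length_pack u₁, h1, ← h2, length_pack]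
  exact hne (by rw [(List.append_inj h hl).2])

/-- A generic associativity law for the products attached to four relations. -/
theorem relProd_assoc {R₁ R₂ R₃ R₄ : WithTop ℕ → WithTop ℕ → Prop} (h₁ : OrdInv R₁)
    (h₄ : OrdInv R₄) (h : ∀ x y z, R₁ x y ∧ R₂ (min x y) z ↔ R₃ x (min y z) ∧ R₄ y z)
    (x y z : QShd k) :
    relProd k R₂ (relProd k R₁ x y) z = relProd k R₃ x (relProd k R₄ y z) := by
  classical
  induction x using ofWord_induction with
  | add x₁ x₂ h1 h2 => simp only [map_add, LinearMap.add_apply, ← h1, ← h2]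
  | smul c x h1 => simp only [map_smul, LinearMap.smul_apply, ← h1]
  | basis a ha ha' =>
  induction y using ofWord_induction with
  | add x₁ x₂ h1 h2 => simp only [map_add, LinearMap.add_apply, ← h1, ← h2]
  | smul c x h1 => simp only [map_smul, LinearMap.smul_apply, ← h1]
  | basis b hb hb' =>
  induction z using ofWord_induction with
  | add x₁ x₂ h1 h2 => simp only [map_add, ← h1, ← h2]
  | smul c x h1 => simp only [map_smul, ← h1]
  | basis c hc hc' =>
  rw [relProd_ofWord _ ha ha' hb hb', relProd_ofWord _ hb hb' hc hc', map_sum, map_sum,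
    LinearMap.sum_apply]
  have e1 : ∀ w ∈ qsFinset R₁ a b, relProd k R₂ (ofWord k w) (ofWord k c) =
      ∑ u ∈ qsFinset R₂ w c, ofWord k u := fun w hw => by
    rw [mem_qsFinset] at hw
    exact relProd_ofWord _ (ne_nil_of_mem_qsWords hw (.inl ha)) hw.1 hc hc'
  have e2 : ∀ w ∈ qsFinset R₄ b c, relProd k R₃ (ofWord k a) (ofWord k w) =
      ∑ u ∈ qsFinset R₃ a w, ofWord k u := fun w hw => by
    rw [mem_qsFinset] at hw
    exact relProd_ofWord _ ha ha' (ne_nil_of_mem_qsWords hw (.inl hb)) hw.1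
  rw [Finset.sum_congr rfl e1, Finset.sum_congr rfl e2, sum_sum_left, sum_sum_right]
  refine Finset.sum_congr ?_ fun _ _ => rfl
  ext u
  simp only [mem_biUnion_left h₁, mem_biUnion_right h₄, minLetter_append, h]

end

/-- Each axiom becomes a fact about three elements of a linear order; the first one, for instance,
says that `x ≤ y` and `min x y ≤ z` hold together exactly when `x ≤ min y z`. -/
theorem isNSh_preceq_succ : IsNSh (preceq k) (succ k) := by
  have hs : ∀ x y, preceq k x y + succ k x y = relProd k (fun _ _ => True) x y := by
    intro x y
    rw [← star_eq, preceq, LinearMap.add_apply, LinearMap.add_apply, LinearMap.add_apply,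
      LinearMap.add_apply, LinearMap.add_apply, LinearMap.add_apply]
    abel
  constructor <;> intro x y z
  · rw [hs, preceq_eq]
    refine relProd_assoc ordInv_le ordInv_true (fun x y z => ?_) x y z
    simp only [and_true, le_min_iff]
    constructor
    · rintro ⟨h1, h2⟩; exact ⟨h1, by rwa [min_eq_left h1] at h2⟩
    · rintro ⟨h1, h2⟩; exact ⟨h1, by rwa [min_eq_left h1]⟩
  · rw [preceq_eq, succ]
    refine relProd_assoc ordInv_gt ordInv_le (fun x y z => ?_) x y z
    constructor
    · rintro ⟨h1, h2⟩
      rw [min_eq_right (le_of_lt h1)] at h2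
      exact ⟨by rwa [min_eq_left h2], h2⟩
    · rintro ⟨h1, h2⟩
      rw [min_eq_left h2] at h1
      exact ⟨h1, by rwa [min_eq_right (le_of_lt h1)]⟩
  · rw [hs, succ]
    refine relProd_assoc ordInv_true ordInv_gt (fun x y z => ?_) x y z
    simp only [gt_iff_lt, true_and, lt_min_iff]
    constructor
    · rintro ⟨h1, h2⟩; exact ⟨by rwa [min_eq_right h2.le], h2⟩
    · rintro ⟨h1, h2⟩; exact ⟨by rwa [min_eq_right h2.le] at h1, h2⟩

theorem isNSh_prec_succeq : IsNSh (prec k) (succeq k) := by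
  have hs : ∀ x y, prec k x y + succeq k x y = relProd k (fun _ _ => True) x y := by
    intro x y
    rw [← star_eq, succeq, LinearMap.add_apply, LinearMap.add_apply, LinearMap.add_apply,
      LinearMap.add_apply, LinearMap.add_apply, LinearMap.add_apply, add_assoc]
  constructor <;> intro x y z
  · rw [hs, prec]
    refine relProd_assoc ordInv_lt ordInv_true (fun x y z => ?_) x y z
    simp only [and_true, lt_min_iff]
    constructor
    · rintro ⟨h1, h2⟩; exact ⟨h1, by rwa [min_eq_left h1.le] at h2⟩
    · rintro ⟨h1, h2⟩; exact ⟨h1, by rwa [min_eq_left h1.le]⟩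
  · rw [succeq_eq, prec]
    refine relProd_assoc ordInv_ge ordInv_lt (fun x y z => ?_) x y z
    constructor
    · rintro ⟨h1, h2⟩
      rw [min_eq_right h1] at h2
      exact ⟨by rwa [min_eq_left h2.le], h2⟩
    · rintro ⟨h1, h2⟩
      rw [min_eq_left h2.le] at h1
      exact ⟨h1, by rwa [min_eq_right h1]⟩
  · rw [hs, succeq_eq]
    refine relProd_assoc ordInv_true ordInv_ge (fun x y z => ?_) x y z
    simp only [ge_iff_le, true_and, le_min_iff]
    constructor
    · rintro ⟨h1, h2⟩; exact ⟨by rwa [min_eq_right h2], h2⟩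
    · rintro ⟨h1, h2⟩; exact ⟨by rwa [min_eq_right h2] at h1, h2⟩

end

/-! ### Cutting quasi-shuffles -/

theorem exists_threshold {φ : ℕ → ℕ} {a : DecWord} (ha : IsPacked a)
    (hφ : StrictMonoOn φ (letterSet a)) (i : ℕ) :
    ∃ j ≤ maxLetter a, ∀ x ∈ letterSet a, φ x ≤ i ↔ x ≤ j := by
  -- The disjunct `x = 0` makes the predicate satisfiable, so that the greatest solution satisfies
  -- it too; the threshold is 0 when `φ` sends no letter of `a` to a value at most `i`.
  refine ⟨Nat.findGreatest (fun x => x = 0 ∨ φ x ≤ i) (maxLetter a), Nat.findGreatest_le _, ?_⟩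
  intro x hx
  have hx' := hx
  rw [ha.letterSet_eq, Finset.mem_Icc] at hx'
  constructor
  · intro h
    exact Nat.le_findGreatest hx'.2 (.inr h)
  · intro h
    have hs : (fun x => x = 0 ∨ φ x ≤ i) (Nat.findGreatest (fun x => x = 0 ∨ φ x ≤ i)
      (maxLetter a)) := Nat.findGreatest_spec (P := fun x => x = 0 ∨ φ x ≤ i) (Nat.zero_le _) (.inl rfl)
    rcases hs with hs | hs
    · omega
    · refine le_trans ((hφ.le_iff_le hx ?_).2 h) hs
      rw [ha.letterSet_eq, Finset.coe_Icc, Set.mem_Icc]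
      exact ⟨hx'.1.trans h, Nat.findGreatest_le _⟩

theorem card_letterSet_pack (l : DecWord) : (letterSet (pack l)).card = (letterSet l).card := by
  rw [pack_eq_relabel, letterSet_relabel, Finset.card_image_of_injOn (strictMonoOn_rank _).injOn]

/-- The threshold of `φ` at `i` is the number of distinct letters of `u` that are at most `i`. It
can therefore be read on `u`, without reference to `φ`. -/
theorem exists_split {a u : DecWord} (h : pack u = a) (i : ℕ) :
    ∃ φ, StrictMonoOn φ (letterSet a) ∧ u = relabel φ a ∧
      (letterSet (lo i u)).card ≤ maxLetter a ∧
      ∀ x ∈ letterSet a, φ x ≤ i ↔ x ≤ (letterSet (lo i u)).card := by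
  have ha : IsPacked a := h ▸ isPacked_pack u
  obtain ⟨φ, hφ, rfl⟩ := (pack_eq_iff ha).1 h
  obtain ⟨j, hj, hij⟩ := exists_threshold ha hφ i
  have : (letterSet (lo i (relabel φ a))).card = j := by
    rw [lo_relabel hij, letterSet_relabel, Finset.card_image_of_injOn, ha.letterSet_lo]
    · simp [hj]
    · exact hφ.injOn.mono (by rw [letterSet_lo]; intro x; simp +contextual)
  exact ⟨φ, hφ, rfl, this ▸ hj, this ▸ hij⟩

theorem pack_lo {a u : DecWord} (h : pack u = a) (i : ℕ) :
    pack (lo i u) = lo (letterSet (lo i u)).card a := by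
  have ha : IsPacked a := h ▸ isPacked_pack u
  obtain ⟨φ, hφ, hu, hj, hij⟩ := exists_split h i
  set j := (letterSet (lo i u)).card
  rw [hu, lo_relabel hij, pack_relabel, (ha.lo j).pack_eq]
  exact hφ.mono (by rw [letterSet_lo]; intro x; simp +contextual)

theorem pack_hi {a u : DecWord} (h : pack u = a) (i : ℕ) :
    pack (hi i u) = hi (letterSet (lo i u)).card a := by
  have ha : IsPacked a := h ▸ isPacked_pack u
  obtain ⟨φ, hφ, hu, hj, hij⟩ := exists_split h i
  set j := (letterSet (lo i u)).card
  rw [hu, hi_relabel hij, pack_relabel, (ha.hi j).pack_eq]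
  intro x hx y hy hxy
  rw [Finset.mem_coe, mem_letterSet_hi] at hx hy
  have h1 := hφ hx.2 hy.2 (Nat.add_lt_add_right hxy j)
  have h2 := hij _ hx.2
  change φ (x + j) - i < φ (y + j) - i
  omega

/-- The common packing records which positions hold low letters and which hold high ones; the two
parts supply the letters themselves. -/
theorem eq_of_lo_eq_of_hi_eq {u u' : DecWord} {i : ℕ} (h : pack u = pack u')
    (hlo : lo i u = lo i u') (hhi : hi i u = hi i u') : u = u' := by
  obtain ⟨φ, hφ, hu, -, hij⟩ := exists_split h i
  obtain ⟨φ', hφ', hu', -, hij'⟩ := exists_split (a := pack u') rfl i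
  rw [hlo] at hij
  set a := pack u'
  set j := (letterSet (lo i u')).card
  rw [hu, hu', lo_relabel hij, lo_relabel hij', relabel_eq_relabel] at hlo
  rw [hu, hu', hi_relabel hij, hi_relabel hij', relabel_eq_relabel] at hhi
  rw [hu, hu', relabel_eq_relabel]
  intro x hx
  by_cases hxj : x ≤ j
  · exact hlo x (by simp [hx, hxj])
  · have := hhi (x - j) (mem_letterSet_hi.2 ⟨by omega, by rwa [Nat.sub_add_cancel (by omega)]⟩)
    rw [Nat.sub_add_cancel (by omega)] at this
    have h1 := hij x hx
    have h2 := hij' x hx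
    omega

/-- The word `a` is the pattern: its letters up to `j` are replaced by those of `v`, the others by
those of `w` raised by `M`. The bounds on `v` and `w` make this relabelling increasing, with
threshold `j` at the level `M`. -/
theorem exists_glue {a v w : DecWord} {j M : ℕ} (ha : IsPacked a) (hv : pack v = lo j a)
    (hw : pack w = hi j a) (hvM : ∀ x ∈ letterSet v, x ≤ M) (hw1 : ∀ x ∈ letterSet w, 1 ≤ x) :
    ∃ u, pack u = a ∧ lo M u = v ∧ hi M u = w := by
  obtain ⟨α, hα, rfl⟩ := (pack_eq_iff (ha.lo j)).1 hv
  obtain ⟨γ, hγ, rfl⟩ := (pack_eq_iff (ha.hi j)).1 hw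
  have hvM' : ∀ x ∈ letterSet a, x ≤ j → α x ≤ M := fun x hx hxj =>
    hvM _ (by rw [letterSet_relabel]; exact Finset.mem_image_of_mem _ (by simp [hx, hxj]))
  have hm : ∀ x ∈ letterSet a, ¬ x ≤ j → x - j ∈ letterSet (hi j a) := fun x hx hxj =>
    mem_letterSet_hi.2 ⟨by omega, by rwa [Nat.sub_add_cancel (by omega)]⟩
  have hw1' : ∀ x ∈ letterSet a, ¬ x ≤ j → 1 ≤ γ (x - j) := fun x hx hxj =>
    hw1 _ (by rw [letterSet_relabel]; exact Finset.mem_image_of_mem _ (hm x hx hxj))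
  set φ : ℕ → ℕ := fun x => if x ≤ j then α x else M + γ (x - j) with hφ
  have hφm : StrictMonoOn φ (letterSet a) := by
    intro x hx y hy hxy
    simp only [hφ]
    split_ifs with h1 h2 h2
    · exact hα (by simpa [h1] using hx) (by simpa [h2] using hy) hxy
    · have := hvM' x hx h1
      have := hw1' y hy h2
      omega
    · omega
    · have := hγ (hm x hx h1) (hm y hy h2) (by omega)
      omega
  have hij : ∀ x ∈ letterSet a, φ x ≤ M ↔ x ≤ j := by
    intro x hx
    simp only [hφ]
    split_ifs with h1
    · simp [h1, hvM' x hx h1]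
    · have := hw1' x hx h1
      omega
  refine ⟨relabel φ a, by rw [pack_relabel hφm, ha.pack_eq], ?_, ?_⟩
  · rw [lo_relabel hij, relabel_eq_relabel]
    intro x hx
    simp only [letterSet_lo, Finset.mem_filter] at hx
    simp [hφ, hx.2]
  · rw [hi_relabel hij, relabel_eq_relabel]
    intro x hx
    rw [mem_letterSet_hi] at hx
    simp only [hφ]
    rw [if_neg (by omega)]
    simp

theorem letterSet_eq_lo_union_hi (i : ℕ) (u : DecWord) :
    letterSet u = letterSet (lo i u) ∪ (letterSet (hi i u)).image (· + i) := by
  ext x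
  simp only [letterSet_lo, Finset.mem_union, Finset.mem_filter, Finset.mem_image, mem_letterSet_hi]
  constructor
  · intro h
    by_cases hx : x ≤ i
    · exact .inl ⟨h, hx⟩
    · exact .inr ⟨x - i, ⟨by omega, by rwa [Nat.sub_add_cancel (by omega)]⟩, by omega⟩
  · rintro (h | ⟨y, ⟨-, h⟩, rfl⟩)
    · exact h.1
    · exact h

/-- The third hypothesis says that the lower part reaches `i`, which excludes a gap between the two
parts. -/
theorem letterSet_of_lo_hi {u : DecWord} {i : ℕ} (h1 : IsPacked (lo i u))
    (h2 : IsPacked (hi i u)) (h3 : maxLetter (lo i u) = i) :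
    letterSet u = Finset.Icc 1 (i + maxLetter (hi i u)) := by
  rw [letterSet_eq_lo_union_hi i u, h1.letterSet_eq, h2.letterSet_eq, h3]
  ext x
  simp only [Finset.mem_union, Finset.mem_Icc, Finset.mem_image]
  constructor
  · rintro (h | ⟨y, h, rfl⟩) <;> omega
  · intro h
    by_cases hx : x ≤ i
    · exact .inl ⟨h.1, hx⟩
    · exact .inr ⟨x - i, by omega, by omega⟩

theorem lo_eq_nil_or {i : ℕ} {l : DecWord} :
    (lo i l = [] ∧ (i : WithTop ℕ) < minLetter l) ∨
      (minLetter (lo i l) = minLetter l ∧ minLetter l ≤ (i : WithTop ℕ)) := by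
  by_cases hl : l = []
  · subst hl
    exact .inl ⟨rfl, WithTop.coe_lt_top _⟩
  obtain ⟨x, hx, hx1, hx2⟩ := exists_minLetter hl
  by_cases h : x ≤ i
  · right
    rw [hx1, minLetter_eq_coe]
    refine ⟨⟨by simp [hx, h], fun y hy => hx2 y ?_⟩, by exact_mod_cast h⟩
    simp only [letterSet_lo, Finset.mem_filter] at hy
    exact hy.1
  · left
    rw [hx1]
    refine ⟨?_, by exact_mod_cast not_le.1 h⟩
    rw [← letterSet_eq_empty, letterSet_lo, Finset.filter_eq_empty_iff]
    intro y hy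
    have := hx2 y hy
    omega

/-- As soon as some letter is at most `i`, the smaller of the two minima survives the cut. If the
other one exceeds `i`, it is replaced by `⊤`, which leaves the comparison unchanged. -/
theorem cmp_minLetter_lo {i : ℕ} {l l' : DecWord} (h : lo i (l ++ l') ≠ []) :
    cmp (minLetter (lo i l)) (minLetter (lo i l')) = cmp (minLetter l) (minLetter l') := by
  rcases lo_eq_nil_or (i := i) (l := l) with ⟨h1, h2⟩ | ⟨h1, h2⟩ <;>
    rcases lo_eq_nil_or (i := i) (l := l') with ⟨h3, h4⟩ | ⟨h3, h4⟩
  · simp [h1, h3] at h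
  · rw [h1, h3, minLetter_nil, (cmp_eq_gt_iff _ _).2 (h4.trans_lt h2),
      (cmp_eq_gt_iff _ _).2 (h4.trans_lt (WithTop.coe_lt_top _))]
  · rw [h1, h3, minLetter_nil, (cmp_eq_lt_iff _ _).2 (h2.trans_lt h4),
      (cmp_eq_lt_iff _ _).2 (h2.trans_lt (WithTop.coe_lt_top _))]
  · rw [h1, h3]

/-- The first letter of the word, if there is one, is at most `i`. -/
def HeadLe (i : ℕ) (l : DecWord) : Prop := ∀ p ∈ l.head?, p.1 ≤ i

theorem headLe_append {i : ℕ} {l l' : DecWord} (h : l ≠ []) :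
    HeadLe i (l ++ l') ↔ HeadLe i l := by
  cases l with
  | nil => exact absurd rfl h
  | cons p l => rfl

theorem headLe_relabel {φ : ℕ → ℕ} {i j : ℕ} {l : DecWord}
    (h : ∀ x ∈ letterSet l, φ x ≤ i ↔ x ≤ j) : HeadLe i (relabel φ l) ↔ HeadLe j l := by
  cases l with
  | nil => simp [HeadLe]
  | cons p l =>
    have := h p.1 (fst_mem_letterSet (by simp))
    simpa [HeadLe, relabel] using this

/-- Cutting the quasi-shuffles of `a` and `b` amounts to quasi-shuffling the cuts of `a` and
`b`. -/
theorem sum_cuts {M : Type*} [AddCommMonoid M] {R : WithTop ℕ → WithTop ℕ → Prop}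
    (hR : OrdInv R) {a b : DecWord} (ha : IsPacked a) (ha0 : a ≠ []) (hb : IsPacked b)
    (F : Prop → DecWord → DecWord → M) :
    ∑ u ∈ qsFinset R a b, ∑ i ∈ Finset.Ico 1 (maxLetter u), F (HeadLe i u) (lo i u) (hi i u) =
      ∑ j ∈ Finset.range (maxLetter a + 1), ∑ l ∈ Finset.range (maxLetter b + 1),
        if (j = 0 ∧ l = 0) ∨ (j = maxLetter a ∧ l = maxLetter b) then 0
        else ∑ v ∈ qsFinset R (lo j a) (lo l b), ∑ w ∈ qsFinset (fun _ _ => True) (hi j a) (hi l b),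
          F (HeadLe j a) v w := by
  set S : Finset (Σ _ : DecWord, ℕ) :=
    (qsFinset R a b).sigma fun u => Finset.Ico 1 (maxLetter u) with hS
  -- The pair `(j, l)`: the numbers of distinct letters at most `i` in the two factors of the
  -- quasi-shuffle. The double sum is split along the fibres of this map.
  set c : (Σ _ : DecWord, ℕ) → ℕ × ℕ := fun x =>
    ((letterSet (lo x.2 (x.1.take a.length))).card,
      (letterSet (lo x.2 (x.1.drop a.length))).card) with hc
  have hmem : ∀ x ∈ S, ∃ u₁ u₂, x.1 = u₁ ++ u₂ ∧ IsPacked (u₁ ++ u₂) ∧ pack u₁ = a ∧ pack u₂ = b ∧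
      R (minLetter u₁) (minLetter u₂) ∧
      c x = ((letterSet (lo x.2 u₁)).card, (letterSet (lo x.2 u₂)).card) ∧
      1 ≤ x.2 ∧ x.2 < maxLetter (u₁ ++ u₂) := by
    rintro ⟨u, i⟩ hx
    simp only [hS, Finset.mem_sigma, mem_qsFinset, Finset.mem_Ico] at hx
    obtain ⟨⟨hu, u₁, u₂, rfl, h1, h2, h3⟩, hi⟩ := hx
    refine ⟨u₁, u₂, rfl, hu, h1, h2, h3, ?_, hi⟩
    simp only [hc, ← h1, length_pack, List.take_left, List.drop_left]
  have hmaps : ∀ x ∈ S, c x ∈ Finset.range (maxLetter a + 1) ×ˢ Finset.range (maxLetter b + 1) := by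
    intro x hx
    obtain ⟨u₁, u₂, -, -, h1, h2, -, hcx, -⟩ := hmem x hx
    obtain ⟨_, _, _, h3, -⟩ := exists_split h1 x.2
    obtain ⟨_, _, _, h4, -⟩ := exists_split h2 x.2
    rw [hcx, Finset.mem_product, Finset.mem_range, Finset.mem_range]
    exact ⟨Nat.lt_succ_of_le h3, Nat.lt_succ_of_le h4⟩
  rw [← Finset.sum_sigma (qsFinset R a b) (fun u => Finset.Ico 1 (maxLetter u))
    (fun x => F (HeadLe x.2 x.1) (lo x.2 x.1) (hi x.2 x.1)), ← hS,
    ← Finset.sum_fiberwise_of_maps_to hmaps, Finset.sum_product]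
  refine Finset.sum_congr rfl fun j hj => Finset.sum_congr rfl fun l hlb => ?_
  rw [Finset.mem_range, Nat.lt_succ_iff] at hj hlb
  split_ifs with hjl
  -- The two excluded pairs would make the lower or the upper part empty, which is impossible for `1
  -- ≤ i < maxLetter u`.
  · rw [Finset.filter_false_of_mem, Finset.sum_empty]
    intro x hx hcx
    obtain ⟨u₁, u₂, -, hu, h1, h2, -, hcx', hi1, hi2⟩ := hmem x hx
    rw [hcx, Prod.mk.injEq] at hcx'
    rcases hjl with ⟨rfl, rfl⟩ | ⟨rfl, rfl⟩
    · have e1 := letterSet_eq_empty.1 (Finset.card_eq_zero.1 hcx'.1.symm)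
      have e2 := letterSet_eq_empty.1 (Finset.card_eq_zero.1 hcx'.2.symm)
      have := hu.maxLetter_lo x.2
      rw [lo_append, e1, e2, List.append_nil, isPacked_nil.maxLetter_eq_zero.2 rfl] at this
      omega
    · have e1 := pack_hi h1 x.2
      have e2 := pack_hi h2 x.2
      rw [← hcx'.1, ha.hi_eq_nil le_rfl, pack_eq_nil] at e1
      rw [← hcx'.2, hb.hi_eq_nil le_rfl, pack_eq_nil] at e2
      have := hu.maxLetter_hi x.2
      rw [hi_append, e1, e2, List.append_nil, isPacked_nil.maxLetter_eq_zero.2 rfl] at this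
      omega
  rw [← Finset.sum_product (qsFinset R (lo j a) (lo l b))
    (qsFinset (fun _ _ => True) (hi j a) (hi l b)) (fun x => F (HeadLe j a) x.1 x.2)]
  refine Finset.sum_nbij (fun x => (lo x.2 x.1, hi x.2 x.1)) ?_ ?_ ?_ ?_
  · intro x hx
    rw [Finset.mem_filter] at hx
    obtain ⟨u₁, u₂, hxu, hu, h1, h2, h3, hcx, hi1, hi2⟩ := hmem x hx.1
    rw [hx.2, Prod.mk.injEq] at hcx
    simp only [Finset.mem_product, mem_qsFinset, hxu]
    refine ⟨⟨hu.lo _, _, _, lo_append _ _ _, by rw [pack_lo h1, ← hcx.1],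
      by rw [pack_lo h2, ← hcx.2], ?_⟩, hu.hi _, _, _, hi_append _ _ _,
      by rw [pack_hi h1, ← hcx.1], by rw [pack_hi h2, ← hcx.2], trivial⟩
    refine (hR _ _ _ _ (cmp_minLetter_lo fun h => ?_)).2 h3
    have := hu.maxLetter_lo x.2
    rw [h, isPacked_nil.maxLetter_eq_zero.2 rfl] at this
    omega
  · intro x hx y hy hxy
    rw [Finset.mem_coe, Finset.mem_filter] at hx hy
    obtain ⟨u₁, u₂, hxu, hu, h1, h2, -, hcx, hi1, hi2⟩ := hmem x hx.1
    obtain ⟨v₁, v₂, hyv, hv, h1', h2', -, hcy, hi1', hi2'⟩ := hmem y hy.1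
    obtain ⟨x1, i⟩ := x
    obtain ⟨y1, i'⟩ := y
    simp only at hxu hyv
    subst hxu hyv
    simp only [Prod.mk.injEq] at hxy hi1 hi2 hi1' hi2'
    -- The level of the cut is recovered as the largest letter of the lower part.
    have hii : i = i' := by
      have := congrArg maxLetter hxy.1
      rw [hu.maxLetter_lo, hv.maxLetter_lo] at this
      omega
    subst hii
    rw [eq_of_lo_eq_of_hi_eq (i := i) _ hxy.1 hxy.2]
    rw [hx.2, Prod.mk.injEq] at hcx
    rw [hy.2, Prod.mk.injEq] at hcy
    rw [lo_append, lo_append, hi_append, hi_append] at hxy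
    obtain ⟨e1, e2⟩ := List.append_inj hxy.1 (by
      rw [← length_pack, pack_lo h1, ← length_pack (lo i v₁), pack_lo h1', ← hcx.1, ← hcy.1])
    obtain ⟨e3, e4⟩ := List.append_inj hxy.2 (by
      rw [← length_pack, pack_hi h1, ← length_pack (hi i v₁), pack_hi h1', ← hcx.1, ← hcy.1])
    rw [eq_of_lo_eq_of_hi_eq (h1.trans h1'.symm) e1 e3, eq_of_lo_eq_of_hi_eq (h2.trans h2'.symm) e2 e4]
  · rintro ⟨v, w⟩ hvw
    simp only [Finset.coe_product, Set.mem_prod, Finset.mem_coe, mem_qsFinset] at hvw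
    obtain ⟨⟨hv, v₁, v₂, rfl, hv1, hv2, hv3⟩, hw, w₁, w₂, rfl, hw1, hw2, -⟩ := hvw
    -- The only possible level: in a packed word the lower part must end exactly at `i`.
    set i := maxLetter (v₁ ++ v₂) with hi
    have hvle : ∀ x ∈ letterSet (v₁ ++ v₂), x ≤ i := fun x hx => by
      rw [hv.letterSet_eq, Finset.mem_Icc] at hx; exact hx.2
    have hwle : ∀ x ∈ letterSet (w₁ ++ w₂), 1 ≤ x := fun x hx => by
      rw [hw.letterSet_eq, Finset.mem_Icc] at hx; exact hx.1
    obtain ⟨u₁, hu1, hl1, hh1⟩ := exists_glue ha hv1 hw1 (fun x hx => hvle x (by simp [hx]))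
      (fun x hx => hwle x (by simp [hx]))
    obtain ⟨u₂, hu2, hl2, hh2⟩ := exists_glue hb hv2 hw2 (fun x hx => hvle x (by simp [hx]))
      (fun x hx => hwle x (by simp [hx]))
    have hl : lo i (u₁ ++ u₂) = v₁ ++ v₂ := by rw [lo_append, hl1, hl2]
    have hh : QSh.hi i (u₁ ++ u₂) = w₁ ++ w₂ := by rw [hi_append, hh1, hh2]
    have hu := letterSet_of_lo_hi (u := u₁ ++ u₂) (i := i) (by rwa [hl]) (by rwa [hh]) (by rw [hl])
    -- Both parts are nonempty because `(j, l)` is not an excluded pair; this places the cut in the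
    -- range `1 ≤ i < maxLetter u`.
    have hv0 : v₁ ++ v₂ ≠ [] := by
      intro h
      rw [List.append_eq_nil_iff] at h
      rw [h.1] at hv1
      rw [h.2] at hv2
      have e1 := ha.maxLetter_lo j
      have e2 := hb.maxLetter_lo l
      rw [← hv1, pack_nil, isPacked_nil.maxLetter_eq_zero.2 rfl] at e1
      rw [← hv2, pack_nil, isPacked_nil.maxLetter_eq_zero.2 rfl] at e2
      omega
    have hw0 : w₁ ++ w₂ ≠ [] := by
      intro h
      rw [List.append_eq_nil_iff] at h
      rw [h.1] at hw1
      rw [h.2] at hw2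
      have e1 := ha.maxLetter_hi j
      have e2 := hb.maxLetter_hi l
      rw [← hw1, pack_nil, isPacked_nil.maxLetter_eq_zero.2 rfl] at e1
      rw [← hw2, pack_nil, isPacked_nil.maxLetter_eq_zero.2 rfl] at e2
      omega
    have hi0 := mt hv.maxLetter_eq_zero.1 hv0
    have hmw := mt hw.maxLetter_eq_zero.1 hw0
    have hxS : (⟨u₁ ++ u₂, i⟩ : Σ _ : DecWord, ℕ) ∈ S := by
      simp only [hS, Finset.mem_sigma, mem_qsFinset, Finset.mem_Ico]
      refine ⟨⟨⟨_, hu⟩, u₁, u₂, rfl, hu1, hu2, ?_⟩, by omega, ?_⟩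
      · rw [← hl1, ← hl2] at hv3
        exact (hR _ _ _ _ (cmp_minLetter_lo (by rwa [hl]))).1 hv3
      · rw [maxLetter_eq_of_letterSet hu, hh]
        omega
    refine ⟨⟨u₁ ++ u₂, i⟩, ?_, by simp only [hl, hh]⟩
    rw [Finset.mem_coe, Finset.mem_filter]
    refine ⟨hxS, ?_⟩
    have e1 : (letterSet v₁).card = j := by
      rw [← card_letterSet_pack, hv1, ha.letterSet_lo]; simp [hj]
    have e2 : (letterSet v₂).card = l := by
      rw [← card_letterSet_pack, hv2, hb.letterSet_lo]; simp [hlb]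
    have e3 : a.length = u₁.length := by rw [← hu1, length_pack]
    simp only [hc, e3, List.take_left, List.drop_left, hl1, hl2, e1, e2]
  · intro x hx
    rw [Finset.mem_filter] at hx
    obtain ⟨u₁, u₂, hxu, -, h1, -, -, hcx, -⟩ := hmem x hx.1
    rw [hx.2, Prod.mk.injEq] at hcx
    obtain ⟨φ, hφ, hφu, -, hij⟩ := exists_split h1 x.2
    have hu0 : u₁ ≠ [] := by rintro rfl; exact ha0 h1.symm
    -- Since `a` is nonempty, the first letter of the quasi-shuffle comes from `a`, so the weight
    -- depends on `j` alone.
    have : HeadLe x.2 x.1 ↔ HeadLe j a := by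
      rw [hxu, headLe_append hu0, hcx.1]
      conv_lhs => rw [hφu]
      exact headLe_relabel hij
    simp only [this]

section

variable {k : Type*} [Field k]

/-! ### Weighted deconcatenation coproducts -/

theorem IsPacked.maxLetter_pos {a : DecWord} (ha : IsPacked a) (h : a ≠ []) : 0 < maxLetter a :=
  Nat.pos_of_ne_zero (mt ha.maxLetter_eq_zero.1 h)

theorem IsPacked.lo_ne_nil {a : DecWord} (ha : IsPacked a) (h : a ≠ []) {i : ℕ} (hi : 1 ≤ i) :
    QSh.lo i a ≠ [] := by
  have := ha.maxLetter_pos h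
  rw [Ne, ← (ha.lo i).maxLetter_eq_zero, ha.maxLetter_lo]
  omega

theorem IsPacked.hi_ne_nil {a : DecWord} (ha : IsPacked a) {i : ℕ} (hi : i < maxLetter a) :
    QSh.hi i a ≠ [] := by
  rw [Ne, ← (ha.hi i).maxLetter_eq_zero, ha.maxLetter_hi]
  omega

theorem IsPacked.headLe_maxLetter {a : DecWord} (ha : IsPacked a) : HeadLe (maxLetter a) a := by
  intro p hp
  have := fst_mem_letterSet (List.mem_of_mem_head? hp)
  rw [ha.letterSet_eq, Finset.mem_Icc] at this
  exact this.2

theorem IsPacked.not_headLe_zero {a : DecWord} (ha : IsPacked a) (h : a ≠ []) :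
    ¬ HeadLe 0 a := by
  cases a with
  | nil => exact absurd rfl h
  | cons p a =>
    intro h
    have h1 := h p rfl
    have := fst_mem_letterSet (l := p :: a) (by simp : p ∈ p :: a)
    rw [ha.letterSet_eq, Finset.mem_Icc] at this
    omega

/-- The coproduct cutting a word at all letters, the cut at `i` having a weight that depends on
whether the first letter is at most `i`. -/
noncomputable def weightedCoprd (χ : Prop → k) : Coprd k (QShd k) :=
  Finsupp.linearCombination k fun a : DPW =>
    ∑ i ∈ Finset.Ico 1 (maxLetter a.word),
      χ (HeadLe i a.word) • (ofWord k (lo i a.word) ⊗ₜ[k] ofWord k (hi i a.word))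

theorem weightedCoprd_ofWord (χ : Prop → k) {a : DecWord} (ha : IsPacked a) (ha0 : a ≠ []) :
    weightedCoprd χ (ofWord k a) = ∑ i ∈ Finset.Ico 1 (maxLetter a),
      χ (HeadLe i a) • (ofWord k (lo i a) ⊗ₜ[k] ofWord k (hi i a)) := by
  have e1 := ofWord_word (k := k) ⟨a, ha0, ha⟩
  simp only at e1
  rw [e1, weightedCoprd, Finsupp.linearCombination_single, one_smul]

/-- On a packed word, packing leaves the lower letters fixed and shifts the upper ones by `i`. The
bounds on `i` make both parts nonempty, so the zero branch of `restrict` is never taken. -/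
theorem cut_eq (a : DPW) {i : ℕ} (h1 : 1 ≤ i) (h2 : i < maxLetter a.word) :
    cut k a i = ofWord k (lo i a.word) ⊗ₜ[k] ofWord k (hi i a.word) := by
  obtain ⟨a, ha0, ha⟩ := a
  simp only at h2
  have hmem : ∀ p ∈ a, 1 ≤ p.1 ∧ p.1 ≤ maxLetter a := fun p hp => by
    have := fst_mem_letterSet hp
    rwa [ha.letterSet_eq, Finset.mem_Icc] at this
  have e1 : (a.filter fun p => p.1 ∈ Finset.Icc 1 i) = lo i a := by
    apply List.filter_congr
    intro p hp
    have := hmem p hp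
    simp; omega
  have e2 : (a.filter fun p => p.1 ∈ Finset.Icc (i + 1) (maxLetter a)) =
      a.filter fun p => i < p.1 := by
    apply List.filter_congr
    intro p hp
    have := hmem p hp
    simp; omega
  have e3 : pack (a.filter fun p => i < p.1) = hi i a := by
    rw [← (ha.hi i).pack_eq]
    rw [hi, pack_relabel]
    intro x hx y hy hxy
    obtain ⟨d, hd⟩ := mem_letterSet.1 hx
    simp only [List.mem_filter, decide_eq_true_eq] at hd
    change x - i < y - i
    omega
  have n1 := ha.lo_ne_nil ha0 h1
  have n2 : (a.filter fun p => i < p.1) ≠ [] := by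
    have := ha.hi_ne_nil h2
    rwa [hi, Ne, relabel_eq_nil] at this
  unfold cut restrict
  simp only [e1, e2, e3, (ha.lo i).pack_eq]
  rw [dif_pos n1, dif_pos n2, ofWord, ofWord, dif_pos ⟨n1, ha.lo i⟩,
    dif_pos ⟨ha.hi_ne_nil h2, ha.hi i⟩]

theorem headLe_word (a : DPW) (i : ℕ) : HeadLe i a.word ↔ a.firstLetter ≤ i := by
  simp [HeadLe, DPW.firstLetter, List.head?_eq_some_head a.ne_nil]

theorem firstLetter_mem (a : DPW) : 1 ≤ a.firstLetter ∧ a.firstLetter ≤ maxLetter a.word := by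
  have := fst_mem_letterSet (List.head_mem a.ne_nil)
  rwa [a.packed.letterSet_eq, Finset.mem_Icc] at this

open Classical in
theorem deltaPrec_eq : deltaPrec k = weightedCoprd fun c => if c then 1 else 0 := by
  rw [deltaPrec, weightedCoprd]
  congr 1
  ext1 a
  simp only [headLe_word, ite_smul, one_smul, zero_smul, ← Finset.sum_filter]
  have hf := firstLetter_mem a
  refine Finset.sum_congr ?_ fun i hi => cut_eq a ?_ ?_
  · ext i; simp; omega
  · simp at hi; omega
  · simp at hi; omega

open Classical in
theorem deltaSucc_eq : deltaSucc k = weightedCoprd fun c => if c then 0 else 1 := by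
  rw [deltaSucc, weightedCoprd]
  congr 1
  ext1 a
  simp only [headLe_word, ite_smul, one_smul, zero_smul]
  have hf := firstLetter_mem a
  have : ∀ (i : ℕ) (t : QShd k ⊗[k] QShd k), (if a.firstLetter ≤ i then 0 else t) =
    if ¬ a.firstLetter ≤ i then t else 0 := fun i t => by split_ifs <;> rfl
  simp only [this, ← Finset.sum_filter]
  refine Finset.sum_congr ?_ fun i hi => cut_eq a ?_ ?_
  · ext i; simp; omega
  · simp at hi; omega
  · simp at hi; omega

theorem weightedCoprd_add (χ χ' : Prop → k) :
    weightedCoprd χ + weightedCoprd χ' = weightedCoprd (χ + χ') := by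
  refine LinearMap.ext fun x => ?_
  rw [LinearMap.add_apply]
  induction x using ofWord_induction with
  | add x y hx hy => simp only [map_add, ← hx, ← hy]; abel
  | smul c x hx => simp only [map_smul, ← hx, smul_add]
  | basis a ha0 ha =>
    simp only [weightedCoprd_ofWord _ ha ha0, Pi.add_apply, add_smul, Finset.sum_add_distrib]

/-- The coproduct `Δ̃`. -/
theorem deltaPrec_add_deltaSucc : deltaPrec k + deltaSucc k = weightedCoprd fun _ => 1 := by
  classical
  rw [deltaPrec_eq, deltaSucc_eq, weightedCoprd_add]
  congr 1
  ext c
  simp only [Pi.add_apply]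
  split_ifs <;> simp

theorem sum_range_succ_eq_ends {M : Type*} [AddCommMonoid M] (g : ℕ → M) {m : ℕ} (hm : 0 < m) :
    ∑ j ∈ Finset.range (m + 1), g j = g 0 + ∑ j ∈ Finset.Ico 1 m, g j + g m := by
  rw [Finset.sum_range_succ, Finset.range_eq_Ico, Finset.sum_eq_sum_Ico_succ_bot hm]

open Classical in
-- The minimum of a nonempty word is finite and that of the empty word is `⊤`, so `a` occurs or not
-- according to the value of `R` on any finite element and `⊤`; 0 stands for the finite element.
theorem sum_qsFinset_nil_right {M : Type*} [AddCommMonoid M] {R : WithTop ℕ → WithTop ℕ → Prop}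
    (hR : OrdInv R) {a : DecWord} (ha : IsPacked a) (ha0 : a ≠ []) (F : DecWord → M) :
    ∑ u ∈ qsFinset R a [], F u = if R 0 ⊤ then F a else 0 := by
  obtain ⟨x, -, hx, -⟩ := exists_minLetter ha0
  have hcmp : R (minLetter a) ⊤ ↔ R 0 ⊤ := hR _ _ _ _ (by
    rw [hx, (cmp_eq_lt_iff (x : WithTop ℕ) ⊤).2 (WithTop.coe_lt_top x),
      (cmp_eq_lt_iff (0 : WithTop ℕ) ⊤).2 (WithTop.coe_lt_top 0)])
  have : qsFinset R a [] = if R 0 ⊤ then {a} else ∅ := by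
    ext u
    rw [mem_qsFinset, qsWords_nil_right ha, Set.mem_ofPred_eq, hcmp]
    split_ifs with h <;> simp [h]
  rw [this]
  split_ifs <;> simp

open Classical in
theorem sum_qsFinset_nil_left {M : Type*} [AddCommMonoid M] {R : WithTop ℕ → WithTop ℕ → Prop}
    (hR : OrdInv R) {a : DecWord} (ha : IsPacked a) (ha0 : a ≠ []) (F : DecWord → M) :
    ∑ u ∈ qsFinset R [] a, F u = if R ⊤ 0 then F a else 0 := by
  obtain ⟨x, -, hx, -⟩ := exists_minLetter ha0
  have hcmp : R ⊤ (minLetter a) ↔ R ⊤ 0 := hR _ _ _ _ (by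
    rw [hx, (cmp_eq_gt_iff ⊤ (x : WithTop ℕ)).2 (WithTop.coe_lt_top x),
      (cmp_eq_gt_iff ⊤ (0 : WithTop ℕ)).2 (WithTop.coe_lt_top 0)])
  have : qsFinset R [] a = if R ⊤ 0 then {a} else ∅ := by
    ext u
    rw [mem_qsFinset, qsWords_nil_left ha, Set.mem_ofPred_eq, hcmp]
    split_ifs with h <;> simp [h]
  rw [this]
  split_ifs <;> simp

open Classical in
/-- The compatibility between a product attached to a relation and a weighted coproduct. -/
theorem weightedCoprd_relProd (χ : Prop → k) {R : WithTop ℕ → WithTop ℕ → Prop}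
    (hR : OrdInv R) (x y : QShd k) :
    weightedCoprd χ (relProd k R x y) =
      TensorProduct.map₂ (relProd k R) (relProd k fun _ _ => True) (weightedCoprd χ x)
        (weightedCoprd (fun _ => 1) y)
      + ((relProd k R).flip y).rTensor _ (weightedCoprd χ x)
      + (if R 0 ⊤ then (1 : k) else 0) •
        ((relProd k fun _ _ => True).flip y).lTensor _ (weightedCoprd χ x)
      + χ True • (relProd k R x).rTensor _ (weightedCoprd (fun _ => 1) y)
      + (χ True * if R 0 ⊤ then (1 : k) else 0) • x ⊗ₜ[k] y
      + (χ False * if R ⊤ 0 then (1 : k) else 0) •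
        ((relProd k fun _ _ => True) x).lTensor _ (weightedCoprd (fun _ => 1) y)
      + (χ False * if R ⊤ 0 then (1 : k) else 0) • y ⊗ₜ[k] x := by
  induction x using ofWord_induction with
  | add x₁ x₂ h1 h2 =>
    simp only [map_add, LinearMap.add_apply, h1, h2, smul_add, TensorProduct.add_tmul,
      TensorProduct.tmul_add, LinearMap.lTensor_add, LinearMap.rTensor_add]
    abel
  | smul c x h1 =>
    simp only [map_smul, LinearMap.smul_apply, h1, smul_add, TensorProduct.tmul_smul,
      ← TensorProduct.smul_tmul', LinearMap.lTensor_smul, LinearMap.rTensor_smul, smul_comm c]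
  | basis a ha0 ha =>
  induction y using ofWord_induction with
  | add x₁ x₂ h1 h2 =>
    simp only [map_add, LinearMap.add_apply, h1, h2, smul_add, TensorProduct.add_tmul,
      TensorProduct.tmul_add, LinearMap.lTensor_add, LinearMap.rTensor_add]
    abel
  | smul c x h1 =>
    simp only [map_smul, LinearMap.smul_apply, h1, smul_add, TensorProduct.tmul_smul,
      ← TensorProduct.smul_tmul', LinearMap.lTensor_smul, LinearMap.rTensor_smul, smul_comm c]
  | basis b hb0 hb =>
  have hm := ha.maxLetter_pos ha0
  have hn := hb.maxLetter_pos hb0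
  rw [relProd_ofWord R ha0 ha hb0 hb, map_sum]
  have e1 : ∀ u ∈ qsFinset R a b, weightedCoprd χ (ofWord k u) =
      ∑ i ∈ Finset.Ico 1 (maxLetter u),
        χ (HeadLe i u) • (ofWord k (lo i u) ⊗ₜ[k] ofWord k (hi i u)) := fun u hu => by
    rw [mem_qsFinset] at hu
    exact weightedCoprd_ofWord χ hu.1 (ne_nil_of_mem_qsWords hu (.inl ha0))
  rw [Finset.sum_congr rfl e1,
    sum_cuts hR ha ha0 hb (fun c v w => χ c • (ofWord k v ⊗ₜ[k] ofWord k w))]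
  -- Each of the two ranges splits into its bottom, interior and top. Of the nine blocks so obtained
  -- two are excluded, and the other seven are the seven terms on the right.
  simp only [sum_range_succ_eq_ends _ hm, sum_range_succ_eq_ends _ hn]
  have hsum : ∀ (χ₀ : k) (S T : Finset DecWord), ∑ v ∈ S, ∑ w ∈ T,
      χ₀ • (ofWord k v ⊗ₜ[k] ofWord k w) =
        χ₀ • ((∑ v ∈ S, ofWord k v) ⊗ₜ[k] (∑ w ∈ T, ofWord k w)) := by
    intro χ₀ S T
    rw [TensorProduct.sum_tmul, Finset.smul_sum]
    refine Finset.sum_congr rfl fun v _ => ?_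
    rw [TensorProduct.tmul_sum, Finset.smul_sum]
  simp only [hsum]
  have hT0 : (HeadLe (maxLetter a) a) = True := eq_true ha.headLe_maxLetter
  have hF0 : (HeadLe 0 a) = False := eq_false (ha.not_headLe_zero ha0)
  have hIa : ∀ j ∈ Finset.Ico 1 (maxLetter a), ¬ j = 0 ∧ ¬ j = maxLetter a ∧
      lo j a ≠ [] ∧ hi j a ≠ [] := fun j hj => by
    rw [Finset.mem_Ico] at hj
    exact ⟨by omega, by omega, ha.lo_ne_nil ha0 hj.1, ha.hi_ne_nil hj.2⟩
  have hIb : ∀ j ∈ Finset.Ico 1 (maxLetter b), ¬ j = 0 ∧ ¬ j = maxLetter b ∧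
      lo j b ≠ [] ∧ hi j b ≠ [] := fun j hj => by
    rw [Finset.mem_Ico] at hj
    exact ⟨by omega, by omega, hb.lo_ne_nil hb0 hj.1, hb.hi_ne_nil hj.2⟩
  simp only [hT0, hF0, hm.ne, hm.ne', hn.ne, hn.ne', and_self, and_true, true_and, and_false,
    false_and, or_self, or_true, or_false, false_or, if_true, if_false, zero_add, add_zero,
    ha.lo_zero, hb.lo_zero, ha.hi_zero, hb.hi_zero, ha.lo_eq_self le_rfl, hb.lo_eq_self le_rfl,
    ha.hi_eq_nil le_rfl, hb.hi_eq_nil le_rfl]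
  have s1 : ∑ l ∈ Finset.Ico 1 (maxLetter b), (if l = 0 then 0 else
      χ False • ((∑ v ∈ qsFinset R [] (lo l b), ofWord k v) ⊗ₜ[k]
        ∑ w ∈ qsFinset (fun _ _ => True) a (hi l b), ofWord k w)) =
      (χ False * if R ⊤ 0 then (1 : k) else 0) •
        ((relProd k fun _ _ => True) (ofWord k a)).lTensor _
          (weightedCoprd (fun _ => 1) (ofWord k b)) := by
    rw [weightedCoprd_ofWord _ hb hb0, map_sum, Finset.smul_sum]
    refine Finset.sum_congr rfl fun l hl => ?_
    obtain ⟨h1, h2, h3, h4⟩ := hIb l hl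
    rw [if_neg h1, sum_qsFinset_nil_left hR (hb.lo l) h3, one_smul, LinearMap.lTensor_tmul,
      relProd_ofWord _ ha0 ha h4 (hb.hi l), mul_smul]
    split_ifs <;> simp
  have s2 : χ False • ((∑ v ∈ qsFinset R [] b, ofWord k v) ⊗ₜ[k]
        ∑ w ∈ qsFinset (fun _ _ => True) a [], ofWord k w) =
      (χ False * if R ⊤ 0 then (1 : k) else 0) • ofWord k b ⊗ₜ[k] ofWord k a := by
    rw [sum_qsFinset_nil_left hR hb hb0, sum_qsFinset_nil_right ordInv_true ha ha0, mul_smul]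
    split_ifs <;> simp
  have s3 : χ True • ((∑ v ∈ qsFinset R a [], ofWord k v) ⊗ₜ[k]
        ∑ w ∈ qsFinset (fun _ _ => True) [] b, ofWord k w) =
      (χ True * if R 0 ⊤ then (1 : k) else 0) • ofWord k a ⊗ₜ[k] ofWord k b := by
    rw [sum_qsFinset_nil_left ordInv_true hb hb0, sum_qsFinset_nil_right hR ha ha0, mul_smul]
    split_ifs <;> simp
  have s4 : ∑ l ∈ Finset.Ico 1 (maxLetter b), (if l = maxLetter b then 0 else
      χ True • ((∑ v ∈ qsFinset R a (lo l b), ofWord k v) ⊗ₜ[k]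
        ∑ w ∈ qsFinset (fun _ _ => True) [] (hi l b), ofWord k w)) =
      χ True • (relProd k R (ofWord k a)).rTensor _
          (weightedCoprd (fun _ => 1) (ofWord k b)) := by
    rw [weightedCoprd_ofWord _ hb hb0, map_sum, Finset.smul_sum]
    refine Finset.sum_congr rfl fun l hl => ?_
    obtain ⟨h1, h2, h3, h4⟩ := hIb l hl
    rw [if_neg h2, sum_qsFinset_nil_left ordInv_true (hb.hi l) h4, one_smul, LinearMap.rTensor_tmul,
      relProd_ofWord _ ha0 ha h3 (hb.lo l), if_pos trivial]
  have s5 : ∑ j ∈ Finset.Ico 1 (maxLetter a), (if j = 0 then 0 else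
      χ (HeadLe j a) • ((∑ v ∈ qsFinset R (lo j a) [], ofWord k v) ⊗ₜ[k]
        ∑ w ∈ qsFinset (fun _ _ => True) (hi j a) b, ofWord k w)) =
      (if R 0 ⊤ then (1 : k) else 0) •
        ((relProd k fun _ _ => True).flip (ofWord k b)).lTensor _ (weightedCoprd χ (ofWord k a)) := by
    rw [weightedCoprd_ofWord _ ha ha0, map_sum, Finset.smul_sum]
    refine Finset.sum_congr rfl fun j hj => ?_
    obtain ⟨h1, h2, h3, h4⟩ := hIa j hj
    rw [if_neg h1, sum_qsFinset_nil_right hR (ha.lo j) h3, map_smul, LinearMap.lTensor_tmul,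
      LinearMap.flip_apply, relProd_ofWord _ h4 (ha.hi j) hb0 hb]
    split_ifs <;> simp
  have s6 : ∑ j ∈ Finset.Ico 1 (maxLetter a), (if j = maxLetter a then 0 else
      χ (HeadLe j a) • ((∑ v ∈ qsFinset R (lo j a) b, ofWord k v) ⊗ₜ[k]
        ∑ w ∈ qsFinset (fun _ _ => True) (hi j a) [], ofWord k w)) =
        ((relProd k R).flip (ofWord k b)).rTensor _ (weightedCoprd χ (ofWord k a)) := by
    rw [weightedCoprd_ofWord _ ha ha0, map_sum]
    refine Finset.sum_congr rfl fun j hj => ?_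
    obtain ⟨h1, h2, h3, h4⟩ := hIa j hj
    rw [if_neg h2, sum_qsFinset_nil_right ordInv_true (ha.hi j) h4, map_smul, LinearMap.rTensor_tmul,
      LinearMap.flip_apply, relProd_ofWord _ h3 (ha.lo j) hb0 hb, if_pos trivial]
  have s7 : ∑ j ∈ Finset.Ico 1 (maxLetter a), ∑ l ∈ Finset.Ico 1 (maxLetter b),
      (if j = 0 ∧ l = 0 ∨ j = maxLetter a ∧ l = maxLetter b then 0 else
      χ (HeadLe j a) • ((∑ v ∈ qsFinset R (lo j a) (lo l b), ofWord k v) ⊗ₜ[k]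
        ∑ w ∈ qsFinset (fun _ _ => True) (hi j a) (hi l b), ofWord k w)) =
      TensorProduct.map₂ (relProd k R) (relProd k fun _ _ => True) (weightedCoprd χ (ofWord k a))
        (weightedCoprd (fun _ => 1) (ofWord k b)) := by
    rw [weightedCoprd_ofWord _ ha ha0, map_sum, LinearMap.sum_apply]
    refine Finset.sum_congr rfl fun j hj => ?_
    rw [weightedCoprd_ofWord _ hb hb0, map_sum]
    refine Finset.sum_congr rfl fun l hl => ?_
    obtain ⟨h1, h2, h3, h4⟩ := hIa j hj
    obtain ⟨h1', h2', h3', h4'⟩ := hIb l hl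
    rw [if_neg (by tauto), one_smul, map_smul, LinearMap.smul_apply, TensorProduct.map₂_apply_tmul, TensorProduct.map_tmul,
      relProd_ofWord _ h3 (ha.lo j) h3' (hb.lo l), relProd_ofWord _ h4 (ha.hi j) h4' (hb.hi l)]
  simp only [Finset.sum_add_distrib, s1, s2, s3, s4, s5, s6, s7]
  abel

end

section

variable {k : Type*} [Field k]

/-! ### Coassociativity -/

theorem headLe_lo {i j : ℕ} {a : DecWord} (h : HeadLe i a) : HeadLe j (lo i a) ↔ HeadLe j a := by
  cases a with
  | nil => rfl
  | cons p a =>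
    have hp : p.1 ≤ i := h p rfl
    have : lo i (p :: a) = p :: lo i a := by simp [lo, hp]
    rw [this]
    rfl

theorem headLe_hi {i j : ℕ} {a : DecWord} (h : ¬ HeadLe i a) :
    HeadLe j (hi i a) ↔ HeadLe (j + i) a := by
  cases a with
  | nil => exact absurd (by simp [HeadLe]) h
  | cons p a =>
    have hp : i < p.1 := by simpa [HeadLe] using h
    have : hi i (p :: a) = (p.1 - i, p.2) :: hi i a := by simp [hi, hp, relabel, Prod.map]
    rw [this]
    simp [HeadLe]

theorem HeadLe.mono {i j : ℕ} {a : DecWord} (h : HeadLe i a) (hij : i ≤ j) : HeadLe j a :=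
  fun p hp => (h p hp).trans hij

theorem sum_Ico_Ico_eq {M : Type*} [AddCommMonoid M] (f : ℕ → ℕ → M) (m : ℕ) :
    ∑ i ∈ Finset.Ico 1 m, ∑ j ∈ Finset.Ico 1 i, f i j =
      ∑ j ∈ Finset.Ico 1 m, ∑ l ∈ Finset.Ico 1 (m - j), f (l + j) j := by
  rw [Finset.sum_comm' (t' := Finset.Ico 1 m) (s' := fun j => Finset.Ico (j + 1) m)]
  · refine Finset.sum_congr rfl fun j hj => ?_
    rw [Finset.mem_Ico] at hj
    rw [Finset.sum_Ico_add' (fun i => f i j) 1 (m - j) j, Nat.sub_add_cancel hj.2.le, add_comm 1 j]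
  · intro i j
    simp only [Finset.mem_Ico]
    omega

/-- Both sides cut the word into three blocks, at `j` and then at `i`, and give the same tensors;
only the weights remain to be compared, which is the hypothesis. -/
theorem weightedCoprd_coassoc {χ ψ χ' ψ' : Prop → k}
    (h : ∀ (a : DecWord) (i j : ℕ), j ≤ i →
      ψ (HeadLe i a) * χ (HeadLe j (lo i a)) = ψ' (HeadLe j a) * χ' (HeadLe (i - j) (hi j a)))
    (x : QShd k) :
    TensorProduct.assoc k _ _ _ ((weightedCoprd χ).rTensor _ (weightedCoprd ψ x)) =
      (weightedCoprd χ').lTensor _ (weightedCoprd ψ' x) := by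
  induction x using ofWord_induction with
  | add x₁ x₂ h1 h2 => simp only [map_add, h1, h2]
  | smul c x h1 => simp only [map_smul, h1]
  | basis a ha0 ha =>
    rw [weightedCoprd_ofWord _ ha ha0, weightedCoprd_ofWord _ ha ha0]
    simp only [map_sum, map_smul, LinearMap.rTensor_tmul, LinearMap.lTensor_tmul]
    have e1 : ∀ i ∈ Finset.Ico 1 (maxLetter a), ψ (HeadLe i a) •
        TensorProduct.assoc k _ _ _ (weightedCoprd χ (ofWord k (lo i a)) ⊗ₜ[k] ofWord k (hi i a)) =
        ∑ j ∈ Finset.Ico 1 i, (ψ (HeadLe i a) * χ (HeadLe j (lo i a))) •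
          (ofWord k (lo j a) ⊗ₜ[k] (ofWord k (lo (i - j) (hi j a)) ⊗ₜ[k] ofWord k (hi i a))) := by
      intro i hi
      rw [Finset.mem_Ico] at hi
      rw [weightedCoprd_ofWord _ (ha.lo i) (ha.lo_ne_nil ha0 hi.1), ha.maxLetter_lo,
        min_eq_left hi.2.le, TensorProduct.sum_tmul, map_sum, Finset.smul_sum]
      refine Finset.sum_congr rfl fun j hj => ?_
      rw [Finset.mem_Ico] at hj
      rw [← TensorProduct.smul_tmul', map_smul, TensorProduct.assoc_tmul, mul_smul, lo_lo,
        min_eq_left hj.2.le, lo_hi, Nat.sub_add_cancel hj.2.le]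
    have e2 : ∀ j ∈ Finset.Ico 1 (maxLetter a), ψ' (HeadLe j a) •
        (ofWord k (lo j a) ⊗ₜ[k] weightedCoprd χ' (ofWord k (hi j a))) =
        ∑ l ∈ Finset.Ico 1 (maxLetter a - j), (ψ' (HeadLe j a) * χ' (HeadLe l (hi j a))) •
          (ofWord k (lo j a) ⊗ₜ[k] (ofWord k (lo l (hi j a)) ⊗ₜ[k] ofWord k (hi (l + j) a))) := by
      intro j hj
      rw [Finset.mem_Ico] at hj
      rw [weightedCoprd_ofWord _ (ha.hi j) (ha.hi_ne_nil hj.2), ha.maxLetter_hi,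
        TensorProduct.tmul_sum, Finset.smul_sum]
      refine Finset.sum_congr rfl fun l hl => ?_
      rw [TensorProduct.tmul_smul, mul_smul, hi_hi]
    rw [Finset.sum_congr rfl e1, Finset.sum_congr rfl e2, sum_Ico_Ico_eq (fun i j =>
      (ψ (HeadLe i a) * χ (HeadLe j (lo i a))) •
          (ofWord k (lo j a) ⊗ₜ[k] (ofWord k (lo (i - j) (hi j a)) ⊗ₜ[k] ofWord k (hi i a))))]
    refine Finset.sum_congr rfl fun j _ => Finset.sum_congr rfl fun l _ => ?_
    rw [h a _ _ (Nat.le_add_left j l), Nat.add_sub_cancel]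

/-- The three axioms correspond to the block that contains the first letter: both sides keep the
double cuts where it lies in the lowest, the middle and the highest block respectively. -/
theorem isNShCoalg_delta : IsNShCoalg (deltaPrec k) (deltaSucc k) := by
  classical
  constructor <;> intro x <;>
    (try simp only [deltaPrec_add_deltaSucc]) <;> simp only [deltaPrec_eq, deltaSucc_eq] <;>
    refine weightedCoprd_coassoc (fun a i j hij => ?_) x
  · by_cases h : HeadLe i a
    · simp [h, headLe_lo h]
    · have h' : ¬ HeadLe j a := fun h' => h (h'.mono hij)
      simp [h, h']
  · by_cases h : HeadLe i a
    · by_cases h' : HeadLe j a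
      · simp [h, headLe_lo h, h']
      · simp [h, headLe_lo h, h', headLe_hi h', Nat.sub_add_cancel hij]
    · have h' : ¬ HeadLe j a := fun h' => h (h'.mono hij)
      simp [h, h', headLe_hi h', Nat.sub_add_cancel hij]
  · by_cases h' : HeadLe j a
    · simp [h', h'.mono hij]
    · simp [h', headLe_hi h', Nat.sub_add_cancel hij]

/-! ### Opposite algebras and coalgebras -/

section op

variable {A : Type*} [AddCommGroup A] [Module k A]

/-- The reversal of the three factors of a triple tensor product. -/
noncomputable def tensorReverse : A ⊗[k] (A ⊗[k] A) →ₗ[k] A ⊗[k] (A ⊗[k] A) :=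
  (TensorProduct.assoc k A A A).toLinearMap ∘ₗ (TensorProduct.comm k A (A ⊗[k] A)).toLinearMap ∘ₗ
    (TensorProduct.comm k A A).toLinearMap.lTensor A

theorem assoc_rTensor_opCoprd (d : Coprd k A) (t : A ⊗[k] A) :
    TensorProduct.assoc k A A A ((opCoprd d).rTensor A (TensorProduct.comm k A A t)) =
      tensorReverse (d.lTensor A t) := by
  induction t using TensorProduct.induction_on with
  | zero => simp
  | add x y hx hy => simp only [map_add, hx, hy]
  | tmul x y =>
    simp only [TensorProduct.comm_tmul, LinearMap.rTensor_tmul, LinearMap.lTensor_tmul, opCoprd,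
      LinearMap.comp_apply, LinearEquiv.coe_coe, tensorReverse]

theorem lTensor_opCoprd (d : Coprd k A) (t : A ⊗[k] A) :
    (opCoprd d).lTensor A (TensorProduct.comm k A A t) =
      tensorReverse (TensorProduct.assoc k A A A (d.rTensor A t)) := by
  induction t using TensorProduct.induction_on with
  | zero => simp
  | add x y hx hy => simp only [map_add, hx, hy]
  | tmul x y =>
    simp only [TensorProduct.comm_tmul, LinearMap.rTensor_tmul, LinearMap.lTensor_tmul, opCoprd,
      LinearMap.comp_apply, LinearEquiv.coe_coe, tensorReverse]
    induction d x using TensorProduct.induction_on with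
    | zero => simp
    | add x y hx hy => simp only [map_add, TensorProduct.tmul_add, TensorProduct.add_tmul, hx, hy]
    | tmul x y => simp

theorem opCoprd_add (d d' : Coprd k A) : opCoprd d + opCoprd d' = opCoprd (d' + d) := by
  rw [opCoprd, opCoprd, opCoprd, LinearMap.comp_add, add_comm]

/-- Reversing the three tensor factors exchanges the two outer axioms and preserves the middle one.
-/
theorem IsNShCoalg.op {dp ds : Coprd k A} (h : IsNShCoalg dp ds) :
    IsNShCoalg (opCoprd ds) (opCoprd dp) := by
  have e : ∀ (d : Coprd k A) (a : A), opCoprd d a = TensorProduct.comm k A A (d a) :=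
    fun _ _ => rfl
  constructor <;> intro a <;> (try rw [opCoprd_add]) <;>
    simp only [e, assoc_rTensor_opCoprd, lTensor_opCoprd]
  · rw [h.succ_succ]
  · rw [h.succ_prec]
  · rw [h.prec_prec]

theorem opProd_add (p s : Prd k A) : opProd p + opProd s = opProd (s + p) := by
  ext x y
  simp [opProd, add_comm]

theorem IsNSh.op {p s : Prd k A} (h : IsNSh p s) : IsNSh (opProd s) (opProd p) := by
  constructor <;> intro x y z <;> simp only [opProd, LinearMap.flip_apply]
  · rw [add_comm, h.succ_succ]
  · rw [h.succ_prec]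
  · rw [add_comm, h.prec_prec]

theorem map₂_opProd_comm (p q : Prd k A) (s t : A ⊗[k] A) :
    TensorProduct.map₂ (opProd p) (opProd q) (TensorProduct.comm k A A s)
      (TensorProduct.comm k A A t) =
      TensorProduct.comm k A A (TensorProduct.map₂ q p t s) := by
  induction s using TensorProduct.induction_on with
  | zero => simp
  | add x y hx hy => simp only [map_add, LinearMap.add_apply, hx, hy]
  | tmul x y =>
    induction t using TensorProduct.induction_on with
    | zero => simp
    | add x y hx hy => simp only [map_add, LinearMap.add_apply, hx, hy]
    | tmul x' y' =>
      simp only [TensorProduct.comm_tmul, TensorProduct.map₂_apply_tmul, TensorProduct.map_tmul, opProd,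
        LinearMap.flip_apply]

theorem rTensor_comm (f : A →ₗ[k] A) (t : A ⊗[k] A) :
    f.rTensor A (TensorProduct.comm k A A t) = TensorProduct.comm k A A (f.lTensor A t) := by
  induction t using TensorProduct.induction_on with
  | zero => simp
  | add x y hx hy => simp only [map_add, hx, hy]
  | tmul x y => simp

theorem lTensor_comm (f : A →ₗ[k] A) (t : A ⊗[k] A) :
    f.lTensor A (TensorProduct.comm k A A t) = TensorProduct.comm k A A (f.rTensor A t) := by
  induction t using TensorProduct.induction_on with
  | zero => simp
  | add x y hx hy => simp only [map_add, hx, hy]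
  | tmul x y => simp

end op

/-! ### The compatibilities between products and coproducts -/

/-- Each identity is `weightedCoprd_relProd` for one relation and one weight. The values of `χ
True`, `χ False`, `R 0 ⊤` and `R ⊤ 0`, all 0 or 1, select the surviving terms; for equality the last
two vanish, hence the short formula for `•`. -/
theorem coproductIdentities :
    CoproductIdentities (prec k) (succ k) (bullet k) (deltaPrec k) (deltaSucc k) := by
  classical
  have hpm : prec k + bullet k = relProd k (· ≤ ·) := preceq_eq
  have hsm : succ k + bullet k = relProd k (· ≥ ·) := succeq_eq
  constructor
  · intro a b
    rw [deltaPrec_add_deltaSucc, star_eq, hpm, deltaPrec_eq, weightedCoprd_relProd _ ordInv_le]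
    simp
  · intro a b
    rw [deltaPrec_add_deltaSucc, star_eq, hsm, deltaPrec_eq, weightedCoprd_relProd _ ordInv_ge]
    simp; abel
  · intro a b
    rw [deltaPrec_add_deltaSucc, star_eq, hpm, deltaSucc_eq, weightedCoprd_relProd _ ordInv_le]
    simp
  · intro a b
    rw [deltaPrec_add_deltaSucc, star_eq, hsm, deltaSucc_eq, weightedCoprd_relProd _ ordInv_ge]
    simp
  · rintro o (rfl | rfl) a b <;> rw [deltaPrec_add_deltaSucc, star_eq]
    · rw [prec, weightedCoprd_relProd _ ordInv_lt]
      simp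
    · rw [hpm, weightedCoprd_relProd _ ordInv_le]
      simp
  · rintro o (rfl | rfl) a b <;> rw [deltaPrec_add_deltaSucc, star_eq]
    · rw [succ, weightedCoprd_relProd _ ordInv_gt]
      simp
    · rw [hsm, weightedCoprd_relProd _ ordInv_ge]
      simp
  · intro a b
    rw [deltaPrec_add_deltaSucc, star_eq, bullet, weightedCoprd_relProd _ ordInv_eq]
    simp

/-- The products attached to two complementary relations form a bidendriform bialgebra. -/
theorem isBidendriform_of_relProd {R R' : WithTop ℕ → WithTop ℕ → Prop} (hR : OrdInv R)
    (hR' : OrdInv R') (h0 : R 0 ⊤) (h0' : ¬ R ⊤ 0) (h1 : ¬ R' 0 ⊤) (h1' : R' ⊤ 0)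
    (halg : IsNSh (relProd k R) (relProd k R'))
    (hstar : relProd k R + relProd k R' = relProd k fun _ _ => True) :
    IsBidendriform (opProd (relProd k R')) (opProd (relProd k R)) (opCoprd (deltaSucc k))
      (opCoprd (deltaPrec k)) := by
  classical
  have e : ∀ (d : Coprd k (QShd k)) a, opCoprd d a = TensorProduct.comm k _ _ (d a) :=
    fun _ _ => rfl
  have ef : ∀ (p : Prd k (QShd k)), (opProd p).flip = p := fun _ => rfl
  have ef' : ∀ (p : Prd k (QShd k)) x, opProd p x = p.flip x := fun _ _ => rfl
  have hc : ∀ a b : QShd k, a ⊗ₜ[k] b = TensorProduct.comm k _ _ (b ⊗ₜ[k] a) := fun _ _ => rfl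
  refine ⟨halg.op, isNShCoalg_delta.op, ?_, ?_, ?_, ?_⟩ <;> intro a b <;>
    rw [opProd_add, opCoprd_add, hstar, deltaPrec_add_deltaSucc]
  · simp only [e, map₂_opProd_comm, rTensor_comm, lTensor_comm, hc a b, ← map_add, ef]
    rw [ef', LinearMap.flip_apply]
    -- Both sides are images under the exchange of the tensor factors, so the comparison reduces to
    -- the non-opposite coproduct of the product in the reverse order.
    congr 1
    simp only [deltaPrec_eq, weightedCoprd_relProd _ hR, ef']
    simp [h0]
    abel
  · simp only [e, map₂_opProd_comm, lTensor_comm, ← map_add, ef]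
    rw [ef', LinearMap.flip_apply]
    congr 1
    simp only [deltaPrec_eq, weightedCoprd_relProd _ hR']
    simp [h1]
    abel
  · simp only [e, map₂_opProd_comm, rTensor_comm, lTensor_comm, ← map_add]
    rw [ef', LinearMap.flip_apply]
    congr 1
    simp only [deltaSucc_eq, weightedCoprd_relProd _ hR, ef']
    simp [h0, h0']
    abel
  · simp only [e, map₂_opProd_comm, rTensor_comm, lTensor_comm, hc b a, ← map_add, ef]
    rw [ef', LinearMap.flip_apply]
    congr 1
    simp only [deltaSucc_eq, weightedCoprd_relProd _ hR']
    simp [h1, h1']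
    abel

end

/-! ### A criterion of freeness -/

section

variable {k : Type*} [Field k]

/-- `(b ≻ x) ≺ a`, the factors `b` and `a` being optional. -/
def grafting {B : Type*} [AddCommGroup B] [Module k B] (p s : Prd k B) (b : Option B) (x : B)
    (a : Option B) : B :=
  a.elim (b.elim x fun y => s y x) fun z => p (b.elim x fun y => s y x) z

/-- The span of the words of length `n`. -/
def lengthSubmodule (k : Type*) [Field k] (n : ℕ) : Submodule k (QShd k) :=
  Finsupp.supported k k {u : DPW | u.word.length = n}

/-- The total length of a triple of words, the outer ones being optional. -/
def tripleLength {X : Set DPW} (t : Option DPW × X × Option DPW) : ℕ :=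
  t.1.elim 0 (fun u => u.word.length) + t.2.1.1.word.length +
    t.2.2.elim 0 (fun u => u.word.length)

/-- The grafting of a triple of words. -/
noncomputable def wordGrafting (p s : Prd k (QShd k)) {X : Set DPW}
    (t : Option DPW × X × Option DPW) : QShd k :=
  grafting p s (t.1.map fun u => Finsupp.single u 1) (Finsupp.single t.2.1.1 1)
    (t.2.2.map fun u => Finsupp.single u 1)

theorem single_induction {P : QShd k → Prop} (x : QShd k) (add : ∀ x y, P x → P y → P (x + y))
    (smul : ∀ (c : k) x, P x → P (c • x)) (single : ∀ a : DPW, P (Finsupp.single a 1)) : P x :=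
  ofWord_induction x add smul fun a h h' => by
    have := single ⟨a, h, h'⟩
    rwa [← ofWord_word] at this

theorem lengthSubmodule_induction {n : ℕ} {P : QShd k → Prop} {x : QShd k}
    (hx : x ∈ lengthSubmodule k n) (zero : P 0) (add : ∀ x y, P x → P y → P (x + y))
    (smul : ∀ (c : k) x, P x → P (c • x))
    (single : ∀ a : DPW, a.word.length = n → P (Finsupp.single a 1)) : P x := by
  rw [lengthSubmodule, Finsupp.supported_eq_span_single] at hx
  induction hx using Submodule.span_induction with
  | mem x hx =>
    obtain ⟨u, hu, rfl⟩ := hx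
    exact single u hu
  | zero => exact zero
  | add x y _ _ hx hy => exact add _ _ hx hy
  | smul c x _ hx => exact smul _ _ hx

theorem single_mem_lengthSubmodule (u : DPW) :
    (Finsupp.single u 1 : QShd k) ∈ lengthSubmodule k u.word.length :=
  Finsupp.single_mem_supported k 1 rfl

theorem DPW.length_pos (u : DPW) : 0 < u.word.length := List.length_pos_iff.2 u.ne_nil

theorem map_mem_lengthSubmodule {p : Prd k (QShd k)}
    (hp : ∀ u v : DPW, p (Finsupp.single u 1) (Finsupp.single v 1) ∈
      lengthSubmodule k (u.word.length + v.word.length)) {m n : ℕ} {x y : QShd k}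
    (hx : x ∈ lengthSubmodule k m) (hy : y ∈ lengthSubmodule k n) :
    p x y ∈ lengthSubmodule k (m + n) := by
  refine lengthSubmodule_induction (P := fun x => p x y ∈ lengthSubmodule k (m + n)) hx ?_ ?_ ?_ ?_
  · simp
  · intro x y hx hy; rw [map_add, LinearMap.add_apply]; exact add_mem hx hy
  · intro c x hx; rw [map_smul, LinearMap.smul_apply]; exact Submodule.smul_mem _ _ hx
  · rintro u rfl
    refine lengthSubmodule_induction (P := fun y => p (Finsupp.single u 1) y ∈
      lengthSubmodule k (u.word.length + n)) hy ?_ ?_ ?_ ?_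
    · simp
    · intro x y hx hy; rw [map_add]; exact add_mem hx hy
    · intro c x hx; rw [map_smul]; exact Submodule.smul_mem _ _ hx
    · rintro v rfl
      exact hp u v

theorem wordGrafting_mem {p s : Prd k (QShd k)}
    (hp : ∀ u v : DPW, p (Finsupp.single u 1) (Finsupp.single v 1) ∈
      lengthSubmodule k (u.word.length + v.word.length))
    (hs : ∀ u v : DPW, s (Finsupp.single u 1) (Finsupp.single v 1) ∈
      lengthSubmodule k (u.word.length + v.word.length)) {X : Set DPW}
    (t : Option DPW × X × Option DPW) : wordGrafting p s t ∈ lengthSubmodule k (tripleLength t) := by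
  have hm := single_mem_lengthSubmodule (k := k)
  obtain ⟨_ | b, x, _ | a⟩ := t <;>
    simp only [wordGrafting, grafting, tripleLength, Option.map_none, Option.map_some,
      Option.elim_none, Option.elim_some, zero_add, add_zero]
  · exact hm x
  · exact hp x a
  · exact hs b x
  · exact map_mem_lengthSubmodule hp (hs b x) (hm a)

/-! ### The morphism extending a map on generators -/

section recursion

variable {X : Set DPW} {B : Type*} [AddCommGroup B] [Module k B]

/-- Successive approximations of the morphism extending `g`. -/
noncomputable def extendStep (β : Module.Basis (Option DPW × X × Option DPW) k (QShd k))
    (p' s' : Prd k B) (g : X → B) : ℕ → QShd k →ₗ[k] B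
  | 0 => 0
  | n + 1 => β.constr k fun t =>
      grafting p' s' (t.1.map fun u => extendStep β p' s' g n (Finsupp.single u 1)) (g t.2.1)
        (t.2.2.map fun u => extendStep β p' s' g n (Finsupp.single u 1))

/-- The linear map extending `g`. -/
noncomputable def extend (β : Module.Basis (Option DPW × X × Option DPW) k (QShd k))
    (p' s' : Prd k B) (g : X → B) : QShd k →ₗ[k] B :=
  Finsupp.linearCombination k fun u : DPW =>
    extendStep β p' s' g u.word.length (Finsupp.single u 1)

variable {β : Module.Basis (Option DPW × X × Option DPW) k (QShd k)} {p' s' : Prd k B} {g : X → B}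

/-- The middle word is nonempty, so the outer words are strictly shorter than the triple; this is
what makes the recursion on length work. -/
theorem grafting_map_congr {f f' : DPW → B} {n : ℕ} {t : Option DPW × X × Option DPW}
    (h : ∀ u : DPW, u.word.length ≤ n → f u = f' u) (ht : tripleLength t ≤ n + 1) (x : B) :
    grafting p' s' (t.1.map f) x (t.2.2.map f) = grafting p' s' (t.1.map f') x (t.2.2.map f') := by
  have hx := t.2.1.1.length_pos
  obtain ⟨b, x, a⟩ := t
  have h1 : b.map f = b.map f' := by
    cases b with
    | none => rfl
    | some b =>
      simp only [tripleLength, Option.elim_some] at ht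
      rw [Option.map_some, Option.map_some, h b (by simp only at hx; omega)]
  have h2 : a.map f = a.map f' := by
    cases a with
    | none => rfl
    | some a =>
      simp only [tripleLength, Option.elim_some] at ht
      rw [Option.map_some, Option.map_some, h a (by simp only at hx; omega)]
  simp only [h1, h2]

/-- The approximations stabilise: a word of length at most `n + 1` is a combination of graftings of
the same total length, whose outer words have length at most `n`. -/
theorem extendStep_succ
    (hspan : ∀ u : DPW, (Finsupp.single u 1 : QShd k) ∈
      Submodule.span k (β '' {t | tripleLength t = u.word.length})) (n : ℕ) :
    ∀ u : DPW, u.word.length ≤ n →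
      extendStep β p' s' g (n + 1) (Finsupp.single u 1) =
        extendStep β p' s' g n (Finsupp.single u 1) := by
  induction n with
  | zero =>
    intro u hu
    have := u.length_pos
    omega
  | succ n ih =>
    intro u hu
    refine LinearMap.eqOn_span (s := β '' {t | tripleLength t = u.word.length}) ?_ (hspan u)
    rintro _ ⟨t, ht, rfl⟩
    rw [extendStep, Module.Basis.constr_basis, extendStep, Module.Basis.constr_basis]
    exact grafting_map_congr ih (ht.le.trans hu) _

theorem extend_eq
    (hspan : ∀ u : DPW, (Finsupp.single u 1 : QShd k) ∈
      Submodule.span k (β '' {t | tripleLength t = u.word.length})) {n : ℕ} {u : DPW}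
    (hu : u.word.length ≤ n) :
    extend β p' s' g (Finsupp.single u 1) = extendStep β p' s' g n (Finsupp.single u 1) := by
  rw [extend, Finsupp.linearCombination_single, one_smul]
  induction n, hu using Nat.le_induction with
  | base => rfl
  | succ n hn ih => rw [ih, extendStep_succ hspan n u hn]

theorem extend_wordGrafting {p s : Prd k (QShd k)} (hβ : ∀ t, β t = wordGrafting p s t)
    (hp : ∀ u v : DPW, p (Finsupp.single u 1) (Finsupp.single v 1) ∈
      lengthSubmodule k (u.word.length + v.word.length))
    (hs : ∀ u v : DPW, s (Finsupp.single u 1) (Finsupp.single v 1) ∈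
      lengthSubmodule k (u.word.length + v.word.length))
    (hspan : ∀ u : DPW, (Finsupp.single u 1 : QShd k) ∈
      Submodule.span k (β '' {t | tripleLength t = u.word.length}))
    (t : Option DPW × X × Option DPW) :
    extend β p' s' g (wordGrafting p s t) =
      grafting p' s' (t.1.map fun u => extend β p' s' g (Finsupp.single u 1)) (g t.2.1)
        (t.2.2.map fun u => extend β p' s' g (Finsupp.single u 1)) := by
  have h1 : extend β p' s' g (wordGrafting p s t) =
      extendStep β p' s' g (tripleLength t + 1) (wordGrafting p s t) := by
    refine lengthSubmodule_induction
      (P := fun y => extend β p' s' g y = extendStep β p' s' g (tripleLength t + 1) y)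
      (wordGrafting_mem hp hs t) ?_ ?_ ?_ ?_
    · simp
    · intro x y hx hy; rw [map_add, map_add, hx, hy]
    · intro c x hx; rw [map_smul, map_smul, hx]
    · intro u hu
      exact extend_eq hspan (by omega)
  rw [h1, ← hβ, extendStep, Module.Basis.constr_basis]
  refine (grafting_map_congr (fun u hu => ?_) (Nat.le_succ _) _).symm
  exact extend_eq hspan hu

/-- Linearity frees the outer factors from being single words. This generality is needed because the
dendriform axioms create outer factors that are products. -/
theorem extend_grafting {p s : Prd k (QShd k)} (hβ : ∀ t, β t = wordGrafting p s t)
    (hp : ∀ u v : DPW, p (Finsupp.single u 1) (Finsupp.single v 1) ∈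
      lengthSubmodule k (u.word.length + v.word.length))
    (hs : ∀ u v : DPW, s (Finsupp.single u 1) (Finsupp.single v 1) ∈
      lengthSubmodule k (u.word.length + v.word.length))
    (hspan : ∀ u : DPW, (Finsupp.single u 1 : QShd k) ∈
      Submodule.span k (β '' {t | tripleLength t = u.word.length}))
    (b : Option (QShd k)) (x : X) (a : Option (QShd k)) :
    extend β p' s' g (grafting p s b (Finsupp.single x.1 1) a) =
      grafting p' s' (b.map (extend β p' s' g)) (g x) (a.map (extend β p' s' g)) := by
  have h := extend_wordGrafting (p' := p') (s' := s') (g := g) hβ hp hs hspan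
  cases b with
  | none =>
    cases a with
    | none => exact h (none, x, none)
    | some a =>
      simp only [grafting, Option.map_none, Option.map_some, Option.elim_none, Option.elim_some]
      induction a using single_induction with
      | add x y hx hy => simp only [map_add, hx, hy]
      | smul c x hx => simp only [map_smul, hx]
      | single a => exact h (none, x, some a)
  | some b =>
    cases a with
    | none =>
      simp only [grafting, Option.map_none, Option.map_some, Option.elim_none, Option.elim_some]
      induction b using single_induction with
      | add x y hx hy => simp only [map_add, LinearMap.add_apply, hx, hy]
      | smul c x hx => simp only [map_smul, LinearMap.smul_apply, hx]
      | single b => exact h (some b, x, none)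
    | some a =>
      simp only [grafting, Option.map_some, Option.elim_some]
      induction b using single_induction with
      | add x y hx hy => simp only [map_add, LinearMap.add_apply, hx, hy]
      | smul c x hx => simp only [map_smul, LinearMap.smul_apply, hx]
      | single b =>
        induction a using single_induction with
        | add x y hx hy => simp only [map_add, hx, hy]
        | smul c x hx => simp only [map_smul, hx]
        | single a => exact h (some b, x, some a)

/-- Induction on the total length. The rules `(w ≺ a) ≺ v = w ≺ (a v)` and `u ≻ ((b ≻ x) ≺ a) = ((u
b) ≻ x) ≺ a` turn a product with a basis element into a grafting, on which the map is known. The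
products `a v` and `u b` are shorter because `x` has been removed, and the induction applies to
them. -/
theorem extend_isNShHom {p s : Prd k (QShd k)} (h : IsNSh p s) (h' : IsNSh p' s')
    (hβ : ∀ t, β t = wordGrafting p s t)
    (hp : ∀ u v : DPW, p (Finsupp.single u 1) (Finsupp.single v 1) ∈
      lengthSubmodule k (u.word.length + v.word.length))
    (hs : ∀ u v : DPW, s (Finsupp.single u 1) (Finsupp.single v 1) ∈
      lengthSubmodule k (u.word.length + v.word.length))
    (hspan : ∀ u : DPW, (Finsupp.single u 1 : QShd k) ∈
      Submodule.span k (β '' {t | tripleLength t = u.word.length})) :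
    IsNShHom p s p' s' (extend β p' s' g) := by
  set F := extend β p' s' g with hF
  have hG : ∀ b x a, F (grafting p s b (Finsupp.single x.1 1) a) =
      grafting p' s' (b.map F) (g x) (a.map F) :=
    extend_grafting hβ hp hs hspan
  have key : ∀ n, ∀ u v : DPW, u.word.length + v.word.length ≤ n →
      F (p (Finsupp.single u 1) (Finsupp.single v 1)) =
        p' (F (Finsupp.single u 1)) (F (Finsupp.single v 1)) ∧
      F (s (Finsupp.single u 1) (Finsupp.single v 1)) =
        s' (F (Finsupp.single u 1)) (F (Finsupp.single v 1)) := by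
    intro n
    induction n with
    | zero =>
      intro u v huv
      have := u.length_pos
      omega
    | succ n ih =>
      intro u v huv
      have ih' : ∀ u v : DPW, u.word.length + v.word.length ≤ n →
          F (p (Finsupp.single u 1) (Finsupp.single v 1) +
            s (Finsupp.single u 1) (Finsupp.single v 1)) =
          p' (F (Finsupp.single u 1)) (F (Finsupp.single v 1)) +
            s' (F (Finsupp.single u 1)) (F (Finsupp.single v 1)) := fun u v huv => by
        rw [map_add, (ih u v huv).1, (ih u v huv).2]
      constructor
      · have hlin : Set.EqOn (F ∘ₗ p.flip (Finsupp.single v 1)) (p'.flip (F (Finsupp.single v 1)) ∘ₗ F)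
            (Submodule.span k (β '' {t | tripleLength t = u.word.length})) := by
          refine LinearMap.eqOn_span ?_
          rintro _ ⟨⟨b, x, a⟩, ht, rfl⟩
          rw [Set.mem_ofPred_eq, tripleLength] at ht
          rw [hβ, LinearMap.comp_apply, LinearMap.comp_apply, LinearMap.flip_apply,
            LinearMap.flip_apply, wordGrafting, hG]
          cases a with
          | none => exact hG _ _ (some (Finsupp.single v 1))
          | some a =>
            have hx := x.1.length_pos
            simp only [Option.elim_some] at ht
            have e := hG (b.map fun u => Finsupp.single u 1) x (some
              (p (Finsupp.single a 1) (Finsupp.single v 1) +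
                s (Finsupp.single a 1) (Finsupp.single v 1)))
            simp only [grafting, Option.map_some, Option.elim_some] at e ⊢
            rw [h.prec_prec, e, h'.prec_prec, ih' a v (by omega)]
        exact hlin (hspan u)
      · have hlin : Set.EqOn (F ∘ₗ s (Finsupp.single u 1)) (s' (F (Finsupp.single u 1)) ∘ₗ F)
            (Submodule.span k (β '' {t | tripleLength t = v.word.length})) := by
          refine LinearMap.eqOn_span ?_
          rintro _ ⟨⟨b, x, a⟩, ht, rfl⟩
          rw [Set.mem_ofPred_eq, tripleLength] at ht
          rw [hβ, LinearMap.comp_apply, LinearMap.comp_apply, wordGrafting, hG]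
          have hx := x.1.length_pos
          cases b with
          | none =>
            have e := hG (some (Finsupp.single u 1)) x (a.map fun u => Finsupp.single u 1)
            cases a with
            | none => exact e
            | some a =>
              simp only [grafting, Option.map_some, Option.map_none, Option.elim_some,
                Option.elim_none] at e ⊢
              rw [← h.succ_prec, e, h'.succ_prec]
          | some b =>
            simp only [Option.elim_some] at ht
            have e := hG (some (p (Finsupp.single u 1) (Finsupp.single b 1) +
                s (Finsupp.single u 1) (Finsupp.single b 1))) x
                (a.map fun u => Finsupp.single u 1)
            cases a with
            | none =>
              simp only [grafting, Option.map_some, Option.map_none, Option.elim_some,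
                Option.elim_none] at e ⊢
              rw [← h.succ_succ, e, ih' u b (by omega), h'.succ_succ]
            | some a =>
              simp only [grafting, Option.map_some, Option.elim_some] at e ⊢
              rw [← h.succ_prec, ← h.succ_succ, e, ih' u b (by omega), h'.succ_succ, h'.succ_prec]
        exact hlin (hspan v)
  constructor <;> intro x y <;>
    induction x using single_induction with
    | add x y hx hy => simp only [map_add, LinearMap.add_apply, hx, hy]
    | smul c x hx => simp only [map_smul, LinearMap.smul_apply, hx]
    | single u =>
      induction y using single_induction with
      | add x y hx hy => simp only [map_add, hx, hy]
      | smul c x hx => simp only [map_smul, hx]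
      | single v =>
        first
        | exact (key _ u v le_rfl).1
        | exact (key _ u v le_rfl).2

theorem IsNShHom.map_grafting {p s : Prd k (QShd k)} {f : QShd k →ₗ[k] B}
    (hf : IsNShHom p s p' s' f) (b : Option (QShd k)) (x : QShd k) (a : Option (QShd k)) :
    f (grafting p s b x a) = grafting p' s' (b.map f) (f x) (a.map f) := by
  cases b <;> cases a <;> simp [grafting, hf.map_prec, hf.map_succ]

end recursion

/-- If the graftings of triples of words with middle word in `X` form a basis, homogeneous with
respect to length, then `X` freely generates. -/
theorem isFreeNSh_of_basis {p s : Prd k (QShd k)} (h : IsNSh p s) {X : Set DPW}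
    (β : Module.Basis (Option DPW × X × Option DPW) k (QShd k))
    (hβ : ∀ t, β t = wordGrafting p s t)
    (hp : ∀ u v : DPW, p (Finsupp.single u 1) (Finsupp.single v 1) ∈
      lengthSubmodule k (u.word.length + v.word.length))
    (hs : ∀ u v : DPW, s (Finsupp.single u 1) (Finsupp.single v 1) ∈
      lengthSubmodule k (u.word.length + v.word.length))
    (hspan : ∀ u : DPW, (Finsupp.single u 1 : QShd k) ∈
      Submodule.span k (β '' {t | tripleLength t = u.word.length})) :
    IsFreeNSh.{w} p s := by
  refine ⟨h, (fun u : DPW => (Finsupp.single u 1 : QShd k)) '' X, ?_⟩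
  intro B _ _ p' s' h' g
  set g' : X → B := fun x => g ⟨_, x.1, x.2, rfl⟩ with hg'
  have hx : ∀ x : X, extend β p' s' g' (Finsupp.single x.1 1) = g' x := fun x =>
    extend_grafting hβ hp hs hspan none x none
  refine ⟨extend β p' s' g', ⟨extend_isNShHom h h' hβ hp hs hspan, ?_⟩, ?_⟩
  · rintro ⟨_, x, hxX, rfl⟩
    exact hx ⟨x, hxX⟩
  · rintro f ⟨hf, hfx⟩
    have hom := extend_isNShHom (g := g') h h' hβ hp hs hspan
    -- Uniqueness: two morphisms that agree on the generators and on shorter words agree on every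
    -- grafting.
    have key : ∀ n, ∀ u : DPW, u.word.length ≤ n →
        f (Finsupp.single u 1) = extend β p' s' g' (Finsupp.single u 1) := by
      intro n
      induction n with
      | zero =>
        intro u hu
        have := u.length_pos
        omega
      | succ n ih =>
        intro u hu
        refine LinearMap.eqOn_span (s := β '' {t | tripleLength t = u.word.length}) ?_ (hspan u)
        rintro _ ⟨t, ht, rfl⟩
        rw [hβ, wordGrafting, hf.map_grafting, hom.map_grafting, hx, hfx ⟨_, t.2.1.1, t.2.1.2, rfl⟩,
          Option.map_map, Option.map_map, Option.map_map, Option.map_map]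
        exact grafting_map_congr ih (ht.le.trans hu) _
    refine LinearMap.ext fun y => ?_
    induction y using single_induction with
    | add x y hx hy => simp only [map_add, hx, hy]
    | smul c x hx => simp only [map_smul, hx]
    | single u => exact key _ u le_rfl

end

/-! ### Indecomposable words and leading terms -/

/-- All the letters of `v` are larger than the letters of `w`. -/
def Dominates (v w : DecWord) : Prop := ∀ x ∈ letterSet v, ∀ y ∈ letterSet w, y < x

/-- No proper prefix dominates the corresponding suffix. -/
def LeftIndec (w : DecWord) : Prop :=
  ∀ v₁ v₂, w = v₁ ++ v₂ → v₁ ≠ [] → v₂ ≠ [] → ¬ Dominates v₁ v₂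

/-- The letters of `v` are `2, …, q + 1` and are not letters of `w`. -/
def IsTail (q : ℕ) (w v : DecWord) : Prop :=
  letterSet v = Finset.Icc 2 (q + 1) ∧ Disjoint (letterSet w) (Finset.Icc 2 (q + 1))

/-- No nonempty suffix is a tail. -/
def RightIndec (w : DecWord) : Prop :=
  ∀ v₁ v₂ q, w = v₁ ++ v₂ → v₂ ≠ [] → ¬ IsTail q v₁ v₂

/-- The words that are indecomposable on both sides. -/
def indecomposables : Set DPW := {u | LeftIndec u.word ∧ RightIndec u.word}

/-- The increasing map that fixes `1` and shifts the larger letters by `q`. -/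
def spread (q t : ℕ) : ℕ := if t ≤ 1 then t else t + q

theorem spread_strictMono (q : ℕ) : StrictMono (spread q) := by
  intro s t h
  unfold spread
  split_ifs <;> omega

/-- The leading term of the grafting of three words. -/
def lead (b x a : DecWord) : DecWord :=
  relabel (· + (maxLetter x + maxLetter a)) b ++
    (relabel (spread (maxLetter a)) x ++ relabel (· + 1) a)

theorem add_strictMono (c : ℕ) : StrictMono (· + c) := fun _ _ h => Nat.add_lt_add_right h c

theorem IsPacked.mem {a : DecWord} (h : IsPacked a) {x : ℕ} :
    x ∈ letterSet a ↔ 1 ≤ x ∧ x ≤ maxLetter a := by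
  rw [h.letterSet_eq, Finset.mem_Icc]

theorem IsPacked.mem_add {a : DecWord} (h : IsPacked a) {c x : ℕ} :
    x ∈ letterSet (relabel (· + c) a) ↔ c + 1 ≤ x ∧ x ≤ c + maxLetter a := by
  simp only [letterSet_relabel, Finset.mem_image, h.mem]
  constructor
  · rintro ⟨y, hy, rfl⟩; omega
  · intro hx; exact ⟨x - c, by omega, by omega⟩

theorem IsPacked.mem_spread {a : DecWord} (h : IsPacked a) (ha : a ≠ []) {q x : ℕ} :
    x ∈ letterSet (relabel (spread q) a) ↔ x = 1 ∨ (q + 2 ≤ x ∧ x ≤ q + maxLetter a) := by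
  have := h.maxLetter_pos ha
  simp only [letterSet_relabel, Finset.mem_image, h.mem, spread]
  constructor
  · rintro ⟨y, hy, rfl⟩; split_ifs <;> omega
  · rintro (rfl | hx)
    · exact ⟨1, by omega, by simp⟩
    · exact ⟨x - q, by omega, by split_ifs <;> omega⟩

theorem letterSet_lead {b x a : DecWord} (hb : IsPacked b) (hx : IsPacked x) (hx0 : x ≠ [])
    (ha : IsPacked a) :
    letterSet (lead b x a) = Finset.Icc 1 (maxLetter b + maxLetter x + maxLetter a) := by
  have := hx.maxLetter_pos hx0
  ext y
  rw [lead, letterSet_append, letterSet_append, Finset.mem_union, Finset.mem_union, hb.mem_add,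
    hx.mem_spread hx0, ha.mem_add, Finset.mem_Icc]
  omega

theorem relabel_eq_append {φ : ℕ → ℕ} {l u v : DecWord} (h : relabel φ l = u ++ v) :
    ∃ l₁ l₂, l = l₁ ++ l₂ ∧ relabel φ l₁ = u ∧ relabel φ l₂ = v := by
  obtain ⟨l₁, l₂, h1, h2, h3⟩ := List.map_eq_append_iff.1 h
  exact ⟨l₁, l₂, h1, h2, h3⟩

/-- A dominating proper prefix cannot contain the smallest letter 1. As 1 is a letter of the spread
`x`, such a prefix ends strictly inside that block and gives a dominating prefix of `x`. -/
theorem leftIndec_spread_append {x a : DecWord} (hx : IsPacked x) (hx0 : x ≠ [])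
    (hi : LeftIndec x) (ha : IsPacked a) (q : ℕ) :
    LeftIndec (relabel (spread q) x ++ relabel (· + 1) a) := by
  intro c d h hc hd hcd
  have hpos : ∀ y ∈ letterSet (c ++ d), 1 ≤ y := by
    intro y hy
    rw [← h, letterSet_append, Finset.mem_union, hx.mem_spread hx0, ha.mem_add] at hy
    omega
  have hone : 1 ∉ letterSet c := by
    intro h1
    obtain ⟨y, hy, -, -⟩ := exists_minLetter hd
    have h2 := hcd 1 h1 y hy
    have h3 := hpos y (by simp [hy])
    omega
  rw [List.append_eq_append_iff] at h
  rcases h with ⟨c', rfl, -⟩ | ⟨c', h, rfl⟩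
  · refine hone ?_
    rw [letterSet_append, Finset.mem_union, hx.mem_spread hx0]
    exact .inl (.inl rfl)
  · obtain ⟨x₁, x₂, rfl, rfl, rfl⟩ := relabel_eq_append h
    by_cases h2 : x₂ = []
    · subst h2
      refine hone ?_
      rw [List.append_nil] at hx hx0
      rw [hx.mem_spread hx0]
      exact .inl rfl
    · refine hi x₁ x₂ rfl (by simpa using hc) h2 fun s hs t ht => ?_
      refine (spread_strictMono q).lt_iff_lt.1 (hcd _ ?_ _ ?_)
      · rw [letterSet_relabel]; exact Finset.mem_image_of_mem _ hs
      · rw [letterSet_append, letterSet_relabel, Finset.mem_union]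
        exact .inl (Finset.mem_image_of_mem _ ht)

/-- If the cuts differ, the piece between them is a prefix of the longer suffix that dominates the
shorter one, against indecomposability. -/
theorem append_dominates_unique {v w v' w' : DecWord} (h : v ++ w = v' ++ w') (hw0 : w ≠ [])
    (hw0' : w' ≠ []) (hd : Dominates v w) (hd' : Dominates v' w') (hw : LeftIndec w)
    (hw' : LeftIndec w') : v = v' ∧ w = w' := by
  rw [List.append_eq_append_iff] at h
  rcases h with ⟨c, rfl, rfl⟩ | ⟨c, rfl, rfl⟩
  · by_cases hc : c = []
    · subst hc; simp
    · exact absurd (fun s hs t ht => hd' s (by simp [hs]) t ht) (hw c w' rfl hc hw0')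
  · by_cases hc : c = []
    · subst hc; simp
    · exact absurd (fun s hs t ht => hd s (by simp [hs]) t ht) (hw' c w rfl hc hw0)

/-- The letters of the piece `c` between two distinct tails are exactly `q + 2, …, q' + 1`. Undoing
the spread, they become `2, …, q' - q + 1`, so the corresponding suffix of `x` is a nonempty tail.
-/
theorem not_rightIndec_of_tails {x v : DecWord} {c z : DecWord} {q q' : ℕ}
    (h : relabel (spread q) x = v ++ c) (hc : c ≠ []) (hz : IsTail q (v ++ c) z)
    (hz' : IsTail q' v (c ++ z)) : ¬ RightIndec x := by
  intro hx
  obtain ⟨x₁, x₂, rfl, rfl, rfl⟩ := relabel_eq_append h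
  obtain ⟨hz1, hz2⟩ := hz
  obtain ⟨hz1', hz2'⟩ := hz'
  rw [letterSet_append, hz1] at hz1'
  rw [letterSet_append, Finset.disjoint_union_left] at hz2
  have hm : ∀ y, y ∈ letterSet (relabel (spread q) x₂) ↔ q + 2 ≤ y ∧ y ≤ q' + 1 := by
    intro y
    have e1 := congrArg (fun s => y ∈ s) hz1'
    have e2 := fun hy => Finset.disjoint_left.1 hz2.2 (show y ∈ _ from hy)
    simp only [Finset.mem_union, Finset.mem_Icc, eq_iff_iff] at e1 e2
    constructor
    · intro hy
      have := e2 hy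
      have := e1.1 (.inl hy)
      omega
    · intro hy
      rcases e1.2 (by omega) with h | h
      · exact h
      · omega
  refine hx x₁ x₂ (q' - q) rfl (by simpa using hc) ⟨?_, ?_⟩
  · ext t
    rw [Finset.mem_Icc]
    constructor
    · intro ht
      have := (hm (spread q t)).1 (by rw [letterSet_relabel]; exact Finset.mem_image_of_mem _ ht)
      unfold spread at this
      split_ifs at this <;> omega
    · intro ht
      have := (hm (t + q)).2 (by omega)
      rw [letterSet_relabel, Finset.mem_image] at this
      obtain ⟨t', ht', e⟩ := this
      have : t' = t := by
        unfold spread at e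
        split_ifs at e <;> omega
      rwa [← this]
  · rw [Finset.disjoint_left]
    intro t ht ht'
    rw [Finset.mem_Icc] at ht'
    refine Finset.disjoint_left.1 hz2' (show t + q ∈ _ from ?_) (by rw [Finset.mem_Icc]; omega)
    rw [letterSet_relabel, Finset.mem_image]
    exact ⟨t, ht, if_neg (by omega)⟩

theorem isTail_spread {x a : DecWord} (hx : IsPacked x) (hx0 : x ≠ []) (ha : IsPacked a) :
    IsTail (maxLetter a) (relabel (spread (maxLetter a)) x) (relabel (· + 1) a) := by
  constructor
  · ext y
    rw [ha.mem_add, Finset.mem_Icc]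
    omega
  · rw [Finset.disjoint_left]
    intro y hy
    rw [hx.mem_spread hx0] at hy
    rw [Finset.mem_Icc]
    omega

/-- Domination locates the end of the first block and tails locate the start of the last one.
Equality of the last blocks gives `a = a'`, so both middle blocks are spread by the same amount and
the relabellings can be undone. -/
theorem lead_injective {b x a b' x' a' : DecWord} (hb : IsPacked b) (hx : IsPacked x)
    (hx0 : x ≠ []) (ha : IsPacked a) (hi : LeftIndec x) (hi' : RightIndec x) (hb' : IsPacked b')
    (hx' : IsPacked x') (hx0' : x' ≠ []) (ha' : IsPacked a') (hj : LeftIndec x')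
    (hj' : RightIndec x') (h : lead b x a = lead b' x' a') : b = b' ∧ x = x' ∧ a = a' := by
  have hdom : ∀ {b x a : DecWord}, IsPacked b → IsPacked x → x ≠ [] → IsPacked a →
      Dominates (relabel (· + (maxLetter x + maxLetter a)) b)
        (relabel (spread (maxLetter a)) x ++ relabel (· + 1) a) := by
    intro b x a hb hx hx0 ha y hy z hz
    have := hx.maxLetter_pos hx0
    rw [hb.mem_add] at hy
    rw [letterSet_append, Finset.mem_union, hx.mem_spread hx0, ha.mem_add] at hz
    omega
  obtain ⟨h1, h2⟩ := append_dominates_unique h (by simp [hx0]) (by simp [hx0'])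
    (hdom hb hx hx0 ha) (hdom hb' hx' hx0' ha') (leftIndec_spread_append hx hx0 hi ha _)
    (leftIndec_spread_append hx' hx0' hj ha' _)
  have ht := isTail_spread hx hx0 ha
  have ht' := isTail_spread hx' hx0' ha'
  have h3 : relabel (spread (maxLetter a)) x = relabel (spread (maxLetter a')) x' ∧
      relabel (· + 1) a = relabel (· + 1) a' := by
    have h2' := h2
    rw [List.append_eq_append_iff] at h2'
    rcases h2' with ⟨c, e1, e2⟩ | ⟨c, e1, e2⟩
    · by_cases hc : c = []
      · subst hc; simp only [List.append_nil, List.nil_append] at e1 e2; exact ⟨e1.symm, e2⟩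
      · rw [e1] at ht'
        rw [e2] at ht
        exact absurd hj' (not_rightIndec_of_tails e1 hc ht' ht)
    · by_cases hc : c = []
      · subst hc; simp only [List.append_nil, List.nil_append] at e1 e2; exact ⟨e1, e2.symm⟩
      · rw [e1] at ht
        rw [e2] at ht'
        exact absurd hi' (not_rightIndec_of_tails e1 hc ht ht')
  have haa := eq_of_relabel_eq (add_strictMono 1).injective h3.2
  subst haa
  have hxx := eq_of_relabel_eq (spread_strictMono _).injective h3.1
  subst hxx
  exact ⟨eq_of_relabel_eq (add_strictMono _).injective h1, rfl, rfl⟩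

/-- Dominating prefixes are removed until none is left; together they still dominate the remaining
suffix. -/
theorem exists_leftIndec_suffix (n : ℕ) : ∀ w : DecWord, w.length ≤ n → w ≠ [] →
    ∃ v w', w = v ++ w' ∧ w' ≠ [] ∧ Dominates v w' ∧ LeftIndec w' := by
  induction n with
  | zero => intro w h h0; exact absurd (List.length_eq_zero_iff.1 (Nat.le_zero.1 h)) h0
  | succ n ih =>
    intro w hw hw0
    by_cases h : LeftIndec w
    · exact ⟨[], w, rfl, hw0, by simp [Dominates], h⟩
    · simp only [LeftIndec, not_forall, not_not] at h
      obtain ⟨c, d, rfl, hc, hd, hcd⟩ := h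
      have := List.length_pos_iff.2 hc
      obtain ⟨v, w', rfl, h1, h2, h3⟩ := ih d (by rw [List.length_append] at hw; omega) hd
      refine ⟨c ++ v, w', by simp, h1, ?_, h3⟩
      intro s hs t ht
      rw [letterSet_append, Finset.mem_union] at hs
      rcases hs with hs | hs
      · exact hcd s hs t (by simp [ht])
      · exact h2 s hs t ht

theorem exists_minimal_tail (w : DecWord) : ∃ y z q, w = y ++ z ∧ IsTail q y z ∧
    ∀ y' z' q', w = y' ++ z' → IsTail q' y' z' → y.length ≤ y'.length := by
  classical
  have hex : ∃ n, ∃ y z q, w = y ++ z ∧ IsTail q y z ∧ y.length = n :=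
    -- The empty suffix is a tail with `q = 0`, the interval from 2 to 1 being empty.
    ⟨w.length, w, [], 0, by simp, by simp [IsTail], rfl⟩
  obtain ⟨y, z, q, h1, h2, h3⟩ := Nat.find_spec hex
  exact ⟨y, z, q, h1, h2, fun y' z' q' h h' => h3 ▸ Nat.find_min' hex ⟨y', z', q', h, h', rfl⟩⟩

/-- The block `b` comes from a dominating prefix `B` with left-indecomposable complement `W`, the
block `a` from the longest tail `Z` of `W`, and `x` from what lies between. As `B` dominates `W`,
the letters of `W` are `1, …, n` and those of `B` are the larger ones. -/
theorem exists_eq_lead {u : DecWord} (hu : IsPacked u) (hu0 : u ≠ []) :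
    ∃ b x a, IsPacked b ∧ IsPacked x ∧ x ≠ [] ∧ LeftIndec x ∧ RightIndec x ∧ IsPacked a ∧
      u = lead b x a := by
  obtain ⟨B, W, rfl, hW0, hBW, hW⟩ := exists_leftIndec_suffix u.length u le_rfl hu0
  obtain ⟨y₀, hy₀, -, hy₀'⟩ := exists_minLetter hW0
  have hmem : ∀ y, (y ∈ letterSet B ∨ y ∈ letterSet W) ↔ 1 ≤ y ∧ y ≤ maxLetter (B ++ W) := by
    intro y; rw [← hu.mem, letterSet_append, Finset.mem_union]
  set N := maxLetter (B ++ W)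
  set n := maxLetter W
  have hnW : n ∈ letterSet W ∧ ∀ y ∈ letterSet W, y ≤ n := by
    have hne : (letterSet W).Nonempty := ⟨y₀, hy₀⟩
    obtain ⟨m, hm, hm'⟩ := Finset.exists_max_image (letterSet W) id hne
    have : n = m := le_antisymm (Finset.sup_le hm') (Finset.le_sup (f := id) hm)
    rw [this]
    exact ⟨hm, hm'⟩
  have hWmem : ∀ y, y ∈ letterSet W ↔ 1 ≤ y ∧ y ≤ n := by
    intro y
    constructor
    · intro hy
      exact ⟨((hmem y).1 (.inr hy)).1, hnW.2 y hy⟩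
    · intro hy
      have := (hmem n).1 (.inr hnW.1)
      rcases (hmem y).2 (by omega) with h | h
      · have := hBW y h n hnW.1
        omega
      · exact h
  have hBmem : ∀ y, y ∈ letterSet B ↔ n + 1 ≤ y ∧ y ≤ N := by
    intro y
    constructor
    · intro hy
      exact ⟨hBW y hy n hnW.1, ((hmem y).1 (.inl hy)).2⟩
    · intro hy
      rcases (hmem y).2 (by omega) with h | h
      · exact h
      · have := hnW.2 y h
        omega
  have hn1 : 1 ≤ n := ((hmem n).1 (.inr hnW.1)).1
  have hnN : n ≤ N := ((hmem n).1 (.inr hnW.1)).2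
  obtain ⟨Y, Z, q, hYZ, ⟨hZ, hYd⟩, hmin⟩ := exists_minimal_tail W
  have hq : q + 1 ≤ n := by
    by_cases hq : q = 0
    · omega
    · have : q + 1 ∈ letterSet W := by
        rw [hYZ, letterSet_append, hZ, Finset.mem_union, Finset.mem_Icc]; omega
      exact hnW.2 _ this
  have hYmem : ∀ y, y ∈ letterSet Y ↔ y = 1 ∨ (q + 2 ≤ y ∧ y ≤ n) := by
    intro y
    have h1 := hWmem y
    have h2 := fun hy => Finset.disjoint_left.1 hYd (show y ∈ _ from hy)
    rw [hYZ, letterSet_append, hZ, Finset.mem_union] at h1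
    rw [Finset.mem_Icc] at h1 h2
    constructor
    · intro hy
      have := h2 hy
      have := h1.1 (.inl hy)
      omega
    · intro hy
      rcases h1.2 (by omega) with h | h
      · exact h
      · omega
  -- This contraction inverts `spread q` on the letters of `Y`, which are 1 and those from `q + 2`
  -- to `n`.
  set x := relabel (fun t => if t ≤ 1 then t else t - q) Y with hxdef
  have hspread : relabel (spread q) x = Y := by
    rw [hxdef, relabel_relabel]
    refine relabel_eq_self fun t ht => ?_
    rw [hYmem] at ht
    simp only [Function.comp, spread]
    split_ifs <;> omega
  have hxset : letterSet x = Finset.Icc 1 (n - q) := by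
    ext t
    simp only [hxdef, letterSet_relabel, Finset.mem_image, Finset.mem_Icc, hYmem]
    constructor
    · rintro ⟨s, hs, rfl⟩; split_ifs <;> omega
    · intro ht
      by_cases h1 : t = 1
      · exact ⟨1, .inl rfl, by simp [h1]⟩
      · exact ⟨t + q, .inr (by omega), by split_ifs <;> omega⟩
  have hx : IsPacked x := ⟨_, hxset⟩
  have hxmax : maxLetter x = n - q := maxLetter_eq_of_letterSet hxset
  have hx0 : x ≠ [] := by
    rw [Ne, ← hx.maxLetter_eq_zero, hxmax]; omega
  set a := relabel (fun t => t - 1) Z with hadef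
  have haZ : relabel (· + 1) a = Z := by
    rw [hadef, relabel_relabel]
    refine relabel_eq_self fun t ht => ?_
    rw [hZ, Finset.mem_Icc] at ht
    simp only [Function.comp]
    omega
  have haset : letterSet a = Finset.Icc 1 q := by
    ext t
    simp only [hadef, letterSet_relabel, Finset.mem_image, Finset.mem_Icc, hZ]
    constructor
    · rintro ⟨s, hs, rfl⟩; omega
    · intro ht; exact ⟨t + 1, by omega, by omega⟩
  have hamax : maxLetter a = q := maxLetter_eq_of_letterSet haset
  set b := relabel (fun t => t - n) B with hbdef
  have hbB : relabel (· + n) b = B := by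
    rw [hbdef, relabel_relabel]
    refine relabel_eq_self fun t ht => ?_
    rw [hBmem] at ht
    simp only [Function.comp]
    omega
  have hbset : letterSet b = Finset.Icc 1 (N - n) := by
    ext t
    simp only [hbdef, letterSet_relabel, Finset.mem_image, Finset.mem_Icc, hBmem]
    constructor
    · rintro ⟨s, hs, rfl⟩; omega
    · intro ht; exact ⟨t + n, by omega, by omega⟩
  refine ⟨b, x, a, ⟨_, hbset⟩, hx, hx0, ?_, ?_, ⟨_, haset⟩, ?_⟩
  -- A dominating prefix of `x` would give one of `W`: its letters are at least 2, hence at least `q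
  -- + 2` after spreading, above all the letters of `Z`.
  · intro x₁ x₂ h12 h1 h2 hd
    rw [h12, relabel_append] at hspread
    refine hW (relabel (spread q) x₁) (relabel (spread q) x₂ ++ Z)
      (by rw [hYZ, ← hspread, List.append_assoc]) (by simpa using h1) (by simp [h2]) ?_
    intro s hs t ht
    rw [letterSet_relabel, Finset.mem_image] at hs
    obtain ⟨s, hs, rfl⟩ := hs
    rw [letterSet_append, letterSet_relabel, Finset.mem_union, hZ, Finset.mem_image] at ht
    rcases ht with ⟨t, ht, rfl⟩ | ht
    · exact spread_strictMono q (hd s hs t ht)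
    · obtain ⟨r, hr, -, -⟩ := exists_minLetter h2
      have e1 := hd s hs r hr
      have e2 : r ∈ letterSet x := by rw [h12]; simp [hr]
      rw [hxset, Finset.mem_Icc] at e2
      rw [Finset.mem_Icc] at ht
      unfold spread
      split_ifs <;> omega
  -- A nonempty tail of `x` with parameter `r` would merge with `Z` into a longer tail of `W`, with
  -- parameter `q + r`.
  · intro x₁ x₂ r h12 h2 ⟨ht, ht'⟩
    rw [h12, relabel_append] at hspread
    have := hmin (relabel (spread q) x₁) (relabel (spread q) x₂ ++ Z) (q + r)
      (by rw [hYZ, ← hspread, List.append_assoc]) ⟨?_, ?_⟩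
    · have h3 := List.length_pos_iff.2 h2
      rw [← hspread, List.length_append, length_relabel, length_relabel] at this
      omega
    · ext t
      rw [letterSet_append, letterSet_relabel, Finset.mem_union, hZ, Finset.mem_image, ht]
      simp only [Finset.mem_Icc]
      constructor
      · rintro (⟨s, hs, rfl⟩ | h)
        · unfold spread; split_ifs <;> omega
        · omega
      · intro h
        by_cases h' : t ≤ q + 1
        · right; omega
        · left; exact ⟨t - q, by omega, by unfold spread; split_ifs <;> omega⟩
    · rw [Finset.disjoint_left]
      intro t h1 h3
      rw [letterSet_relabel, Finset.mem_image] at h1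
      obtain ⟨s, hs, rfl⟩ := h1
      have h4 := Finset.disjoint_left.1 ht' hs
      have h5 : s ∈ letterSet x := by rw [h12]; simp [hs]
      rw [hxset, Finset.mem_Icc] at h5
      rw [Finset.mem_Icc] at h3 h4
      unfold spread at h3
      split_ifs at h3 <;> omega
  · rw [lead, hxmax, hamax, haZ, hspread, Nat.sub_add_cancel (by omega), hbB, hYZ]

/-! ### Leading terms of graftings -/

/-- The row of letters of a decorated word. -/
def letters (l : DecWord) : List ℕ := l.map Prod.fst

@[simp] theorem letters_append (l l' : DecWord) : letters (l ++ l') = letters l ++ letters l' := by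
  simp [letters]

theorem append_lt_append_left (l : List ℕ) {m m' : List ℕ} (h : m < m') : l ++ m < l ++ m' := by
  induction l with
  | nil => exact h
  | cons x l ih => exact List.cons_lt_cons_iff.2 (.inr ⟨rfl, ih⟩)

/-- The first position where the two relabellings differ decides the lexicographic order, whatever
words follow. -/
theorem relabel_eq_or_lt {φ ψ : ℕ → ℕ} {l : DecWord} (h : ∀ x ∈ letterSet l, φ x ≤ ψ x) :
    relabel φ l = relabel ψ l ∨
      ∀ m m', letters (relabel φ l) ++ m < letters (relabel ψ l) ++ m' := by
  induction l with
  | nil => exact .inl rfl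
  | cons p l ih =>
    have hp := h p.1 (fst_mem_letterSet (by simp))
    have hl := ih fun x hx => h x (by
      obtain ⟨d, hd⟩ := mem_letterSet.1 hx
      exact mem_letterSet.2 ⟨d, by simp [hd]⟩)
    rcases hp.lt_or_eq with hlt | heq
    · right
      intro m m'
      exact List.cons_lt_cons_iff.2 (.inl hlt)
    · rcases hl with hl | hl
      · left
        change Prod.map φ id p :: relabel φ l = Prod.map ψ id p :: relabel ψ l
        rw [hl]
        simp [Prod.map, heq]
      · right
        intro m m'
        exact List.cons_lt_cons_iff.2 (.inr ⟨heq, hl m m'⟩)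

/-- Above `φ t` there must be room for the `m - t` later values, all at most `V`. -/
theorem strictMonoOn_add_le {φ : ℕ → ℕ} {m V : ℕ} (hφ : StrictMonoOn φ (Finset.Icc 1 m : Finset ℕ))
    (hV : ∀ t, 1 ≤ t → t ≤ m → φ t ≤ V) {t : ℕ} (h1 : 1 ≤ t) (h2 : t ≤ m) : φ t + m ≤ V + t := by
  have key : ∀ d, t + d ≤ m → φ t + d ≤ φ (t + d) := by
    intro d
    induction d with
    | zero => simp
    | succ d ih =>
      intro hd
      have e1 := ih (by omega)
      have e2 := hφ (a := t + d) (b := t + (d + 1)) (by simp; omega) (by simp; omega) (by omega)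
      omega
  have e1 := key (m - t) (by omega)
  have e2 := hV (t + (m - t)) (by omega) (by omega)
  omega

/-- The blocks are compared from left to right. A count of the available letters bounds each
relabelling by the one used in `lead`. Either some letter is strictly smaller, which settles the
order, or the block agrees, and then the letters it uses up give the bound for the next block. -/
theorem eq_lead_or_lt {b x a u₁ u₂ u₃ : DecWord} (hx0 : x ≠ [])
    (hu : IsPacked (u₁ ++ u₂ ++ u₃)) (h₁ : pack u₁ = b) (h₂ : pack u₂ = x) (h₃ : pack u₃ = a)
    (h₂₁ : minLetter u₂ ≤ minLetter u₁) (h₂₃ : minLetter u₂ ≤ minLetter u₃) :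
    u₁ ++ u₂ ++ u₃ = lead b x a ∨ letters (u₁ ++ u₂ ++ u₃) < letters (lead b x a) := by
  have hb : IsPacked b := h₁ ▸ isPacked_pack u₁
  have hx : IsPacked x := h₂ ▸ isPacked_pack u₂
  have ha : IsPacked a := h₃ ▸ isPacked_pack u₃
  have hc1 := card_letterSet_pack u₁
  have hc2 := card_letterSet_pack u₂
  have hc3 := card_letterSet_pack u₃
  rw [h₁, hb.card_letterSet] at hc1
  rw [h₂, hx.card_letterSet] at hc2
  rw [h₃, ha.card_letterSet] at hc3
  have hmx := hx.maxLetter_pos hx0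
  set N := maxLetter (u₁ ++ u₂ ++ u₃) with hN
  set r := maxLetter b with hr
  set m := maxLetter x with hm
  set q := maxLetter a with hq
  have hmem : ∀ y, (y ∈ letterSet u₁ ∨ y ∈ letterSet u₂ ∨ y ∈ letterSet u₃) ↔ 1 ≤ y ∧ y ≤ N := by
    intro y
    rw [← hu.mem, letterSet_append, letterSet_append, Finset.mem_union, Finset.mem_union, or_assoc]
  have hcard : N ≤ r + m + q := by
    have e1 := Finset.card_union_le (letterSet u₁ ∪ letterSet u₂) (letterSet u₃)
    have e2 := Finset.card_union_le (letterSet u₁) (letterSet u₂)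
    rw [← letterSet_append, ← letterSet_append, hu.card_letterSet] at e1
    rw [← letterSet_append] at e2
    omega
  have hu20 : u₂ ≠ [] := by
    rintro rfl
    exact hx0 h₂.symm
  obtain ⟨φ₁, hφ₁, e₁⟩ := (pack_eq_iff hb).1 h₁
  obtain ⟨φ₂, hφ₂, e₂⟩ := (pack_eq_iff hx).1 h₂
  obtain ⟨φ₃, hφ₃, e₃⟩ := (pack_eq_iff ha).1 h₃
  have hv₁ : ∀ t, 1 ≤ t → t ≤ r → φ₁ t ∈ letterSet u₁ := fun t h1 h2 => by
    rw [e₁, letterSet_relabel]; exact Finset.mem_image_of_mem _ (hb.mem.2 ⟨h1, h2⟩)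
  have hv₂ : ∀ t, 1 ≤ t → t ≤ m → φ₂ t ∈ letterSet u₂ := fun t h1 h2 => by
    rw [e₂, letterSet_relabel]; exact Finset.mem_image_of_mem _ (hx.mem.2 ⟨h1, h2⟩)
  have hv₃ : ∀ t, 1 ≤ t → t ≤ q → φ₃ t ∈ letterSet u₃ := fun t h1 h2 => by
    rw [e₃, letterSet_relabel]; exact Finset.mem_image_of_mem _ (ha.mem.2 ⟨h1, h2⟩)
  rw [hb.letterSet_eq] at hφ₁
  rw [hx.letterSet_eq] at hφ₂
  rw [ha.letterSet_eq] at hφ₃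
  have hlead : lead b x a = relabel (· + (m + q)) b ++ (relabel (spread q) x ++ relabel (· + 1) a) :=
    rfl
  rw [List.append_assoc]
  have d₁ : ∀ t ∈ letterSet b, φ₁ t ≤ t + (m + q) := by
    intro t ht
    rw [hb.mem] at ht
    have := strictMonoOn_add_le (V := N) hφ₁ (fun t h1 h2 => ((hmem _).1 (.inl (hv₁ t h1 h2))).2)
      ht.1 ht.2
    omega
  rcases relabel_eq_or_lt d₁ with E₁ | L₁
  swap
  · right
    rw [hlead, e₁]
    simp only [letters_append]
    exact L₁ _ _
  rw [← e₁] at E₁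
  have hU₁ : ∀ y, y ∈ letterSet u₁ ↔ m + q + 1 ≤ y ∧ y ≤ m + q + r := fun y => by
    rw [E₁, hb.mem_add]
  have hcard23 : (letterSet u₂ ∪ letterSet u₃).card ≤ m + q := by
    have := Finset.card_union_le (letterSet u₂) (letterSet u₃)
    omega
  have hU₂₃ : ∀ y, y ∈ letterSet u₂ ∨ y ∈ letterSet u₃ → 1 ≤ y ∧ y ≤ m + q := by
    intro y hy
    have h1 := (hmem y).1 (.inr hy)
    refine ⟨h1.1, ?_⟩
    by_contra hlt
    -- The first block uses only letters above `m + q`. A letter `y` beyond `m + q` in the other two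
    -- blocks would therefore give them at least `m + q + 1` distinct letters.
    have hsub : insert y (Finset.Icc 1 (m + q)) ⊆ letterSet u₂ ∪ letterSet u₃ := by
      intro z hz
      rw [Finset.mem_insert, Finset.mem_Icc] at hz
      rw [Finset.mem_union]
      rcases hz with rfl | hz
      · exact hy
      · rcases (hmem z).2 (by omega) with h | h
        · have := (hU₁ z).1 h
          omega
        · exact h
    have := Finset.card_le_card hsub
    rw [Finset.card_insert_of_notMem (by rw [Finset.mem_Icc]; omega), Nat.card_Icc] at this
    omega
  -- The middle block attains the overall minimum, which is 1 in a packed word. This is where the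
  -- conditions on the minima enter.
  have hone : φ₂ 1 = 1 := by
    obtain ⟨y, hy, hy1, hy2⟩ := exists_minLetter hu20
    have hy0 : 1 ≤ y ∧ y ≤ N := (hmem y).1 (.inr (.inl hy))
    have hle : ∀ z, 1 ≤ z → z ≤ N → y ≤ z := by
      intro z h1 h2
      rcases (hmem z).2 ⟨h1, h2⟩ with h | h | h
      · have := h₂₁.trans (Finset.min_le h)
        rw [hy1] at this
        exact WithTop.coe_le_coe.1 this
      · exact hy2 z h
      · have := h₂₃.trans (Finset.min_le h)
        rw [hy1] at this
        exact WithTop.coe_le_coe.1 this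
    have hy11 : y = 1 := le_antisymm (hle 1 le_rfl (by omega)) hy0.1
    rw [hy11, e₂, letterSet_relabel, Finset.mem_image] at hy
    obtain ⟨t, ht, ht1⟩ := hy
    rw [hx.mem] at ht
    have h3 := hφ₂.monotoneOn (a := 1) (b := t) (by simp; omega) (by simp; omega) ht.1
    have h4 := ((hmem _).1 (.inr (.inl (hv₂ 1 le_rfl hmx)))).1
    omega
  have d₂ : ∀ t ∈ letterSet x, φ₂ t ≤ spread q t := by
    intro t ht
    rw [hx.mem] at ht
    have := strictMonoOn_add_le (V := m + q) hφ₂ (fun t h1 h2 => (hU₂₃ _ (.inl (hv₂ t h1 h2))).2)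
      ht.1 ht.2
    unfold spread
    split_ifs with h1
    · obtain rfl : t = 1 := by omega
      exact hone.le
    · omega
  rcases relabel_eq_or_lt d₂ with E₂ | L₂
  swap
  · right
    rw [hlead, E₁, letters_append, letters_append, letters_append, letters_append, e₂]
    exact append_lt_append_left _ (L₂ _ _)
  rw [← e₂] at E₂
  have hU₂ : ∀ y, y ∈ letterSet u₂ ↔ y = 1 ∨ (q + 2 ≤ y ∧ y ≤ q + m) := fun y => by
    rw [E₂, hx.mem_spread hx0]
  have hU₃ : ∀ y ∈ letterSet u₃, y ≤ q + 1 := by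
    intro y hy
    have h1 := hU₂₃ y (.inr hy)
    by_contra hlt
    have hK := (hmem (q + m)).1 (.inr (.inl ((hU₂ _).2 (by omega))))
    -- The letters `2, …, q + 1` are used by neither of the first two blocks; together with `y` they
    -- would give the last block `q + 1` distinct letters instead of `q`.
    have hsub : insert y (Finset.Icc 2 (q + 1)) ⊆ letterSet u₃ := by
      intro z hz
      rw [Finset.mem_insert, Finset.mem_Icc] at hz
      rcases hz with rfl | hz
      · exact hy
      · rcases (hmem z).2 (by omega) with h | h | h
        · have := (hU₁ z).1 h
          omega
        · have := (hU₂ z).1 h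
          omega
        · exact h
    have := Finset.card_le_card hsub
    rw [Finset.card_insert_of_notMem (by rw [Finset.mem_Icc]; omega), Nat.card_Icc] at this
    omega
  have d₃ : ∀ t ∈ letterSet a, φ₃ t ≤ t + 1 := by
    intro t ht
    rw [ha.mem] at ht
    have := strictMonoOn_add_le (V := q + 1) hφ₃ (fun t h1 h2 => hU₃ _ (hv₃ t h1 h2)) ht.1 ht.2
    omega
  rcases relabel_eq_or_lt d₃ with E₃ | L₃
  · left
    rw [← e₃] at E₃
    rw [hlead, E₁, E₂, E₃]
  · right
    rw [hlead, E₁, E₂, e₃, letters_append, letters_append, letters_append, letters_append]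
    refine append_lt_append_left _ (append_lt_append_left _ ?_)
    simpa using L₃ [] []

/-- The inequalities are strict, so the leading word occurs in the grafting whether the
half-products are strict or weak. -/
theorem minLetter_lead {b x a : DecWord} (hb : IsPacked b) (hx : IsPacked x) (hx0 : x ≠ [])
    (ha : IsPacked a) :
    minLetter (relabel (spread (maxLetter a)) x) <
        minLetter (relabel (· + (maxLetter x + maxLetter a)) b) ∧
      minLetter (relabel (spread (maxLetter a)) x) < minLetter (relabel (· + 1) a) := by
  have hm := hx.maxLetter_pos hx0
  have h1 : minLetter (relabel (spread (maxLetter a)) x) = (1 : ℕ) := by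
    rw [minLetter_eq_coe]
    refine ⟨(hx.mem_spread hx0).2 (.inl rfl), fun y hy => ?_⟩
    rw [hx.mem_spread hx0] at hy
    omega
  have key : ∀ l : DecWord, (∀ y ∈ letterSet l, 1 < y) → ((1 : ℕ) : WithTop ℕ) < minLetter l := by
    intro l hl
    by_cases h : l = []
    · subst h; exact WithTop.coe_lt_top 1
    · obtain ⟨y, hy, hy1, -⟩ := exists_minLetter h
      rw [hy1]
      exact_mod_cast hl y hy
  rw [h1]
  constructor <;> refine key _ fun y hy => ?_
  · rw [hb.mem_add] at hy; omega
  · rw [ha.mem_add] at hy; omega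

/-! ### Bases with prescribed leading terms -/

section

variable {k : Type*} [Field k]

/-- In a linear relation, look at a leading word with the largest row of letters. Decorations are
not compared: the other terms have strictly smaller rows, so distinct leading words with equal rows
do not interfere. -/
theorem linearIndependent_of_lead {τ : Type*} {v : τ → QShd k} {e : τ → DPW}
    (he : Function.Injective e) (h1 : ∀ t, v t (e t) = 1)
    (h2 : ∀ t u, v t u ≠ 0 → u = e t ∨ letters u.word < letters (e t).word) :
    LinearIndependent k v := by
  rw [linearIndependent_iff]
  intro l hl
  by_contra hne
  obtain ⟨t, ht, hmax⟩ := Finset.exists_max_image l.support (fun t => letters (e t).word)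
    (Finsupp.support_nonempty_iff.2 hne)
  have h := DFunLike.congr_fun hl (e t)
  rw [Finsupp.linearCombination_apply, Finsupp.sum, Finsupp.finsetSum_apply,
    Finset.sum_eq_single_of_mem t ht] at h
  · rw [Finsupp.smul_apply, h1, smul_eq_mul, mul_one] at h
    exact Finsupp.mem_support_iff.1 ht h
  · intro t' ht' hne'
    rw [Finsupp.smul_apply, smul_eq_mul]
    by_contra h0
    rcases h2 t' (e t) (right_ne_zero_of_mul h0) with h3 | h3
    · exact hne' (he h3).symm
    · exact absurd (hmax t' ht') (not_le.2 h3)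

theorem single_mem_span_of_lead {τ : Type*} {v : τ → QShd k} {e : τ → DPW}
    (he : Function.Surjective e) (h1 : ∀ t, v t (e t) = 1)
    (h2 : ∀ t u, v t u ≠ 0 → u = e t ∨ letters u.word < letters (e t).word)
    (h3 : ∀ t, v t ∈ lengthSubmodule k (e t).word.length) (u : DPW) :
    (Finsupp.single u 1 : QShd k) ∈
      Submodule.span k (v '' {t | (e t).word.length = u.word.length}) := by
  classical
  set n := u.word.length with hn
  -- The lexicographic order on all lists is not well-founded; it is on this finite set, which
  -- contains the rows of all packed words of length `n`.
  set S : Set (List ℕ) := {l | l.length = n ∧ ∀ x ∈ l, x ≤ n} with hS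
  have hfin : S.Finite := by
    refine ((List.finite_length_eq (Fin (n + 1)) n).image (List.map Fin.val)).subset ?_
    rintro l ⟨hl, hl'⟩
    refine ⟨l.map (Fin.ofNat (n + 1)), by simpa using hl, ?_⟩
    rw [List.map_map]
    conv_rhs => rw [← List.map_id l]
    refine List.map_congr_left fun x hx => ?_
    simp only [Function.comp, Fin.ofNat, id]
    exact Nat.mod_eq_of_lt (Nat.lt_succ_of_le (hl' x hx))
  have hmem : ∀ w : DPW, w.word.length = n → letters w.word ∈ S := by
    intro w hw
    refine ⟨by simpa [letters] using hw, fun x hx => ?_⟩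
    obtain ⟨p, hp, rfl⟩ := List.mem_map.1 hx
    exact hw ▸ w.packed.le_length hp
  have hwf : S.WellFoundedOn (· < ·) := hfin.wellFoundedOn
  have key : ∀ l ∈ S, ∀ w : DPW, letters w.word = l → w.word.length = n →
      (Finsupp.single w 1 : QShd k) ∈ Submodule.span k (v '' {t | (e t).word.length = n}) := by
    intro l hl
    refine hwf.induction hl (P := fun l => ∀ w : DPW, letters w.word = l → w.word.length = n →
      (Finsupp.single w 1 : QShd k) ∈ Submodule.span k (v '' {t | (e t).word.length = n})) ?_
    rintro _ - ih w rfl hw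
    obtain ⟨t, rfl⟩ := he w
    have hsum : (Finsupp.single (e t) 1 : QShd k) =
        v t - ∑ w ∈ (v t).support.erase (e t), v t w • Finsupp.single w 1 := by
      have h4 : v t = ∑ w ∈ (v t).support, v t w • (Finsupp.single w 1 : QShd k) := by
        conv_lhs => rw [← Finsupp.sum_single (v t)]
        simp [Finsupp.sum]
      rw [← Finset.add_sum_erase _ _ (Finsupp.mem_support_iff.2 (by rw [h1]; exact one_ne_zero)),
        h1, one_smul] at h4
      exact eq_sub_of_add_eq h4.symm
    rw [hsum]
    refine sub_mem (Submodule.subset_span ⟨t, hw, rfl⟩) (sum_mem fun w hw' => ?_)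
    rw [Finset.mem_erase, Finsupp.mem_support_iff] at hw'
    have hlen : w.word.length = n := by
      have := (Finsupp.mem_supported k _).1 (h3 t) (Finsupp.mem_support_iff.2 hw'.2)
      rw [← hw]
      exact this
    refine Submodule.smul_mem _ _ (ih _ (hmem w hlen) ?_ w rfl hlen)
    exact (h2 t w hw'.2).resolve_left hw'.1
  exact key _ (hmem u rfl) u rfl rfl

/-! ### Freeness -/

/-- The word of an optional nonempty packed word. -/
def optWord (b : Option DPW) : DecWord := b.elim [] DPW.word

theorem isPacked_optWord (b : Option DPW) : IsPacked (optWord b) := by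
  cases b with
  | none => exact isPacked_nil
  | some b => exact b.packed

theorem exists_optWord {b : DecWord} (hb : IsPacked b) : ∃ b' : Option DPW, optWord b' = b := by
  by_cases h : b = []
  · exact ⟨none, h.symm⟩
  · exact ⟨some ⟨b, h, hb⟩, rfl⟩

theorem optWord_injective : Function.Injective optWord := by
  intro b b' h
  cases b <;> cases b'
  · rfl
  · exact absurd h.symm (DPW.ne_nil _)
  · exact absurd h (DPW.ne_nil _)
  · rw [DPW.ext h]

/-- The leading term of the grafting of a triple of words. -/
def leadWord {X : Set DPW} (t : Option DPW × X × Option DPW) : DPW where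
  word := lead (optWord t.1) t.2.1.1.word (optWord t.2.2)
  ne_nil := by simp [lead, t.2.1.1.ne_nil]
  packed := ⟨_, letterSet_lead (isPacked_optWord _) t.2.1.1.packed t.2.1.1.ne_nil
    (isPacked_optWord _)⟩

theorem length_leadWord {X : Set DPW} (t : Option DPW × X × Option DPW) :
    (leadWord t).word.length = tripleLength t := by
  obtain ⟨_ | b, x, _ | a⟩ := t <;> (simp [leadWord, lead, tripleLength, optWord]; try omega)

theorem leadWord_bijective :
    Function.Bijective (leadWord : Option DPW × indecomposables × Option DPW → DPW) := by
  constructor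
  · rintro ⟨b, x, a⟩ ⟨b', x', a'⟩ h
    obtain ⟨h1, h2, h3⟩ := lead_injective (isPacked_optWord b) x.1.packed x.1.ne_nil
      (isPacked_optWord a) x.2.1 x.2.2 (isPacked_optWord b') x'.1.packed x'.1.ne_nil
      (isPacked_optWord a') x'.2.1 x'.2.2 (congrArg DPW.word h)
    rw [optWord_injective h1, optWord_injective h3, Subtype.ext (DPW.ext h2)]
  · intro u
    obtain ⟨b, x, a, hb, hx, hx0, h1, h2, ha, hu⟩ := exists_eq_lead u.packed u.ne_nil
    obtain ⟨b', rfl⟩ := exists_optWord hb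
    obtain ⟨a', rfl⟩ := exists_optWord ha
    exact ⟨(b', ⟨⟨x, hx0, hx⟩, h1, h2⟩, a'), DPW.ext hu.symm⟩

theorem relProd_mem_lengthSubmodule (R : WithTop ℕ → WithTop ℕ → Prop) (u v : DPW) :
    relProd k R (Finsupp.single u 1) (Finsupp.single v 1) ∈
      lengthSubmodule k (u.word.length + v.word.length) := by
  rw [← ofWord_word, ← ofWord_word, relProd_ofWord R u.ne_nil u.packed v.ne_nil v.packed]
  refine sum_mem fun w hw => ?_
  rw [mem_qsFinset] at hw
  rw [← length_of_mem_qsWords hw, ofWord]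
  split_ifs with h
  · exact single_mem_lengthSubmodule ⟨w, h.1, h.2⟩
  · exact zero_mem _

open Classical in
-- The hypotheses `R₁ ⊤ 0` and `R₂ 0 ⊤` let the empty word act as a unit in the outer places, so one
-- formula covers the present and the absent factors.
theorem wordGrafting_eq_sum {R₁ R₂ : WithTop ℕ → WithTop ℕ → Prop} (h₁ : OrdInv R₁)
    (h₂ : OrdInv R₂) (h₁' : R₁ ⊤ 0) (h₂' : R₂ 0 ⊤) {X : Set DPW}
    (t : Option DPW × X × Option DPW) :
    wordGrafting (relProd k R₂) (relProd k R₁) t =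
      ∑ u ∈ (qsFinset R₁ (optWord t.1) t.2.1.1.word).biUnion
        (fun w => qsFinset R₂ w (optWord t.2.2)), ofWord k u := by
  obtain ⟨b, ⟨x, hx⟩, a⟩ := t
  rw [← sum_sum_left]
  have hleft : (b.map fun u => (Finsupp.single u 1 : QShd k)).elim (Finsupp.single x 1)
      (fun y => relProd k R₁ y (Finsupp.single x 1)) =
      ∑ w ∈ qsFinset R₁ (optWord b) x.word, ofWord k w := by
    cases b with
    | none =>
      simp only [optWord, Option.map_none, Option.elim_none]
      rw [sum_qsFinset_nil_left h₁ x.packed x.ne_nil, if_pos h₁', ofWord_word]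
    | some b =>
      simp only [optWord, Option.map_some, Option.elim_some]
      rw [← relProd_ofWord _ b.ne_nil b.packed x.ne_nil x.packed, ofWord_word, ofWord_word]
  have hw : ∀ w ∈ qsFinset R₁ (optWord b) x.word, w ≠ [] ∧ IsPacked w := fun w hw => by
    rw [mem_qsFinset] at hw
    exact ⟨ne_nil_of_mem_qsWords hw (.inr x.ne_nil), hw.1⟩
  simp only [wordGrafting, grafting]
  rw [hleft]
  cases a with
  | none =>
    simp only [optWord, Option.map_none, Option.elim_none]
    refine Finset.sum_congr rfl fun w hw' => ?_
    rw [sum_qsFinset_nil_right h₂ (hw w hw').2 (hw w hw').1, if_pos h₂']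
  | some a =>
    simp only [Option.map_some, Option.elim_some]
    rw [map_sum, LinearMap.sum_apply]
    refine Finset.sum_congr rfl fun w hw' => ?_
    rw [← ofWord_word, relProd_ofWord _ (hw w hw').1 (hw w hw').2 a.ne_nil a.packed]
    rfl

/-- The products attached to suitable relations are free, the indecomposable words being free
generators. -/
theorem isFreeNSh_relProd {R₁ R₂ : WithTop ℕ → WithTop ℕ → Prop} (h₁ : OrdInv R₁)
    (h₂ : OrdInv R₂) (hle₁ : ∀ x y, R₁ x y → y ≤ x) (hlt₁ : ∀ x y, y < x → R₁ x y)
    (hle₂ : ∀ x y, R₂ x y → x ≤ y) (hlt₂ : ∀ x y, x < y → R₂ x y)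
    (h : IsNSh (relProd k R₂) (relProd k R₁)) :
    IsFreeNSh.{w} (relProd k R₂) (relProd k R₁) := by
  classical
  have hp := relProd_mem_lengthSubmodule (k := k) R₂
  have hs := relProd_mem_lengthSubmodule (k := k) R₁
  have happly : ∀ (t : Option DPW × indecomposables × Option DPW) (u : DPW),
      wordGrafting (relProd k R₂) (relProd k R₁) t u =
        if u.word ∈ (qsFinset R₁ (optWord t.1) t.2.1.1.word).biUnion
          (fun w => qsFinset R₂ w (optWord t.2.2)) then 1 else 0 := fun t u => by
    rw [wordGrafting_eq_sum h₁ h₂ (hlt₁ _ _ (WithTop.coe_lt_top 0)) (hlt₂ _ _ (WithTop.coe_lt_top 0)),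
      sum_ofWord_apply]
  have hone : ∀ t : Option DPW × indecomposables × Option DPW,
      wordGrafting (relProd k R₂) (relProd k R₁) t (leadWord t) = 1 := by
    intro t
    have hb := isPacked_optWord t.1
    have ha := isPacked_optWord t.2.2
    have hx := t.2.1.1.packed
    have hmin := minLetter_lead hb hx t.2.1.1.ne_nil ha
    rw [happly, if_pos]
    rw [mem_biUnion_left h₁]
    refine ⟨(leadWord t).packed, _, _, _, (List.append_assoc _ _ _).symm, ?_, ?_, ?_, hlt₁ _ _ hmin.1, ?_⟩
    · rw [pack_relabel ((add_strictMono _).strictMonoOn _), hb.pack_eq]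
    · rw [pack_relabel ((spread_strictMono _).strictMonoOn _), hx.pack_eq]
    · rw [pack_relabel ((add_strictMono _).strictMonoOn _), ha.pack_eq]
    · rw [minLetter_append, min_eq_right hmin.1.le]
      exact hlt₂ _ _ hmin.2
  have htri : ∀ (t : Option DPW × indecomposables × Option DPW) (u : DPW),
      wordGrafting (relProd k R₂) (relProd k R₁) t u ≠ 0 →
        u = leadWord t ∨ letters u.word < letters (leadWord t).word := by
    intro t u hu
    rw [happly, ne_eq, ite_eq_right_iff, Classical.not_imp, mem_biUnion_left h₁] at hu
    obtain ⟨⟨hpk, u₁, u₂, u₃, hu, e1, e2, e3, r1, r2⟩, -⟩ := hu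
    have l1 := hle₁ _ _ r1
    have l2 := hle₂ _ _ r2
    -- Weak inequalities are enough for the upper bound: the minimum of the first two blocks is that
    -- of the middle one.
    rw [minLetter_append, min_eq_right l1] at l2
    rw [hu] at hpk
    have := eq_lead_or_lt t.2.1.1.ne_nil hpk e1 e2 e3 l1 l2
    rw [← hu] at this
    exact this.imp_left fun h => DPW.ext h
  have hspan : ∀ u : DPW, (Finsupp.single u 1 : QShd k) ∈
      Submodule.span k (wordGrafting (relProd k R₂) (relProd k R₁) ''
        {t : Option DPW × indecomposables × Option DPW | tripleLength t = u.word.length}) := by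
    intro u
    have := single_mem_span_of_lead leadWord_bijective.2 hone htri
      (fun t => by rw [length_leadWord]; exact wordGrafting_mem hp hs t) u
    simpa only [length_leadWord] using this
  have hli := linearIndependent_of_lead leadWord_bijective.1 hone htri
  have htop : ⊤ ≤ Submodule.span k (Set.range (wordGrafting (X := indecomposables)
      (relProd k R₂) (relProd k R₁))) := by
    rintro y -
    induction y using single_induction with
    | add x y hx hy => exact add_mem hx hy
    | smul c x hx => exact Submodule.smul_mem _ _ hx
    | single u => exact Submodule.span_mono (Set.image_subset_range _ _) (hspan u)
  have hβ : ∀ t, Module.Basis.mk hli htop t = wordGrafting (relProd k R₂) (relProd k R₁) t :=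
    fun t => Module.Basis.mk_apply hli htop t
  refine isFreeNSh_of_basis h (Module.Basis.mk hli htop) hβ hp hs fun u => ?_
  rw [Module.Basis.coe_mk]
  exact hspan u

end

end QSh

theorem mainTheorem9 (k : Type u) [Field k] :
    QSh.CoproductIdentities (QSh.prec k) (QSh.succ k) (QSh.bullet k)
      (QSh.deltaPrec k) (QSh.deltaSucc k) ∧
    QSh.IsBidendriform (QSh.opProd (QSh.succ k)) (QSh.opProd (QSh.preceq k))
      (QSh.opCoprd (QSh.deltaSucc k)) (QSh.opCoprd (QSh.deltaPrec k)) ∧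
    QSh.IsBidendriform (QSh.opProd (QSh.succeq k)) (QSh.opProd (QSh.prec k))
      (QSh.opCoprd (QSh.deltaSucc k)) (QSh.opCoprd (QSh.deltaPrec k)) ∧
    QSh.IsFreeNSh.{w} (QSh.preceq k) (QSh.succ k) ∧
    QSh.IsFreeNSh.{w} (QSh.prec k) (QSh.succeq k) := by
  have h1 := QSh.isNSh_preceq_succ (k := k)
  have h2 := QSh.isNSh_prec_succeq (k := k)
  have hs1 : QSh.preceq k + QSh.succ k = QSh.relProd k fun _ _ => True := by
    rw [← QSh.star_eq, QSh.preceq]; abel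
  have hs2 : QSh.prec k + QSh.succeq k = QSh.relProd k fun _ _ => True := by
    rw [← QSh.star_eq, QSh.succeq]; abel
  rw [QSh.preceq_eq] at *
  rw [QSh.succeq_eq] at *
  have h0 : (0 : WithTop ℕ) < ⊤ := WithTop.coe_lt_top 0
  refine ⟨QSh.coproductIdentities, ?_, ?_, ?_, ?_⟩
  · exact QSh.isBidendriform_of_relProd QSh.ordInv_le QSh.ordInv_gt h0.le (not_le.2 h0)
      (not_lt.2 h0.le) h0 h1 hs1
  · exact QSh.isBidendriform_of_relProd QSh.ordInv_lt QSh.ordInv_ge h0 (not_lt.2 h0.le)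
      (not_le.2 h0) h0.le h2 hs2
  · exact QSh.isFreeNSh_relProd QSh.ordInv_gt QSh.ordInv_le (fun _ _ h => le_of_lt h)
      (fun _ _ h => h) (fun _ _ h => h) (fun _ _ h => le_of_lt h) h1
  · exact QSh.isFreeNSh_relProd QSh.ordInv_ge QSh.ordInv_lt (fun _ _ h => h)
      (fun _ _ h => le_of_lt h) (fun _ _ h => le_of_lt h) (fun _ _ h => h) h2
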